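/- **Setting.** Let $m\ge 3$, $n\ge 2$, let $G=(V,E)$ be a tree with $V=\{1,\dots,m\}$, let $\Gamma\subset V$ be its set of leaves, and for $k\in\Gamma$ let $\ell_k$ be the neighbour of $k$. Let $X$ be a set of $n$ points. For every edge let $C^{(k,\ell)}\in\mathbb R_{\ge0}^{n\times n}$ be a cost matrix, with $C^{(\ell,k)}=(C^{(k,\ell)})^{T}$, and put $\mathbf C(x)=\sum_{\{k,\ell\}\in E}C^{(k,\ell)}(x_k,x_\ell)$ for $x\in X^m$. For $k\in\Gamma$ let $\mu_k$ be a probability vector on $X$. A plan is a nonnegative tensor $\mathbf B$ on $X^m$ whose marginals satisfy $P_k(\mathbf B)=\mu_k$ for all $k\in\Gamma$; it is an $\epsilon$-approximate solution of the tree-structured multi-marginal optimal transport (MOT) problem if $\langle\mathbf C,\mathbf B\rangle\le\langle\mathbf C,\mathbf B'\rangle+\epsilon$ for all plans $\mathbf B'$. Let $R_C^\Gamma=\max_{k\in\Gamma}\max_{x,y}C^{(k,\ell_k)}(x,y)$, and let $\bar d(G)$ be the average of the distance in $G$ over all pairs of distinct leaves. **Algorithm.** Given $\epsilon>0$, compute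 $\eta=\epsilon/(2m\log n)$, $\epsilon'=\epsilon/(8R_C^\Gamma)$ and $K^{(k,\ell)}=\exp(-C^{(k,\ell)}/\eta)$ (entrywise). For scaling vectors $u=(u_k)_{k\in\Gamma}$ put $\mathbf B_u(x)=\exp(-\mathbf C(x)/\eta)\prod_{k\in\Gamma}u_k(x_k)\mu_k(x_k)$. The message from $k$ to a neighbour $\ell$ is $m_{k\to\ell}(x_\ell)=\sum_{x_k}K^{(\ell,k)}(x_\ell,x_k)\,q_{k\to\ell}(x_k)$, where $q_{k\to\ell}=u_k\odot\mu_k$ if $k\in\Gamma$ and $q_{k\to\ell}=\prod_{j\in N(k)\setminus\ell}m_{j\to k}$ otherwise. 1. (Sinkhorn belief propagation.) Start with $u_k=\mathbf 1$ for all $k\in\Gamma$ and an arbitrary (possibly random) $k^{(0)}\in\Gamma$; compute the messages directed towards $k^{(0)}$ and set $u_{k^{(0)}}\leftarrow 1/m_{\ell_{k^{(0)}}\to k^{(0)}}$. For $t=1,2,\dots$, while $\sum_{k\in\Gamma}\|P_k(\mathbf B_u)-\mu_k\|_1\ge\epsilon'$: pick $k^{(t)}$ uniformly at random in $\Gamma\setminus\{k^{(t-1)}\}$,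 given the past; recompute the messages on the path from $k^{(t-1)}$ to $k^{(t)}$, in this order; set $u_{k^{(t)}}\leftarrow 1/m_{\ell_{k^{(t)}}\to k^{(t)}}$. 2. Recompute the messages directed away from the last chosen leaf, and from all messages compute the bi-marginals $P_{k,\ell}(\mathbf B_u)$ on all edges and the marginals $P_{\ell_k}(\mathbf B_u)$. 3. (Rounding.) For each $k\in\Gamma$ replace the bi-marginal $F$ on the edge $(\ell_k,k)$ by the following matrix, with $r=P_{\ell_k}(\mathbf B_u)$ and $c=\mu_k$: scale row $i$ of $F$ by $\min(r_i/r_i(F),1)$ to get $F'$, scale column $j$ of $F'$ by $\min(c_j/c_j(F'),1)$ to get $F''$, and return $F''+e\,f^T/\|e\|_1$, where $r(\cdot)$ and $c(\cdot)$ denote row and column sums, $e=r-r(F'')$, $f=c-c(F'')$, and $a/0:=0$. The output is the resulting family $(\widehat B_{k,\ell})_{(k,\ell)\in E}$. It represents the tensor $\widehat{\mathbf B}(x)=\prod_{\{k,\ell\}\in E}\widehat B_{k,\ell}(x_k,x_\ell)\big/\prod_{v\in V}\widehat P_v(x_v)^{\deg v-1}$, where $\widehat P_v$ is the marginal at $v$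 of the output matrix $\widehat B_{v,\ell}$ for a fixed neighbour $\ell$ of $v$. **Operation count.** Let $T\in\mathbb N\cup\{\infty\}$ be the number of elementary real operations ($+,-,\times,/$, negation, absolute value, $\min$, comparisons in a maximum, $\exp$, $\log$) of the whole algorithm. At each vertex the product of all incoming messages is stored and updated by one division and one multiplication per entry, so that the cost of updating a message does not depend on the degrees. Evaluations of the stopping criterion and the choice of $k^{(t)}$ are not charged. **Theorem.** There is a universal constant $c>0$ such that for all data as above and all $0<\epsilon\le|\Gamma|R_C^\Gamma$ the following holds. Almost surely the algorithm halts, $\widehat{\mathbf B}$ has the bi-marginals $\widehat B_{k,\ell}$ on all edges, and $\widehat{\mathbf B}$ is an $\epsilon$-approximate solution of the tree-structured MOT problem. Moreover $T$ is a random variable and $$\mathbb E[T]\le c\,\frac{\bar d(G)\,m\,|\Gamma|^2\,n^2\,(R_C^\Gamma)^2\log n}{\epsilon^2}.$$ -/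

import Mathlib

open scoped BigOperators ENNReal

/-- A value together with the number of elementary real operations spent on computing it. -/
structure Counted (α : Type) where
  val : α
  ops : ℕ

namespace Counted

instance : Monad Counted where
  pure a := ⟨a, 0⟩
  bind a f := ⟨(f a.val).val, a.ops + (f a.val).ops⟩

/-! Elementary operations; each of them costs one unit. -/

noncomputable def add (a b : ℝ) : Counted ℝ := ⟨a + b, 1⟩
noncomputable def sub (a b : ℝ) : Counted ℝ := ⟨a - b, 1⟩
noncomputable def mul (a b : ℝ) : Counted ℝ := ⟨a * b, 1⟩
/-- Division, with the convention `a / 0 = 0`. -/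
noncomputable def div (a b : ℝ) : Counted ℝ := ⟨a / b, 1⟩
noncomputable def neg (a : ℝ) : Counted ℝ := ⟨-a, 1⟩
noncomputable def abs (a : ℝ) : Counted ℝ := ⟨|a|, 1⟩
noncomputable def min (a b : ℝ) : Counted ℝ := ⟨Min.min a b, 1⟩
noncomputable def exp (a : ℝ) : Counted ℝ := ⟨Real.exp a, 1⟩
noncomputable def log (a : ℝ) : Counted ℝ := ⟨Real.log a, 1⟩

/-- Compute all entries of a finite array: the costs of the entries add up. -/
def tabulate {ι α : Type} [Fintype ι] (f : ι → Counted α) : Counted (ι → α) :=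
  ⟨fun i => (f i).val, ∑ i, (f i).ops⟩

/-- Compute finitely many numbers and add them up, one addition for each. -/
noncomputable def sum {ι : Type} [Fintype ι] (f : ι → Counted ℝ) : Counted ℝ :=
  ⟨∑ i, (f i).val, ∑ i, (f i).ops + Fintype.card ι⟩

/-- The maximum of finitely many numbers, one comparison for each. -/
noncomputable def maximum {ι : Type} [Fintype ι] (f : ι → ℝ) : Counted ℝ :=
  ⟨⨆ i, f i, Fintype.card ι⟩

end Counted

/-- The data of a tree-structured multi-marginal optimal transport problem with `m` vertices and
`n` support points: a tree `G`, a nonnegative cost matrix for every edge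
(`C k l x y` is the cost of `x` at vertex `k` together with `y` at vertex `l`, so that `C l k` is
the transpose of `C k l`), and a probability vector for every leaf of the tree
(the values of `mu` at other vertices play no role). -/
structure TreeMOT (m n : ℕ) where
  G : SimpleGraph (Fin m)
  isTree : G.IsTree
  C : Fin m → Fin m → Matrix (Fin n) (Fin n) ℝ
  C_transpose : ∀ k l, G.Adj k l → C l k = (C k l).transpose
  C_nonneg : ∀ k l, G.Adj k l → ∀ x y, 0 ≤ C k l x y
  mu : Fin m → Fin n → ℝ
  mu_nonneg : ∀ k, (∃! l, G.Adj k l) → ∀ x, 0 ≤ mu k x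
  mu_sum : ∀ k, (∃! l, G.Adj k l) → ∑ x, mu k x = 1

namespace TreeMOT

variable {m n : ℕ}

open scoped Classical in
/-- The set `Γ` of leaves of the tree: the vertices with exactly one neighbour. -/
noncomputable def leaves (M : TreeMOT m n) : Finset (Fin m) :=
  Finset.univ.filter fun k => ∃! l, M.G.Adj k l

open scoped Classical in
/-- The edges of the tree, each listed once. -/
noncomputable def edges (M : TreeMOT m n) : Finset (Fin m × Fin m) :=
  Finset.univ.filter fun p => p.1 < p.2 ∧ M.G.Adj p.1 p.2

open scoped Classical in
/-- A neighbour of `k`; the unique one if `k` is a leaf. -/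
noncomputable def nbr (M : TreeMOT m n) (k : Fin m) : Fin m :=
  if h : ∃ l, M.G.Adj k l then h.choose else k

/-- The largest entry of the cost matrices on the edges at the leaves. -/
noncomputable def leafCost (M : TreeMOT m n) : ℝ :=
  ⨆ i : {k // k ∈ M.leaves} × Fin n × Fin n, M.C i.1 (M.nbr i.1) i.2.1 i.2.2

/-- The average distance between two distinct leaves. -/
noncomputable def avgLeafDist (M : TreeMOT m n) : ℝ :=
  (∑ k ∈ M.leaves, ∑ l ∈ M.leaves.erase k, (M.G.dist k l : ℝ)) /
    ((M.leaves.card : ℝ) * ((M.leaves.card : ℝ) - 1))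

/-! ### The optimal transport problem -/

/-- The graph-structured cost tensor. -/
noncomputable def costTensor (M : TreeMOT m n) (x : Fin m → Fin n) : ℝ :=
  ∑ p ∈ M.edges, M.C p.1 p.2 (x p.1) (x p.2)

/-- The marginal of a tensor at one vertex. -/
def marginal (B : (Fin m → Fin n) → ℝ) (k : Fin m) (a : Fin n) : ℝ :=
  ∑ x : Fin m → Fin n with x k = a, B x

/-- The bi-marginal of a tensor at two vertices. -/
def bimarginal (B : (Fin m → Fin n) → ℝ) (k l : Fin m) : Matrix (Fin n) (Fin n) ℝ :=
  fun a b => ∑ x : Fin m → Fin n with x k = a ∧ x l = b, B x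

/-- Transport plans: nonnegative tensors with the prescribed marginals at the leaves. -/
def IsFeasible (M : TreeMOT m n) (B : (Fin m → Fin n) → ℝ) : Prop :=
  (∀ x, 0 ≤ B x) ∧ ∀ k ∈ M.leaves, marginal B k = M.mu k

/-- The total cost of a tensor. -/
noncomputable def totalCost (M : TreeMOT m n) (B : (Fin m → Fin n) → ℝ) : ℝ :=
  ∑ x, M.costTensor x * B x

/-- Transport plans that are optimal up to an error `ε`. -/
def IsApproxSolution (M : TreeMOT m n) (ε : ℝ) (B : (Fin m → Fin n) → ℝ) : Prop :=
  M.IsFeasible B ∧ ∀ B', M.IsFeasible B' → M.totalCost B ≤ M.totalCost B' + ε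

/-! ### Sinkhorn belief propagation -/

/-- The tensor given by the regularization parameter `η` and the scaling vectors `u`. -/
noncomputable def scaledTensor (M : TreeMOT m n) (η : ℝ) (u : Fin m → Fin n → ℝ)
    (x : Fin m → Fin n) : ℝ :=
  Real.exp (-(M.costTensor x / η)) * ∏ k ∈ M.leaves, (u k (x k) * M.mu k (x k))

/-- The total violation of the marginal constraints, used in the stopping criterion. -/
noncomputable def marginalError (M : TreeMOT m n) (η : ℝ) (u : Fin m → Fin n → ℝ) : ℝ :=
  ∑ k ∈ M.leaves, ∑ a, |marginal (M.scaledTensor η u) k a - M.mu k a|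

/-- Parameters computed before the iteration. -/
structure Params (m n : ℕ) where
  eta : ℝ
  tol : ℝ
  K : Fin m → Fin m → Matrix (Fin n) (Fin n) ℝ

open scoped Classical in
/-- Compute `η = ε / (2 m log n)`, the tolerance `ε' = ε / (8 R)`, and the kernel matrices
`K = exp (- C / η)` on the edges. -/
noncomputable def setup (M : TreeMOT m n) (ε : ℝ) : Counted (Params m n) := do
  let r ← Counted.maximum fun i : {k // k ∈ M.leaves} × Fin n × Fin n =>
    M.C i.1 (M.nbr i.1) i.2.1 i.2.2
  let a ← Counted.mul 2 (m : ℝ)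
  let b ← Counted.log (n : ℝ)
  let c ← Counted.mul a b
  let eta ← Counted.div ε c
  let d ← Counted.mul 8 r
  let tol ← Counted.div ε d
  let K ← Counted.tabulate fun k : Fin m => Counted.tabulate fun l : Fin m =>
    if M.G.Adj k l then
      Counted.tabulate fun x : Fin n => Counted.tabulate fun y : Fin n => do
        let q ← Counted.div (M.C k l x y) eta
        let q' ← Counted.neg q
        Counted.exp q'
    else pure fun _ _ => 0
  pure { eta := eta, tol := tol, K := K }

/-- What is stored during the iteration: the scaling vectors `u`, the current message `msg k l`
from `k` to `l` for every edge, and for every vertex the entrywise product `prod` of the messages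
into it. Storing this product makes the cost of a message update independent of the degrees. -/
structure State (m n : ℕ) where
  u : Fin m → Fin n → ℝ
  msg : Fin m → Fin m → Fin n → ℝ
  prod : Fin m → Fin n → ℝ

open scoped Classical in
/-- The vector that is sent from `k` to `l`, before multiplication by the kernel: `u k ⊙ mu k` at
a leaf `k`, and the product of all messages into `k` except the one from `l` otherwise. -/
noncomputable def outgoing (M : TreeMOT m n) (k l : Fin m) (s : State m n) :
    Counted (Fin n → ℝ) :=
  if k ∈ M.leaves then Counted.tabulate fun x => Counted.mul (s.u k x) (M.mu k x)
  else Counted.tabulate fun x => Counted.div (s.prod k x) (s.msg l k x)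

/-- Recompute the message from `k` to `l`. -/
noncomputable def updateMessage (M : TreeMOT m n) (par : Params m n) (k l : Fin m)
    (s : State m n) : Counted (State m n) := do
  let q ← M.outgoing k l s
  let new ← Counted.tabulate fun y : Fin n =>
    Counted.sum fun x : Fin n => Counted.mul (par.K l k y x) (q x)
  let p ← Counted.tabulate fun y : Fin n => do
    let r ← Counted.div (s.prod l y) (s.msg k l y)
    Counted.mul r (new y)
  pure { s with
    msg := Function.update s.msg k (Function.update (s.msg k) l new)
    prod := Function.update s.prod l p }

/-- Recompute a list of messages, in the given order. -/
noncomputable def updateMessages (M : TreeMOT m n) (par : Params m n)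
    (L : List (Fin m × Fin m)) (s : State m n) : Counted (State m n) :=
  L.foldlM (fun s e => M.updateMessage par e.1 e.2 s) s

/-- The Sinkhorn update of the scaling vector at the leaf `k`. -/
noncomputable def updateScaling (M : TreeMOT m n) (k : Fin m) (s : State m n) :
    Counted (State m n) := do
  let v ← Counted.tabulate fun x : Fin n => Counted.div 1 (s.msg (M.nbr k) k x)
  pure { s with u := Function.update s.u k v }

/-- The unique path between two vertices of the tree. -/
noncomputable def path (M : TreeMOT m n) (k l : Fin m) : M.G.Walk k l :=
  (M.isTree.existsUnique_path k l).choose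

/-- The edges of the path from `k` to `l`, directed towards `l`, in the order of the path. -/
noncomputable def pathEdges (M : TreeMOT m n) (k l : Fin m) : List (Fin m × Fin m) :=
  (M.path k l).darts.map fun d => (d.fst, d.snd)

/-- The vertices at distance `r` from `k`. -/
noncomputable def sphere (M : TreeMOT m n) (k : Fin m) (r : ℕ) : List (Fin m) :=
  (List.finRange m).filter fun v => M.G.dist v k = r

/-- All edges, directed towards `k`, the ones farthest from `k` first. -/
noncomputable def inwardEdges (M : TreeMOT m n) (k : Fin m) : List (Fin m × Fin m) :=
  (List.range m).reverse.flatMap fun r =>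
    (M.sphere k (r + 1)).map fun v => (v, (M.path v k).snd)

/-- All edges, directed away from `k`, the ones closest to `k` first. -/
noncomputable def outwardEdges (M : TreeMOT m n) (k : Fin m) : List (Fin m × Fin m) :=
  (List.range m).flatMap fun r =>
    (M.sphere k (r + 1)).map fun v => ((M.path v k).snd, v)

/-- The initial state for the first leaf `k`: all scaling vectors are the all-ones vector, the
messages towards `k` are computed, and the scaling vector at `k` is updated. -/
noncomputable def startState (M : TreeMOT m n) (par : Params m n) (k : Fin m) :
    Counted (State m n) := do
  let s ← M.updateMessages par (M.inwardEdges k)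
    { u := fun _ _ => 1, msg := fun _ _ _ => 1, prod := fun _ _ => 1 }
  M.updateScaling k s

/-- One iteration, if the scaling vector at `k` was updated last and the one at `l` is updated
now: only the messages on the path from `k` to `l` are recomputed. -/
noncomputable def iteration (M : TreeMOT m n) (par : Params m n) (k l : Fin m) (s : State m n) :
    Counted (State m n) := do
  let s ← M.updateMessages par (M.pathEdges k l) s
  M.updateScaling l s

/-- The state after `t` iterations, if the leaves are chosen according to `κ`. -/
noncomputable def sinkhorn (M : TreeMOT m n) (par : Params m n) (κ : ℕ → Fin m) :
    ℕ → Counted (State m n)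
  | 0 => M.startState par (κ 0)
  | t + 1 => do
    let s ← M.sinkhorn par κ t
    M.iteration par (κ t) (κ (t + 1)) s

/-! ### Rounding -/

open scoped Classical in
/-- The bi-marginals of the scaled tensor on all edges (in both directions), if all messages are
up to date. -/
noncomputable def edgeMatrices (M : TreeMOT m n) (par : Params m n) (s : State m n) :
    Counted (Fin m → Fin m → Matrix (Fin n) (Fin n) ℝ) :=
  Counted.tabulate fun k : Fin m => Counted.tabulate fun l : Fin m =>
    if M.G.Adj k l then do
      let q ← M.outgoing k l s
      let q' ← M.outgoing l k s
      Counted.tabulate fun x : Fin n => Counted.tabulate fun y : Fin n => do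
        let a ← Counted.mul (q x) (par.K k l x y)
        Counted.mul a (q' y)
    else pure fun _ _ => 0

/-- Rounding of a nonnegative matrix `F` to a matrix with row sums `r` and column sums `c`:
rows and columns are scaled down where their sums are too large, and a rank-one correction is
added (it is absent if there is nothing left to correct). -/
noncomputable def roundMatrix (F : Matrix (Fin n) (Fin n) ℝ) (r c : Fin n → ℝ) :
    Counted (Matrix (Fin n) (Fin n) ℝ) := do
  let rowF ← Counted.tabulate fun i : Fin n => Counted.sum fun j : Fin n => pure (F i j)
  let x ← Counted.tabulate fun i : Fin n => do
    let a ← Counted.div (r i) (rowF i)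
    Counted.min a 1
  let F' ← Counted.tabulate fun i : Fin n => Counted.tabulate fun j : Fin n =>
    Counted.mul (x i) (F i j)
  let colF' ← Counted.tabulate fun j : Fin n => Counted.sum fun i : Fin n => pure (F' i j)
  let y ← Counted.tabulate fun j : Fin n => do
    let a ← Counted.div (c j) (colF' j)
    Counted.min a 1
  let F'' ← Counted.tabulate fun i : Fin n => Counted.tabulate fun j : Fin n =>
    Counted.mul (F' i j) (y j)
  let rowF'' ← Counted.tabulate fun i : Fin n => Counted.sum fun j : Fin n => pure (F'' i j)
  let colF'' ← Counted.tabulate fun j : Fin n => Counted.sum fun i : Fin n => pure (F'' i j)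
  let errR ← Counted.tabulate fun i : Fin n => Counted.sub (r i) (rowF'' i)
  let errC ← Counted.tabulate fun j : Fin n => Counted.sub (c j) (colF'' j)
  let N ← Counted.sum fun i : Fin n => Counted.abs (errR i)
  Counted.tabulate fun i : Fin n => Counted.tabulate fun j : Fin n => do
    let a ← Counted.mul (errR i) (errC j)
    let b ← Counted.div a N
    Counted.add (F'' i j) b

open scoped Classical in
/-- Replace, for every leaf `k` with neighbour `l`, the bi-marginal on the edge between `l` and
`k` by its rounding to the marginals `P` at `l` and `mu k` at `k`; the bi-marginals on the other
edges are kept. -/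
noncomputable def roundLeaves (M : TreeMOT m n)
    (B : Fin m → Fin m → Matrix (Fin n) (Fin n) ℝ) (P : Fin m → Fin n → ℝ) :
    Counted (Fin m → Fin m → Matrix (Fin n) (Fin n) ℝ) := do
  let Q ← Counted.tabulate fun k : Fin m =>
    if k ∈ M.leaves then roundMatrix (B (M.nbr k) k) (P (M.nbr k)) (M.mu k)
    else pure fun _ _ => 0
  pure fun k l =>
    if k ∈ M.leaves ∧ l = M.nbr k then (Q k).transpose
    else if l ∈ M.leaves ∧ k = M.nbr l then Q l
    else B k l

open scoped Classical in
/-- The tensor that decouples according to the tree and has the bi-marginals `B` on the edges: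
the product of the bi-marginals, divided by `P v ^ (deg v - 1)` for every vertex `v`, where `P v`
is the marginal at `v`. -/
noncomputable def treeTensor (M : TreeMOT m n)
    (B : Fin m → Fin m → Matrix (Fin n) (Fin n) ℝ) (x : Fin m → Fin n) : ℝ :=
  (∏ p ∈ M.edges, B p.1 p.2 (x p.1) (x p.2)) /
    ∏ v, (∑ y, B v (M.nbr v) (x v) y) ^ (M.G.degree v - 1)

/-! ### The complete method -/

/-- The complete method, for the case that the Sinkhorn loop is left after `t` iterations. The
output consists of the bi-marginals of the resulting transport plan on the edges. -/
noncomputable def runFor (M : TreeMOT m n) (ε : ℝ) (κ : ℕ → Fin m) (t : ℕ) :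
    Counted (Fin m → Fin m → Matrix (Fin n) (Fin n) ℝ) := do
  let par ← M.setup ε
  let s ← M.sinkhorn par κ t
  let s ← M.updateMessages par (M.outwardEdges (κ t)) s
  let B ← M.edgeMatrices par s
  M.roundLeaves B s.prod

/-- The condition under which the Sinkhorn loop is left after `t` iterations, provided that it has
not been left before. -/
def StopCond (M : TreeMOT m n) (ε : ℝ) (κ : ℕ → Fin m) (t : ℕ) : Prop :=
  M.marginalError (M.setup ε).val.eta (M.sinkhorn (M.setup ε).val κ t).val.u <
    (M.setup ε).val.tol

/-- The complete method halts after exactly `t` Sinkhorn iterations. -/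
def HaltsAt (M : TreeMOT m n) (ε : ℝ) (κ : ℕ → Fin m) (t : ℕ) : Prop :=
  M.StopCond ε κ t ∧ ∀ s < t, ¬ M.StopCond ε κ s

open scoped Classical in
/-- The number of operations of the complete method, `∞` if it does not halt. Evaluations of the
stopping criterion are not charged. -/
noncomputable def opCount (M : TreeMOT m n) (ε : ℝ) (κ : ℕ → Fin m) : ℝ≥0∞ :=
  if h : ∃ t, M.HaltsAt ε κ t then ((M.runFor ε κ h.choose).ops : ℝ≥0∞) else ⊤

/-- `P` is a law of the random sequence of leaves: the first leaf is arbitrary, and, given the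
past, the next one is uniformly distributed on the leaves other than the present one. -/
structure IsUpdateLaw (M : TreeMOT m n) (P : MeasureTheory.Measure (ℕ → Fin m)) : Prop where
  prob : MeasureTheory.IsProbabilityMeasure P
  start : ∀ᵐ κ ∂P, κ 0 ∈ M.leaves
  step : ∀ (t : ℕ) (h : ℕ → Fin m),
    P {κ | ∀ s ≤ t + 1, κ s = h s} =
      P {κ | ∀ s ≤ t, κ s = h s} *
        (if h (t + 1) ∈ M.leaves.erase (h t) then ((M.leaves.card - 1 : ℕ) : ℝ≥0∞)⁻¹ else 0)

end TreeMOT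

/-!
The scaled tensor `scaledTensor` is a Gibbs measure on a tree, so that valid messages give its
marginals and bi-marginals: rooted at `r`, it is a Markov field whose conditional laws are
normalized by the messages towards `r` (`scaledTensor_eq_rootedTensor`), and Markov kernels are
summed out from the far end (`sum_mul_prod_kernel`). If the root moves along an edge, then only
the direction of this edge changes (`dist_change_root`); hence the messages on the path between
two successive leaves are the only ones to be recomputed
(`validTowards_updateMessages_walk`), and an update of a scaling vector makes the marginal at its
leaf correct.

*Number of iterations.* The dual objective is concave in the logarithms of the scaling vectors,
and these logarithms oscillate by at most `R / η`, because the kernel at a leaf varies by a factor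
of at most `exp (R / η)`. So the dual gap `φ` satisfies `φ ≤ 2 (R / η) E`, where `E` is the violation
of the marginal constraints (`dualGap_bounds`). An update at the leaf `k` decreases `φ` by the
relative entropy of `μ_k` with respect to the present marginal, which is at least a multiple of the
squared `ℓ¹` error at `k` (`sq_sum_abs_sub_le`). As the present leaf has no error, the average over
the other leaves is at least a multiple of `E² / |Γ|²`. Before the loop stops, `E` is bounded below
both by the tolerance and by a multiple of `φ`. A concave function of `φ` with derivative
`A / max φ s ^ 2` therefore decreases by at least one in the mean (`energy_step`), and since it is
bounded by `2 A / s`, so is the expected number of iterations (`tsum_lintegral_alive_le`). The gap is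
taken with respect to a supremum over scaling vectors of bounded oscillation, and no dual optimizer
is needed.

*Length of the paths.* The first leaf is arbitrary, so its distance to the next one is only bounded
by `m`. Every later leaf is, given the past, uniform on all leaves but one, and the two choices
that determine a path are made after the event that the loop goes on is relaxed to one that is
known before (`lintegral_alive_mul_dist_succ_le`). This gives twice the average leaf distance per
iteration.

*Approximation.* Nonnegativity of two relative entropies compares the cost of the scaled tensor with
the cost of any transport plan, up to `η m log n = ε / 2` and a multiple of `R E`
(`totalCost_scaledTensor_le_add`). Rounding costs at most `R E` more (`roundLeaves_spec`). Only
leaves can have vanishing entries in their marginals, and these do not occur in the denominators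
if the tree is rooted at another vertex; so the rounded bi-marginals are the ones of the tensor that
they represent (`bimarginal_treeTensor`).
-/

namespace TreeMOT

variable {m n : ℕ}

/-! ### The tree seen from a root -/

/-- The neighbour of `v` on the path to `r`, for `v ≠ r`. -/
noncomputable def parent (M : TreeMOT m n) (r v : Fin m) : Fin m := (M.path v r).snd

lemma path_isPath (M : TreeMOT m n) (k l : Fin m) : (M.path k l).IsPath :=
  (M.isTree.existsUnique_path k l).choose_spec.1

lemma eq_path (M : TreeMOT m n) {k l : Fin m} {p : M.G.Walk k l} (hp : p.IsPath) :
    p = M.path k l :=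
  (M.isTree.existsUnique_path k l).choose_spec.2 p hp

lemma length_path (M : TreeMOT m n) (k l : Fin m) : (M.path k l).length = M.G.dist k l := by
  obtain ⟨p, hp, h⟩ := M.isTree.connected.exists_path_of_dist k l
  rw [← M.eq_path hp, h]

lemma eq_parent (M : TreeMOT m n) {r v w : Fin m} (h : M.G.Adj v w)
    (hd : M.G.dist r v = M.G.dist r w + 1) : w = M.parent r v := by
  obtain ⟨q, hq⟩ := M.isTree.connected.exists_walk_length_eq_dist w r
  have hp : (SimpleGraph.Walk.cons h q).IsPath := by
    apply SimpleGraph.Walk.isPath_of_length_eq_dist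
    rw [SimpleGraph.Walk.length_cons, hq, SimpleGraph.dist_comm, ← hd, SimpleGraph.dist_comm]
  rw [parent, ← M.eq_path hp, SimpleGraph.Walk.snd_cons]

lemma adj_parent (M : TreeMOT m n) {r v : Fin m} (h : v ≠ r) : M.G.Adj v (M.parent r v) :=
  SimpleGraph.Walk.adj_snd (SimpleGraph.Walk.not_nil_of_ne h)

lemma dist_parent (M : TreeMOT m n) {r v : Fin m} (h : v ≠ r) :
    M.G.dist r v = M.G.dist r (M.parent r v) + 1 := by
  have h1 := M.length_path v r
  have h3 : (M.path v r).tail.length + 1 = (M.path v r).length :=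
    SimpleGraph.Walk.length_tail_add_one (SimpleGraph.Walk.not_nil_of_ne h)
  have h2 : (M.path v r).tail.length = M.G.dist (M.parent r v) r := by
    rw [M.eq_path (M.path_isPath v r).tail, length_path]
    rfl
  rw [SimpleGraph.dist_comm, ← h1, ← h3, h2, SimpleGraph.dist_comm]

lemma parent_eq_root (M : TreeMOT m n) {r l : Fin m} (h : M.G.Adj r l) : M.parent r l = r := by
  refine (M.eq_parent h.symm ?_).symm
  rw [SimpleGraph.dist_eq_one_iff_adj.2 h]
  simp

lemma ne_of_dist_eq_succ (M : TreeMOT m n) {r v : Fin m} {d : ℕ} (h : M.G.dist r v = d + 1) :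
    v ≠ r := by
  rintro rfl
  simp at h

lemma dist_cases (M : TreeMOT m n) (r : Fin m) {v w : Fin m} (h : M.G.Adj v w) :
    M.G.dist r v = M.G.dist r w + 1 ∨ M.G.dist r w = M.G.dist r v + 1 :=
  M.isTree.dist_eq_dist_add_one_of_adj r h

/-- If the root is moved along an edge, then this edge is the only one that is reversed. -/
lemma dist_change_root (M : TreeMOT m n) {r r' v w : Fin m} (hr : M.G.Adj r r')
    (h : M.G.Adj v w) (hd : M.G.dist r' v = M.G.dist r' w + 1) :
    (v = r ∧ w = r') ∨ M.G.dist r v = M.G.dist r w + 1 := by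
  rcases M.dist_cases r h with h1 | h1
  · exact Or.inr h1
  left
  have hv := M.dist_cases v hr
  have hw := M.dist_cases w hr
  simp only [M.G.dist_comm (u := v), M.G.dist_comm (u := w)] at hv hw
  have hvr : v = r := by
    by_contra hne
    have h2 := M.dist_parent hne
    have h3 := M.adj_parent hne
    have h4 : M.G.dist r' v = M.G.dist r' (M.parent r v) + 1 := by
      have := M.dist_cases r' h3
      have := M.dist_cases (M.parent r v) hr
      simp only [M.G.dist_comm (u := M.parent r v)] at this
      omega
    have h5 := M.eq_parent h hd
    have h6 := M.eq_parent h3 h4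
    rw [h6, ← h5] at h2
    omega
  refine ⟨hvr, ?_⟩
  subst hvr
  have h0 : M.G.dist v v = 0 := by simp
  have : M.G.dist r' w = 0 := by omega
  exact ((M.isTree.connected.dist_eq_zero_iff).1 this).symm

lemma mem_leaves (M : TreeMOT m n) {k : Fin m} : k ∈ M.leaves ↔ ∃! l, M.G.Adj k l := by
  classical
  simp [leaves]

lemma exists_adj (M : TreeMOT m n) (hm : 3 ≤ m) (k : Fin m) : ∃ l, M.G.Adj k l := by
  have : Nontrivial (Fin m) := Fin.nontrivial_iff_two_le.2 (by omega)
  obtain ⟨l, hl⟩ := exists_ne k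
  exact ⟨_, M.adj_parent (r := l) hl.symm⟩

lemma adj_nbr (M : TreeMOT m n) (hm : 3 ≤ m) (k : Fin m) : M.G.Adj k (M.nbr k) := by
  have h := M.exists_adj hm k
  rw [nbr, dif_pos h]
  exact h.choose_spec

lemma adj_leaf_iff (M : TreeMOT m n) (hm : 3 ≤ m) {k l : Fin m} (hk : k ∈ M.leaves) :
    M.G.Adj k l ↔ l = M.nbr k :=
  ⟨fun h => (M.mem_leaves.1 hk).unique h (M.adj_nbr hm k), fun h => h ▸ M.adj_nbr hm k⟩

lemma not_mem_leaves_of_adj (M : TreeMOT m n) (hm : 3 ≤ m) {k l : Fin m} (h : M.G.Adj k l)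
    (hk : k ∈ M.leaves) : l ∉ M.leaves := by
  intro hl
  -- the two vertices `k` and `l` would form a connected component
  have key : ∀ (v : Fin m) (p : M.G.Walk v k), v = k ∨ v = l := by
    intro v p
    induction p with
    | nil => exact Or.inl rfl
    | cons hadj q ih =>
      rcases ih h hk with rfl | rfl
      · right
        rw [(M.adj_leaf_iff hm hk).1 h]
        exact (M.adj_leaf_iff hm hk).1 hadj.symm
      · left
        rw [(M.adj_leaf_iff hm hl).1 h.symm]
        exact (M.adj_leaf_iff hm hl).1 hadj.symm
  have hsub : (Finset.univ : Finset (Fin m)) ⊆ {k, l} := fun v _ => by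
    simpa using key v (M.path v k)
  have := Finset.card_le_card hsub
  have h2 := Finset.card_le_two (a := k) (b := l)
  simp at this
  omega

lemma exists_not_mem_leaves (M : TreeMOT m n) (hm : 3 ≤ m) : ∃ r, r ∉ M.leaves := by
  by_contra! h
  exact M.not_mem_leaves_of_adj hm (M.adj_nbr hm ⟨0, by omega⟩) (h _) (h _)

/-- A leaf other than the root is not the parent of any vertex. -/
lemma parent_not_mem_leaves (M : TreeMOT m n) {r v : Fin m} (hv : v ≠ r)
    (hr : r ∉ M.leaves) : M.parent r v ∉ M.leaves := by
  intro hl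
  have h1 := M.adj_parent hv
  have hne : M.parent r v ≠ r := fun h => hr (h ▸ hl)
  have h2 := M.adj_parent hne
  have h3 := (M.mem_leaves.1 hl).unique h1.symm h2
  have h4 := M.dist_parent hv
  have h5 := M.dist_parent hne
  rw [← h3] at h5
  omega

open scoped Classical in
/-- A symmetric product over the edges is a product over the vertices other than the root, each of
them joined to its parent. -/
@[to_additive]
lemma prod_edges_eq {β : Type*} [CommMonoid β] (M : TreeMOT m n) (r : Fin m)
    (f : Fin m → Fin m → β) (hf : ∀ v w, M.G.Adj v w → f v w = f w v) :
    ∏ p ∈ M.edges, f p.1 p.2 = ∏ v ∈ Finset.univ.erase r, f (M.parent r v) v := by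
  symm
  refine Finset.prod_bij (fun v _ => if v < M.parent r v then (v, M.parent r v)
    else (M.parent r v, v)) ?_ ?_ ?_ ?_
  · intro v hv
    have h := M.adj_parent (Finset.ne_of_mem_erase hv)
    have := h.ne
    by_cases hlt : v < M.parent r v
    · simp [edges, hlt, h]
    · simp only [edges, hlt, if_false, Finset.mem_filter, Finset.mem_univ, true_and]
      exact ⟨lt_of_le_of_ne (not_lt.1 hlt) this.symm, h.symm⟩
  · intro v hv w hw hvw
    have h1 := M.dist_parent (Finset.ne_of_mem_erase hv)
    have h2 := M.dist_parent (Finset.ne_of_mem_erase hw)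
    by_contra hne
    have : M.parent r v = w ∧ M.parent r w = v := by
      split_ifs at hvw <;> simp only [Prod.mk.injEq] at hvw <;> grind
    rw [this.1] at h1
    rw [this.2] at h2
    omega
  · rintro ⟨a, b⟩ hab
    simp only [edges, Finset.mem_filter, Finset.mem_univ, true_and] at hab
    rcases M.dist_cases r hab.2 with h | h
    · refine ⟨a, Finset.mem_erase.2 ⟨M.ne_of_dist_eq_succ h, Finset.mem_univ _⟩, ?_⟩
      rw [← M.eq_parent hab.2 h]
      simp [hab.1]
    · refine ⟨b, Finset.mem_erase.2 ⟨M.ne_of_dist_eq_succ h, Finset.mem_univ _⟩, ?_⟩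
      rw [← M.eq_parent hab.2.symm h]
      simp [hab.1.not_gt]
  · intro v hv
    have h := M.adj_parent (Finset.ne_of_mem_erase hv)
    split_ifs
    · exact hf _ _ h.symm
    · rfl

open scoped Classical in
/-- A product over the vertices other than the root, each of them joined to its parent, collected
at the parents. -/
lemma prod_parent_eq {β : Type*} [CommMonoid β] (M : TreeMOT m n) (r : Fin m)
    (f : Fin m → Fin m → β) :
    ∏ v ∈ Finset.univ.erase r, f (M.parent r v) v =
      ∏ w, ∏ v ∈ Finset.univ.filter fun v => M.G.Adj w v ∧ (w = r ∨ v ≠ M.parent r w), f w v := by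
  rw [← Finset.prod_fiberwise_of_maps_to (s := Finset.univ.erase r) (t := Finset.univ)
    (g := M.parent r) (fun _ _ => Finset.mem_univ _)]
  refine Finset.prod_congr rfl fun w _ => ?_
  have hset : (Finset.univ.erase r).filter (fun v => M.parent r v = w) =
      Finset.univ.filter fun v => M.G.Adj w v ∧ (w = r ∨ v ≠ M.parent r w) := by
    ext v
    simp only [Finset.mem_filter, Finset.mem_erase, Finset.mem_univ, and_true, true_and]
    constructor
    · rintro ⟨hv, rfl⟩
      refine ⟨(M.adj_parent hv).symm, ?_⟩
      by_contra! h
      have h1 := M.dist_parent hv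
      have h2 := M.dist_parent h.1
      rw [← h.2] at h2
      omega
    · rintro ⟨hadj, h⟩
      have hd : M.G.dist r v = M.G.dist r w + 1 := by
        rcases M.dist_cases r hadj with h1 | h1
        · exfalso
          rcases h with rfl | h
          · simp at h1
          · exact h (M.eq_parent hadj h1)
        · exact h1
      exact ⟨M.ne_of_dist_eq_succ hd, (M.eq_parent hadj.symm hd).symm⟩
  rw [hset]
  refine Finset.prod_congr rfl fun v hv => ?_
  rw [← hset, Finset.mem_filter] at hv
  rw [hv.2]

/-! ### Tensors that factor along a rooted tree -/

/-- Resampling one coordinate counts every argument once for each value of this coordinate. -/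
lemma sum_sum_update {ι X : Type*} [Fintype ι] [DecidableEq ι] [Fintype X] (v : ι)
    (g : (ι → X) → ℝ) :
    ∑ x, ∑ y, g (Function.update x v y) = Fintype.card X * ∑ x, g x := by
  have hinv : Function.Involutive fun p : (ι → X) × X => (Function.update p.1 v p.2, p.1 v) := by
    rintro ⟨x, y⟩
    simp
  have h := Equiv.sum_comp hinv.toPerm fun p : (ι → X) × X => g p.1
  rw [Fintype.sum_prod_type, Fintype.sum_prod_type] at h
  simp only [Function.Involutive.coe_toPerm] at h
  rw [h, Finset.mul_sum]
  simp

/-- Markov kernels attached to the vertices of a set `S` are summed out, the vertices farthest from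
the root first. Each elimination of a vertex is a sum over all values of its coordinate, which
accounts for the power of the number of values. -/
lemma sum_mul_prod_kernel {ι X : Type*} [Fintype ι] [DecidableEq ι] [Fintype X] (pa : ι → ι)
    (d : ι → ℕ) (q : ι → X → X → ℝ) (S : Finset ι) (hd : ∀ v ∈ S, d v = d (pa v) + 1)
    (hq : ∀ v ∈ S, ∀ b, ∑ y, q v b y = 1) (f : (ι → X) → ℝ)
    (hf : ∀ v ∈ S, ∀ x y, f (Function.update x v y) = f x) :
    (Fintype.card X : ℝ) ^ S.card * ∑ x, f x * ∏ v ∈ S, q v (x (pa v)) (x v) = ∑ x, f x := by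
  induction S using Finset.induction_on_max_value d with
  | empty => simp
  | insert a s ha hmax ih =>
    rw [← ih (fun v hv => hd v (Finset.mem_insert_of_mem hv))
      (fun v hv => hq v (Finset.mem_insert_of_mem hv))
      (fun v hv => hf v (Finset.mem_insert_of_mem hv)),
      Finset.card_insert_of_notMem ha, pow_succ, mul_assoc, ← sum_sum_update a]
    congr 1
    refine Finset.sum_congr rfl fun x _ => ?_
    have hpa : pa a ≠ a := fun h => by
      have := hd a (Finset.mem_insert_self _ _)
      rw [h] at this
      omega
    calc _ = ∑ y, (f x * ∏ v ∈ s, q v (x (pa v)) (x v)) * q a (x (pa a)) y := by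
          refine Finset.sum_congr rfl fun y _ => ?_
          have hprod : ∏ v ∈ s, q v (Function.update x a y (pa v)) (Function.update x a y v) =
              ∏ v ∈ s, q v (x (pa v)) (x v) := by
            refine Finset.prod_congr rfl fun v hv => ?_
            have h1 : v ≠ a := fun h => ha (h ▸ hv)
            have h2 : pa v ≠ a := fun h => by
              have h3 := hd v (Finset.mem_insert_of_mem hv)
              have h4 := hmax v hv
              rw [h] at h3
              omega
            rw [Function.update_of_ne h1, Function.update_of_ne h2]
          rw [hf a (Finset.mem_insert_self _ _), Finset.prod_insert ha, hprod,
            Function.update_of_ne hpa, Function.update_self]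
          ring
      _ = _ := by rw [← Finset.mul_sum, hq a (Finset.mem_insert_self _ _), mul_one]

lemma sum_bimarginal (B : (Fin m → Fin n) → ℝ) (k l : Fin m) (a : Fin n) :
    ∑ b, bimarginal B k l a b = marginal B k a := by
  simp only [bimarginal, marginal]
  rw [← Finset.sum_fiberwise (Finset.univ.filter fun x : Fin m → Fin n => x k = a) (fun x => x l)]
  refine Finset.sum_congr rfl fun b _ => ?_
  rw [Finset.filter_filter]

lemma bimarginal_swap (B : (Fin m → Fin n) → ℝ) (k l : Fin m) (a b : Fin n) :
    bimarginal B l k b a = bimarginal B k l a b := by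
  simp only [bimarginal, and_comm]

lemma sum_marginal (B : (Fin m → Fin n) → ℝ) (k : Fin m) (f : Fin n → ℝ) :
    ∑ a, f a * marginal B k a = ∑ x, f (x k) * B x := by
  rw [← Finset.sum_fiberwise Finset.univ (fun x : Fin m → Fin n => x k)]
  refine Finset.sum_congr rfl fun a _ => ?_
  rw [marginal, Finset.mul_sum]
  refine Finset.sum_congr rfl fun x hx => ?_
  rw [(Finset.mem_filter.1 hx).2]

lemma sum_marginal_one (B : (Fin m → Fin n) → ℝ) (k : Fin m) :
    ∑ a, marginal B k a = ∑ x, B x := by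
  simpa using sum_marginal B k fun _ => 1

lemma totalCost_eq (M : TreeMOT m n) (B : (Fin m → Fin n) → ℝ) :
    M.totalCost B = ∑ p ∈ M.edges, ∑ a, ∑ b, M.C p.1 p.2 a b * bimarginal B p.1 p.2 a b := by
  simp only [totalCost, costTensor, Finset.sum_mul]
  rw [Finset.sum_comm]
  refine Finset.sum_congr rfl fun p _ => ?_
  rw [← Finset.sum_fiberwise Finset.univ (fun x : Fin m → Fin n => x p.1)]
  refine Finset.sum_congr rfl fun a _ => ?_
  rw [← Finset.sum_fiberwise _ (fun x : Fin m → Fin n => x p.2)]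
  refine Finset.sum_congr rfl fun b _ => ?_
  rw [bimarginal, Finset.mul_sum, Finset.filter_filter]
  refine Finset.sum_congr rfl fun x hx => ?_
  rw [(Finset.mem_filter.1 hx).2.1, (Finset.mem_filter.1 hx).2.2]

open scoped Classical in
/-- The tensor with marginal `w` at the root and conditional laws `q v b` of the coordinate at `v`,
given that the one at the parent of `v` is `b`. -/
noncomputable def rootedTensor (M : TreeMOT m n) (r : Fin m) (w : Fin n → ℝ)
    (q : Fin m → Fin n → Fin n → ℝ) (x : Fin m → Fin n) : ℝ :=
  w (x r) * ∏ v ∈ Finset.univ.erase r, q v (x (M.parent r v)) (x v)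

lemma bimarginal_rootedTensor (M : TreeMOT m n) (r : Fin m) (w : Fin n → ℝ)
    (q : Fin m → Fin n → Fin n → ℝ) (hq : ∀ v ≠ r, ∀ b, ∑ y, q v b y = 1) {l : Fin m}
    (hl : M.G.Adj r l) (a b : Fin n) :
    bimarginal (M.rootedTensor r w q) r l a b = w a * q l a b := by
  classical
  have hlr : l ≠ r := hl.ne'
  have hpl : M.parent r l = r := M.parent_eq_root hl
  have hn : (n : ℝ) ≠ 0 := by
    have := a.pos
    positivity
  let S : Finset (Fin m) := (Finset.univ.erase r).erase l
  let f : (Fin m → Fin n) → ℝ := fun x => if x r = a ∧ x l = b then 1 else 0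
  have hS : S.card + 2 = m := by
    have h1 : l ∈ Finset.univ.erase r := Finset.mem_erase.2 ⟨hlr, Finset.mem_univ _⟩
    have h2 : S.card + 1 = _ := Finset.card_erase_add_one h1
    have h3 := Finset.card_erase_add_one (Finset.mem_univ r)
    simp only [Finset.card_univ, Fintype.card_fin] at h3
    omega
  have hmem : ∀ v ∈ S, v ≠ l ∧ v ≠ r := fun v hv =>
    ⟨Finset.ne_of_mem_erase hv, Finset.ne_of_mem_erase (Finset.mem_of_mem_erase hv)⟩
  have h1 := sum_mul_prod_kernel (M.parent r) (M.G.dist r) q S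
    (fun v hv => M.dist_parent (hmem v hv).2) (fun v hv => hq v (hmem v hv).2) f (by
      intro v hv x y
      simp only [f]
      rw [Function.update_of_ne (hmem v hv).2.symm, Function.update_of_ne (hmem v hv).1.symm])
  have h2 : (n : ℝ) ^ 2 * ∑ x, f x = (n : ℝ) ^ m := by
    have e1 := sum_sum_update r f
    have e2 := sum_sum_update l fun x => ∑ y, f (Function.update x r y)
    rw [e1, Fintype.card_fin] at e2
    rw [pow_two, mul_assoc, ← e2]
    have : ∀ x : Fin m → Fin n,
        ∑ y, ∑ z, f (Function.update (Function.update x l y) r z) = 1 := by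
      intro x
      simp only [f, Function.update_self, Function.update_of_ne hlr]
      rw [Finset.sum_comm]
      simp [ite_and]
    rw [Finset.sum_congr rfl fun x _ => this x]
    simp
  have h3 : ∑ x, f x * ∏ v ∈ S, q v (x (M.parent r v)) (x v) = 1 := by
    have hpos : (n : ℝ) ^ m ≠ 0 := pow_ne_zero _ hn
    apply mul_left_cancel₀ hpos
    rw [mul_one]
    nth_rw 2 [← h2]
    rw [← h1, ← mul_assoc, mul_comm ((n : ℝ) ^ 2), Fintype.card_fin, ← pow_add, hS]
  calc bimarginal (M.rootedTensor r w q) r l a b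
      = ∑ x, w a * q l a b * (f x * ∏ v ∈ S, q v (x (M.parent r v)) (x v)) := by
        rw [bimarginal, Finset.sum_filter]
        refine Finset.sum_congr rfl fun x _ => ?_
        by_cases hx : x r = a ∧ x l = b
        · simp only [hx, f, rootedTensor, S]
          rw [← Finset.mul_prod_erase _ _ (Finset.mem_erase.2 ⟨hlr, Finset.mem_univ l⟩), hpl, hx.1,
            hx.2]
          simp [mul_assoc]
        · simp [hx, f]
    _ = w a * q l a b := by rw [← Finset.mul_sum, h3, mul_one]

lemma marginal_rootedTensor (M : TreeMOT m n) (hm : 3 ≤ m) (r : Fin m) (w : Fin n → ℝ)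
    (q : Fin m → Fin n → Fin n → ℝ) (hq : ∀ v ≠ r, ∀ b, ∑ y, q v b y = 1) (a : Fin n) :
    marginal (M.rootedTensor r w q) r a = w a := by
  have h := M.adj_nbr hm r
  rw [← sum_bimarginal _ r (M.nbr r)]
  simp only [M.bimarginal_rootedTensor r w q hq h]
  rw [← Finset.mul_sum, hq _ h.ne', mul_one]

end TreeMOT

/-! ### Values and costs of counted computations -/

namespace Counted

variable {α β ι : Type}

@[simp] lemma pure_val (a : α) : (pure a : Counted α).val = a := rfl

@[simp] lemma pure_ops (a : α) : (pure a : Counted α).ops = 0 := rfl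

@[simp] lemma bind_val (a : Counted α) (f : α → Counted β) : (a >>= f).val = (f a.val).val := rfl

@[simp] lemma bind_ops (a : Counted α) (f : α → Counted β) :
    (a >>= f).ops = a.ops + (f a.val).ops := rfl

@[simp] lemma tabulate_val [Fintype ι] (f : ι → Counted α) (i : ι) :
    (tabulate f).val i = (f i).val := rfl

@[simp] lemma tabulate_ops [Fintype ι] (f : ι → Counted α) :
    (tabulate f).ops = ∑ i, (f i).ops := rfl

@[simp] lemma sum_val [Fintype ι] (f : ι → Counted ℝ) : (sum f).val = ∑ i, (f i).val := rfl

@[simp] lemma sum_ops [Fintype ι] (f : ι → Counted ℝ) :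
    (sum f).ops = ∑ i, (f i).ops + Fintype.card ι := rfl

@[simp] lemma add_val (a b : ℝ) : (add a b).val = a + b := rfl
@[simp] lemma sub_val (a b : ℝ) : (sub a b).val = a - b := rfl
@[simp] lemma mul_val (a b : ℝ) : (mul a b).val = a * b := rfl
@[simp] lemma div_val (a b : ℝ) : (div a b).val = a / b := rfl
@[simp] lemma abs_val (a : ℝ) : (Counted.abs a).val = |a| := rfl
@[simp] lemma min_val (a b : ℝ) : (Counted.min a b).val = Min.min a b := rfl
@[simp] lemma add_ops (a b : ℝ) : (add a b).ops = 1 := rfl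
@[simp] lemma sub_ops (a b : ℝ) : (sub a b).ops = 1 := rfl
@[simp] lemma mul_ops (a b : ℝ) : (mul a b).ops = 1 := rfl
@[simp] lemma div_ops (a b : ℝ) : (div a b).ops = 1 := rfl
@[simp] lemma neg_ops (a : ℝ) : (neg a).ops = 1 := rfl
@[simp] lemma abs_ops (a : ℝ) : (Counted.abs a).ops = 1 := rfl
@[simp] lemma min_ops (a b : ℝ) : (Counted.min a b).ops = 1 := rfl
@[simp] lemma exp_ops (a : ℝ) : (exp a).ops = 1 := rfl
@[simp] lemma log_ops (a : ℝ) : (log a).ops = 1 := rfl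
@[simp] lemma maximum_ops [Fintype ι] (f : ι → ℝ) : (maximum f).ops = Fintype.card ι := rfl

end Counted

namespace TreeMOT

variable {m n : ℕ}

/-! ### Messages -/

open scoped Classical in
/-- The weight at a vertex: the scaled prescribed marginal at a leaf, and one elsewhere. -/
noncomputable def weight (M : TreeMOT m n) (u : Fin m → Fin n → ℝ) (v : Fin m) (x : Fin n) : ℝ :=
  if v ∈ M.leaves then u v x * M.mu v x else 1

open scoped Classical in
/-- The invariants of the state: positivity, and correctness of the stored products. -/
structure Inv (M : TreeMOT m n) (s : State m n) : Prop where
  u_pos : ∀ k x, 0 < s.u k x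
  msg_pos : ∀ k l x, 0 < s.msg k l x
  prod_eq : ∀ l x, s.prod l x = ∏ j ∈ Finset.univ.filter (fun j => M.G.Adj l j), s.msg j l x

/-- The stored message from `v` to `w` is the one that an update would give. -/
def Valid (M : TreeMOT m n) (par : Params m n) (s : State m n) (v w : Fin m) : Prop :=
  ∀ y, s.msg v w y = ∑ x, par.K w v y x * (M.outgoing v w s).val x

/-- The kernel matrices are positive on the edges. -/
def PosKernel (M : TreeMOT m n) (par : Params m n) : Prop :=
  ∀ k l, M.G.Adj k l → ∀ x y, 0 < par.K k l x y

lemma mu_nonneg' (M : TreeMOT m n) {k : Fin m} (hk : k ∈ M.leaves) (x : Fin n) : 0 ≤ M.mu k x :=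
  M.mu_nonneg k (M.mem_leaves.1 hk) x

lemma mu_sum' (M : TreeMOT m n) {k : Fin m} (hk : k ∈ M.leaves) : ∑ x, M.mu k x = 1 :=
  M.mu_sum k (M.mem_leaves.1 hk)

open scoped Classical in
lemma outgoing_eq (M : TreeMOT m n) (hm : 3 ≤ m) {s : State m n} (hs : M.Inv s) {k l : Fin m}
    (h : M.G.Adj k l) (x : Fin n) :
    (M.outgoing k l s).val x = M.weight s.u k x *
      ∏ j ∈ Finset.univ.filter (fun j => M.G.Adj k j ∧ j ≠ l), s.msg j k x := by
  have hset : Finset.univ.filter (fun j => M.G.Adj k j ∧ j ≠ l) =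
      (Finset.univ.filter fun j => M.G.Adj k j).erase l := by
    ext j
    simp [and_comm]
  by_cases hk : k ∈ M.leaves
  · have hset' : Finset.univ.filter (fun j => M.G.Adj k j ∧ j ≠ l) = ∅ := by
      ext j
      simp only [Finset.mem_filter, Finset.mem_univ, true_and, Finset.notMem_empty, iff_false,
        not_and, not_not]
      intro hj
      rw [(M.adj_leaf_iff hm hk).1 h, (M.adj_leaf_iff hm hk).1 hj]
    rw [hset', outgoing, if_pos hk]
    simp [weight, hk]
  · rw [outgoing, if_neg hk, hset, weight, if_neg hk, one_mul, Counted.tabulate_val,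
      Counted.div_val, hs.prod_eq,
      ← Finset.mul_prod_erase _ _ (a := l) (by simpa using h), mul_div_cancel_left₀]
    exact (hs.msg_pos _ _ _).ne'

lemma weight_nonneg (M : TreeMOT m n) {u : Fin m → Fin n → ℝ} (hu : ∀ k x, 0 < u k x) (v : Fin m)
    (x : Fin n) : 0 ≤ M.weight u v x := by
  rw [weight]
  split_ifs with h
  · exact mul_nonneg (hu v x).le (M.mu_nonneg' h x)
  · exact zero_le_one

lemma exists_weight_pos (M : TreeMOT m n) (hn : 0 < n) {u : Fin m → Fin n → ℝ}
    (hu : ∀ k x, 0 < u k x) (v : Fin m) : ∃ x, 0 < M.weight u v x := by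
  by_cases h : v ∈ M.leaves
  · have h1 : 0 < ∑ x, M.mu v x := by
      rw [M.mu_sum' h]
      exact one_pos
    obtain ⟨x, -, hx⟩ := Finset.exists_lt_of_sum_lt (f := fun _ => (0 : ℝ)) (by simpa using h1)
    exact ⟨x, by simpa [weight, h] using mul_pos (hu v x) hx⟩
  · exact ⟨⟨0, hn⟩, by simp [weight, h]⟩

lemma sum_kernel_outgoing_pos (M : TreeMOT m n) (hm : 3 ≤ m) (hn : 0 < n) {par : Params m n}
    (hK : M.PosKernel par) {s : State m n} (hs : M.Inv s) {k l : Fin m} (h : M.G.Adj k l)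
    (y : Fin n) : 0 < ∑ x, par.K l k y x * (M.outgoing k l s).val x := by
  obtain ⟨x, hx⟩ := M.exists_weight_pos hn hs.u_pos k
  have hK' := hK l k h.symm y
  refine Finset.sum_pos' (fun z _ => mul_nonneg (hK' z).le ?_)
    ⟨x, Finset.mem_univ _, mul_pos (hK' x) ?_⟩
  · rw [M.outgoing_eq hm hs h]
    exact mul_nonneg (M.weight_nonneg hs.u_pos k z) (Finset.prod_nonneg fun j _ =>
      (hs.msg_pos _ _ _).le)
  · rw [M.outgoing_eq hm hs h]
    exact mul_pos hx (Finset.prod_pos fun j _ => hs.msg_pos _ _ _)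

lemma updateMessage_u (M : TreeMOT m n) (par : Params m n) (k l : Fin m) (s : State m n) :
    (M.updateMessage par k l s).val.u = s.u := rfl

lemma updateMessage_msg_self (M : TreeMOT m n) (par : Params m n) (k l : Fin m) (s : State m n)
    (y : Fin n) : (M.updateMessage par k l s).val.msg k l y =
      ∑ x, par.K l k y x * (M.outgoing k l s).val x := by
  simp [updateMessage]

lemma updateMessage_msg_of_ne (M : TreeMOT m n) (par : Params m n) {k l : Fin m} (s : State m n)
    {k' l' : Fin m} (h : ¬(k' = k ∧ l' = l)) :
    (M.updateMessage par k l s).val.msg k' l' = s.msg k' l' := by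
  by_cases hk : k' = k
  · subst hk
    have hl : l' ≠ l := fun h' => h ⟨rfl, h'⟩
    simp [updateMessage, hl]
  · simp [updateMessage, hk]

lemma inv_updateMessage (M : TreeMOT m n) (hm : 3 ≤ m) (hn : 0 < n) {par : Params m n}
    (hK : M.PosKernel par) {s : State m n} (hs : M.Inv s) {k l : Fin m} (h : M.G.Adj k l) :
    M.Inv (M.updateMessage par k l s).val := by
  classical
  refine ⟨hs.u_pos, fun k' l' x => ?_, fun l' x => ?_⟩
  · by_cases h' : k' = k ∧ l' = l
    · rw [h'.1, h'.2, updateMessage_msg_self]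
      exact M.sum_kernel_outgoing_pos hm hn hK hs h x
    · rw [M.updateMessage_msg_of_ne par s h']
      exact hs.msg_pos _ _ _
  · by_cases hl : l' = l
    · subst hl
      have hk : k ∈ Finset.univ.filter fun j => M.G.Adj l' j := by simpa using h.symm
      have h1 : (M.updateMessage par k l' s).val.prod l' x = s.prod l' x / s.msg k l' x *
          (M.updateMessage par k l' s).val.msg k l' x := by
        simp [updateMessage]
      rw [h1, hs.prod_eq, ← Finset.mul_prod_erase _ _ hk, ← Finset.mul_prod_erase _ _ hk,
        mul_div_cancel_left₀ _ (hs.msg_pos _ _ _).ne', mul_comm]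
      congr 1
      refine Finset.prod_congr rfl fun j hj => ?_
      rw [M.updateMessage_msg_of_ne par s fun h' => Finset.ne_of_mem_erase hj h'.1]
    · have h1 : (M.updateMessage par k l s).val.prod l' = s.prod l' := by
        simp [updateMessage, hl]
      rw [h1, hs.prod_eq]
      refine Finset.prod_congr rfl fun j _ => ?_
      rw [M.updateMessage_msg_of_ne par s fun h' => hl h'.2]

/-- The vector sent from `v` to `w` depends on the message from `a` to `b` only if `b = v` and
`a ≠ w`. -/
lemma outgoing_updateMessage (M : TreeMOT m n) (hm : 3 ≤ m) (hn : 0 < n) {par : Params m n}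
    (hK : M.PosKernel par) {s : State m n} (hs : M.Inv s) {a b v w : Fin m} (hab : M.G.Adj a b)
    (hvw : M.G.Adj v w) (h : ¬(b = v ∧ a ≠ w)) (x : Fin n) :
    (M.outgoing v w (M.updateMessage par a b s).val).val x = (M.outgoing v w s).val x := by
  classical
  rw [M.outgoing_eq hm (M.inv_updateMessage hm hn hK hs hab) hvw, M.outgoing_eq hm hs hvw,
    updateMessage_u]
  congr 1
  refine Finset.prod_congr rfl fun j hj => ?_
  rw [M.updateMessage_msg_of_ne par s]
  rintro ⟨rfl, rfl⟩
  exact h ⟨rfl, (Finset.mem_filter.1 hj).2.2⟩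

lemma valid_updateMessage_self (M : TreeMOT m n) (hm : 3 ≤ m) (hn : 0 < n) {par : Params m n}
    (hK : M.PosKernel par) {s : State m n} (hs : M.Inv s) {a b : Fin m} (hab : M.G.Adj a b) :
    M.Valid par (M.updateMessage par a b s).val a b := by
  intro y
  rw [updateMessage_msg_self]
  refine Finset.sum_congr rfl fun x _ => ?_
  rw [M.outgoing_updateMessage hm hn hK hs hab hab]
  exact fun h => hab.ne h.1.symm

lemma valid_updateMessage (M : TreeMOT m n) (hm : 3 ≤ m) (hn : 0 < n) {par : Params m n}
    (hK : M.PosKernel par) {s : State m n} (hs : M.Inv s) {a b v w : Fin m} (hab : M.G.Adj a b)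
    (hvw : M.G.Adj v w) (h : ¬(b = v ∧ a ≠ w)) (hv : M.Valid par s v w) :
    M.Valid par (M.updateMessage par a b s).val v w := by
  by_cases he : v = a ∧ w = b
  · rw [he.1, he.2]
    exact M.valid_updateMessage_self hm hn hK hs hab
  · intro y
    rw [M.updateMessage_msg_of_ne par s he, hv y]
    refine Finset.sum_congr rfl fun x _ => ?_
    rw [M.outgoing_updateMessage hm hn hK hs hab hvw h]

lemma updateMessages_nil (M : TreeMOT m n) (par : Params m n) (s : State m n) :
    M.updateMessages par [] s = ⟨s, 0⟩ := rfl

lemma updateMessages_cons (M : TreeMOT m n) (par : Params m n) (e : Fin m × Fin m)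
    (L : List (Fin m × Fin m)) (s : State m n) :
    M.updateMessages par (e :: L) s =
      (M.updateMessage par e.1 e.2 s >>= fun s' => M.updateMessages par L s') := by
  simp only [updateMessages, List.foldlM_cons]

lemma updateMessages_cons_val (M : TreeMOT m n) (par : Params m n) (e : Fin m × Fin m)
    (L : List (Fin m × Fin m)) (s : State m n) :
    (M.updateMessages par (e :: L) s).val =
      (M.updateMessages par L (M.updateMessage par e.1 e.2 s).val).val := by
  rw [updateMessages_cons, Counted.bind_val]

lemma updateMessages_u (M : TreeMOT m n) (par : Params m n) (L : List (Fin m × Fin m))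
    (s : State m n) : (M.updateMessages par L s).val.u = s.u := by
  induction L generalizing s with
  | nil => rfl
  | cons e L ih => rw [updateMessages_cons_val, ih, updateMessage_u]

lemma inv_updateMessages (M : TreeMOT m n) (hm : 3 ≤ m) (hn : 0 < n) {par : Params m n}
    (hK : M.PosKernel par) (L : List (Fin m × Fin m)) (hL : ∀ e ∈ L, M.G.Adj e.1 e.2)
    {s : State m n} (hs : M.Inv s) : M.Inv (M.updateMessages par L s).val := by
  induction L generalizing s with
  | nil => exact hs
  | cons e L ih =>
    rw [updateMessages_cons_val]
    exact ih (fun e he => hL e (List.mem_cons_of_mem _ he))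
      (M.inv_updateMessage hm hn hK hs (hL e List.mem_cons_self))

/-- The message on the edge `e` is not an ingredient of the message on the edge `e'`, that is, `e`
does not end where `e'` starts, unless `e` is the reverse of `e'`. -/
def NotIngredient (e e' : Fin m × Fin m) : Prop := ¬(e.2 = e'.1 ∧ e.1 ≠ e'.2)

lemma valid_updateMessages_of_valid (M : TreeMOT m n) (hm : 3 ≤ m) (hn : 0 < n) {par : Params m n}
    (hK : M.PosKernel par) (L : List (Fin m × Fin m)) (hL : ∀ e ∈ L, M.G.Adj e.1 e.2)
    {s : State m n} (hs : M.Inv s) {e : Fin m × Fin m} (he : M.G.Adj e.1 e.2)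
    (h : ∀ e' ∈ L, NotIngredient e' e) (hv : M.Valid par s e.1 e.2) :
    M.Valid par (M.updateMessages par L s).val e.1 e.2 := by
  induction L generalizing s with
  | nil => exact hv
  | cons e' L ih =>
    rw [updateMessages_cons_val]
    have hadj := hL e' List.mem_cons_self
    exact ih (fun e he => hL e (List.mem_cons_of_mem _ he)) (M.inv_updateMessage hm hn hK hs hadj)
      (fun e he => h e (List.mem_cons_of_mem _ he))
      (M.valid_updateMessage hm hn hK hs hadj he (h e' List.mem_cons_self) hv)

/-- If every message in a list is updated after its ingredients in the list, then all of them are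
valid in the end. -/
lemma valid_updateMessages_of_mem (M : TreeMOT m n) (hm : 3 ≤ m) (hn : 0 < n) {par : Params m n}
    (hK : M.PosKernel par) (L : List (Fin m × Fin m)) (hL : ∀ e ∈ L, M.G.Adj e.1 e.2)
    (hpair : L.Pairwise fun e e' => NotIngredient e' e) {s : State m n} (hs : M.Inv s)
    {e : Fin m × Fin m} (he : e ∈ L) : M.Valid par (M.updateMessages par L s).val e.1 e.2 := by
  induction L generalizing s with
  | nil => simp at he
  | cons e' L ih =>
    rw [updateMessages_cons_val]
    have hadj := hL e' List.mem_cons_self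
    have hL' : ∀ e ∈ L, M.G.Adj e.1 e.2 := fun e he => hL e (List.mem_cons_of_mem _ he)
    have hs' := M.inv_updateMessage hm hn hK hs hadj
    rw [List.pairwise_cons] at hpair
    rcases List.mem_cons.1 he with rfl | he
    · exact M.valid_updateMessages_of_valid hm hn hK L hL' hs' hadj hpair.1
        (M.valid_updateMessage_self hm hn hK hs hadj)
    · exact ih hL' hpair.2 hs' he

/-- All messages towards `r` are valid. -/
def ValidTowards (M : TreeMOT m n) (par : Params m n) (s : State m n) (r : Fin m) : Prop :=
  ∀ v w, M.G.Adj v w → M.G.dist r v = M.G.dist r w + 1 → M.Valid par s v w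

/-- Updating the messages along a walk moves the vertex towards which all messages are valid from
the start of the walk to its end. -/
lemma validTowards_updateMessages_walk (M : TreeMOT m n) (hm : 3 ≤ m) (hn : 0 < n)
    {par : Params m n} (hK : M.PosKernel par) {k l : Fin m} (p : M.G.Walk k l) {s : State m n}
    (hs : M.Inv s) (hv : M.ValidTowards par s k) :
    M.Inv (M.updateMessages par (p.darts.map fun d => (d.fst, d.snd)) s).val ∧
      M.ValidTowards par (M.updateMessages par (p.darts.map fun d => (d.fst, d.snd)) s).val l := by
  induction p generalizing s with
  | nil => exact ⟨hs, hv⟩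
  | @cons a b c hab q ih =>
    rw [SimpleGraph.Walk.darts_cons, List.map_cons, updateMessages_cons_val]
    refine ih (M.inv_updateMessage hm hn hK hs hab) fun v w hvw hd => ?_
    rcases M.dist_change_root hab hvw hd with ⟨rfl, rfl⟩ | h
    · exact M.valid_updateMessage_self hm hn hK hs hab
    · refine M.valid_updateMessage hm hn hK hs hab hvw ?_ (hv v w hvw h)
      rintro ⟨h1, -⟩
      dsimp only at h1
      rw [← h1] at hd
      simp at hd

lemma mem_sphere (M : TreeMOT m n) {k v : Fin m} {r : ℕ} :
    v ∈ M.sphere k r ↔ M.G.dist k v = r := by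
  simp [sphere, SimpleGraph.dist_comm]

lemma dist_lt (M : TreeMOT m n) (k v : Fin m) : M.G.dist k v < m := by
  rw [← M.length_path]
  simpa using (M.path_isPath k v).length_lt

lemma mem_inwardEdges (M : TreeMOT m n) {k : Fin m} {e : Fin m × Fin m} :
    e ∈ M.inwardEdges k ↔ M.G.Adj e.1 e.2 ∧ M.G.dist k e.1 = M.G.dist k e.2 + 1 := by
  simp only [inwardEdges, List.mem_flatMap, List.mem_reverse, List.mem_range, List.mem_map,
    mem_sphere]
  constructor
  · rintro ⟨r, -, v, hv, rfl⟩
    have hne := M.ne_of_dist_eq_succ hv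
    exact ⟨M.adj_parent hne, M.dist_parent hne⟩
  · rintro ⟨h, hd⟩
    refine ⟨M.G.dist k e.2, M.dist_lt k _, e.1, hd, ?_⟩
    rw [Prod.ext_iff]
    exact ⟨rfl, (M.eq_parent h hd).symm⟩

lemma mem_outwardEdges (M : TreeMOT m n) {k : Fin m} {e : Fin m × Fin m} :
    e ∈ M.outwardEdges k ↔ M.G.Adj e.1 e.2 ∧ M.G.dist k e.2 = M.G.dist k e.1 + 1 := by
  simp only [outwardEdges, List.mem_flatMap, List.mem_range, List.mem_map, mem_sphere]
  constructor
  · rintro ⟨r, -, v, hv, rfl⟩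
    have hne := M.ne_of_dist_eq_succ hv
    exact ⟨(M.adj_parent hne).symm, M.dist_parent hne⟩
  · rintro ⟨h, hd⟩
    refine ⟨M.G.dist k e.1, M.dist_lt k _, e.2, hd, ?_⟩
    rw [Prod.ext_iff]
    exact ⟨(M.eq_parent h.symm hd).symm, rfl⟩

lemma pairwise_inwardEdges (M : TreeMOT m n) (k : Fin m) :
    (M.inwardEdges k).Pairwise fun e e' => NotIngredient e' e := by
  have h : (M.inwardEdges k).Pairwise fun e e' => M.G.dist k e'.1 ≤ M.G.dist k e.1 := by
    rw [inwardEdges, List.pairwise_flatMap]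
    refine ⟨fun r _ => ?_, ?_⟩
    · rw [List.pairwise_map]
      refine List.pairwise_of_forall_mem_list fun v hv w hw => ?_
      rw [M.mem_sphere.1 hv, M.mem_sphere.1 hw]
    · rw [List.pairwise_reverse]
      refine List.pairwise_lt_range.imp fun {i j} hij e he e' he' => ?_
      obtain ⟨v, hv, rfl⟩ := List.mem_map.1 he
      obtain ⟨w, hw, rfl⟩ := List.mem_map.1 he'
      simp only [M.mem_sphere.1 hv, M.mem_sphere.1 hw]
      omega
  refine h.imp_of_mem fun {e e'} he he' hle hbad => ?_
  have h1 := (M.mem_inwardEdges.1 he').2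
  rw [hbad.1] at h1
  omega

lemma pairwise_outwardEdges (M : TreeMOT m n) (k : Fin m) :
    (M.outwardEdges k).Pairwise fun e e' => NotIngredient e' e := by
  have h : (M.outwardEdges k).Pairwise fun e e' => M.G.dist k e.2 ≤ M.G.dist k e'.2 := by
    rw [outwardEdges, List.pairwise_flatMap]
    refine ⟨fun r _ => ?_, ?_⟩
    · rw [List.pairwise_map]
      refine List.pairwise_of_forall_mem_list fun v hv w hw => ?_
      rw [M.mem_sphere.1 hv, M.mem_sphere.1 hw]
    · refine List.pairwise_lt_range.imp fun {i j} hij e he e' he' => ?_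
      obtain ⟨v, hv, rfl⟩ := List.mem_map.1 he
      obtain ⟨w, hw, rfl⟩ := List.mem_map.1 he'
      simp only [M.mem_sphere.1 hv, M.mem_sphere.1 hw]
      omega
  refine h.imp_of_mem fun {e e'} he he' hle hbad => ?_
  have h1 := (M.mem_outwardEdges.1 he).2
  rw [← hbad.1] at h1
  omega

lemma validTowards_inward (M : TreeMOT m n) (hm : 3 ≤ m) (hn : 0 < n) {par : Params m n}
    (hK : M.PosKernel par) (k : Fin m) {s : State m n} (hs : M.Inv s) :
    M.ValidTowards par (M.updateMessages par (M.inwardEdges k) s).val k := fun v w hvw hd =>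
  M.valid_updateMessages_of_mem hm hn hK _ (fun _ he => (M.mem_inwardEdges.1 he).1)
    (M.pairwise_inwardEdges k) hs (e := (v, w)) (M.mem_inwardEdges.2 ⟨hvw, hd⟩)

/-- The outward pass completes the messages towards one vertex to a set of valid messages. -/
lemma valid_outward (M : TreeMOT m n) (hm : 3 ≤ m) (hn : 0 < n) {par : Params m n}
    (hK : M.PosKernel par) (k : Fin m) {s : State m n} (hs : M.Inv s)
    (hv : M.ValidTowards par s k) {v w : Fin m} (hvw : M.G.Adj v w) :
    M.Valid par (M.updateMessages par (M.outwardEdges k) s).val v w := by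
  have hadj : ∀ e ∈ M.outwardEdges k, M.G.Adj e.1 e.2 := fun _ he => (M.mem_outwardEdges.1 he).1
  rcases M.dist_cases k hvw with hd | hd
  · refine M.valid_updateMessages_of_valid hm hn hK _ hadj hs (e := (v, w)) hvw
      (fun e he hbad => hbad.2 ?_) (hv v w hvw hd)
    have h1 := M.mem_outwardEdges.1 he
    rw [hbad.1] at h1
    rw [M.eq_parent h1.1.symm h1.2]
    exact (M.eq_parent hvw hd).symm
  · exact M.valid_updateMessages_of_mem hm hn hK _ hadj (M.pairwise_outwardEdges k) hs
      (e := (v, w)) (M.mem_outwardEdges.2 ⟨hvw, hd⟩)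

/-! ### Marginals of the scaled tensor -/

/-- The kernel matrices are the ones prescribed by the cost matrices and the regularization
parameter. -/
def GibbsKernel (M : TreeMOT m n) (par : Params m n) : Prop :=
  ∀ k l, M.G.Adj k l → ∀ x y, par.K k l x y = Real.exp (-(M.C k l x y / par.eta))

lemma GibbsKernel.pos {M : TreeMOT m n} {par : Params m n} (hK : M.GibbsKernel par) :
    M.PosKernel par := fun k l h x y => by
  rw [hK k l h]
  exact Real.exp_pos _

lemma GibbsKernel.symm {M : TreeMOT m n} {par : Params m n} (hK : M.GibbsKernel par) {k l : Fin m}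
    (h : M.G.Adj k l) (x y : Fin n) : par.K k l x y = par.K l k y x := by
  rw [hK k l h, hK l k h.symm, M.C_transpose k l h, Matrix.transpose_apply]

open scoped Classical in
lemma scaledTensor_eq (M : TreeMOT m n) {par : Params m n} (hK : M.GibbsKernel par) (r : Fin m)
    (u : Fin m → Fin n → ℝ) (x : Fin m → Fin n) :
    M.scaledTensor par.eta u x =
      (∏ v ∈ Finset.univ.erase r, par.K (M.parent r v) v (x (M.parent r v)) (x v)) *
        ∏ v, M.weight u v (x v) := by
  rw [← M.prod_edges_eq r (fun v w => par.K v w (x v) (x w)) fun v w h => hK.symm h _ _,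
    scaledTensor, costTensor, Finset.sum_div, ← Finset.sum_neg_distrib, Real.exp_sum]
  congr 1
  · refine Finset.prod_congr rfl fun p hp => ?_
    have h : M.G.Adj p.1 p.2 := by
      simp only [edges, Finset.mem_filter] at hp
      exact hp.2.2
    rw [hK _ _ h]
  · simp only [weight]
    rw [Finset.prod_ite_mem, Finset.univ_inter]

open scoped Classical in
/-- Belief propagation: if the messages towards `r` are valid, then the scaled tensor is the law of
a Markov field on the tree with root `r`, where the product of the messages into a vertex is the
normalization of the conditional laws at its children. -/
lemma scaledTensor_eq_rootedTensor (M : TreeMOT m n) (hm : 3 ≤ m) {par : Params m n}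
    (hK : M.GibbsKernel par) {s : State m n} (hs : M.Inv s) (r : Fin m) :
    M.scaledTensor par.eta s.u = M.rootedTensor r
      (fun a => M.weight s.u r a *
        ∏ j ∈ Finset.univ.filter (fun j => M.G.Adj r j), s.msg j r a)
      (fun v b y => par.K (M.parent r v) v b y * (M.outgoing v (M.parent r v) s).val y /
        s.msg v (M.parent r v) b) := by
  funext x
  have hpar := M.prod_parent_eq r fun w v => s.msg v w (x w)
  rw [← Finset.mul_prod_erase _ _ (Finset.mem_univ r)] at hpar
  have hr : ∏ v ∈ Finset.univ.filter (fun v => M.G.Adj r v ∧ (r = r ∨ v ≠ M.parent r r)),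
      s.msg v r (x r) = ∏ j ∈ Finset.univ.filter (fun j => M.G.Adj r j), s.msg j r (x r) := by
    simp
  rw [hr] at hpar
  have hpos : 0 < ∏ v ∈ Finset.univ.erase r, s.msg v (M.parent r v) (x (M.parent r v)) :=
    Finset.prod_pos fun v _ => hs.msg_pos _ _ _
  have hout : ∏ v ∈ Finset.univ.erase r, (M.outgoing v (M.parent r v) s).val (x v) =
      (∏ v ∈ Finset.univ.erase r, M.weight s.u v (x v)) *
      ∏ w ∈ Finset.univ.erase r, ∏ v ∈ Finset.univ.filter fun v =>
        M.G.Adj w v ∧ (w = r ∨ v ≠ M.parent r w), s.msg v w (x w) := by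
    rw [← Finset.prod_mul_distrib]
    refine Finset.prod_congr rfl fun v hv => ?_
    have hne := Finset.ne_of_mem_erase hv
    rw [M.outgoing_eq hm hs (M.adj_parent hne)]
    simp only [hne, false_or]
  rw [M.scaledTensor_eq hK r, rootedTensor, Finset.prod_div_distrib, Finset.prod_mul_distrib,
    ← Finset.mul_prod_erase _ _ (Finset.mem_univ r), mul_div_assoc', eq_div_iff hpos.ne', hpar,
    hout]
  ring

lemma sum_conditional (M : TreeMOT m n) {par : Params m n} {s : State m n} (hs : M.Inv s)
    {r v : Fin m} (hne : v ≠ r) (hv : M.ValidTowards par s r) (b : Fin n) :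
    ∑ y, par.K (M.parent r v) v b y * (M.outgoing v (M.parent r v) s).val y /
        s.msg v (M.parent r v) b = 1 := by
  rw [← Finset.sum_div, ← hv v _ (M.adj_parent hne) (M.dist_parent hne) b]
  exact div_self (hs.msg_pos _ _ _).ne'

lemma marginal_scaledTensor (M : TreeMOT m n) (hm : 3 ≤ m) {par : Params m n}
    (hK : M.GibbsKernel par) {s : State m n} (hs : M.Inv s) {r : Fin m}
    (hv : M.ValidTowards par s r) (a : Fin n) :
    marginal (M.scaledTensor par.eta s.u) r a = M.weight s.u r a * s.prod r a := by
  rw [M.scaledTensor_eq_rootedTensor hm hK hs r, M.marginal_rootedTensor hm, hs.prod_eq]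
  exact fun v hne b => M.sum_conditional hs hne hv b

lemma bimarginal_scaledTensor (M : TreeMOT m n) (hm : 3 ≤ m) {par : Params m n}
    (hK : M.GibbsKernel par) {s : State m n} (hs : M.Inv s) {r l : Fin m}
    (hv : M.ValidTowards par s r) (hl : M.G.Adj r l) (a b : Fin n) :
    bimarginal (M.scaledTensor par.eta s.u) r l a b =
      (M.outgoing r l s).val a * par.K r l a b * (M.outgoing l r s).val b := by
  classical
  have hpl : M.parent r l = r := M.parent_eq_root hl
  have hset : Finset.univ.filter (fun j => M.G.Adj r j ∧ j ≠ l) =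
      (Finset.univ.filter fun j => M.G.Adj r j).erase l := by
    ext j
    simp [and_comm]
  rw [M.scaledTensor_eq_rootedTensor hm hK hs r, M.bimarginal_rootedTensor _ _ _ _ hl, hpl,
    M.outgoing_eq hm hs hl, hset,
    ← Finset.mul_prod_erase (Finset.univ.filter fun j => M.G.Adj r j) _ (a := l) (by simpa using hl)]
  · have := (hs.msg_pos l r a).ne'
    field_simp
  · exact fun v hne b => M.sum_conditional hs hne hv b

lemma prod_leaf (M : TreeMOT m n) (hm : 3 ≤ m) {s : State m n} (hs : M.Inv s) {k : Fin m}
    (hk : k ∈ M.leaves) (a : Fin n) : s.prod k a = s.msg (M.nbr k) k a := by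
  classical
  rw [hs.prod_eq]
  have hset : Finset.univ.filter (fun j => M.G.Adj k j) = {M.nbr k} := by
    ext j
    simp [M.adj_leaf_iff hm hk]
  rw [hset, Finset.prod_singleton]

lemma marginal_scaledTensor_leaf (M : TreeMOT m n) (hm : 3 ≤ m) {par : Params m n}
    (hK : M.GibbsKernel par) {s : State m n} (hs : M.Inv s) {k : Fin m} (hk : k ∈ M.leaves)
    (hv : M.ValidTowards par s k) (a : Fin n) :
    marginal (M.scaledTensor par.eta s.u) k a = s.u k a * M.mu k a * s.msg (M.nbr k) k a := by
  rw [M.marginal_scaledTensor hm hK hs hv, M.prod_leaf hm hs hk, weight, if_pos hk]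

/-! ### Sinkhorn updates -/

lemma updateScaling_u (M : TreeMOT m n) (k : Fin m) (s : State m n) :
    (M.updateScaling k s).val.u =
      Function.update s.u k fun x => 1 / s.msg (M.nbr k) k x := rfl

lemma updateScaling_msg (M : TreeMOT m n) (k : Fin m) (s : State m n) :
    (M.updateScaling k s).val.msg = s.msg := rfl

lemma inv_updateScaling (M : TreeMOT m n) {s : State m n} (hs : M.Inv s) (k : Fin m) :
    M.Inv (M.updateScaling k s).val := by
  refine ⟨fun l x => ?_, hs.msg_pos, hs.prod_eq⟩
  rw [updateScaling_u]
  by_cases h : l = k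
  · subst h
    rw [Function.update_self]
    exact one_div_pos.2 (hs.msg_pos _ _ _)
  · rw [Function.update_of_ne h]
    exact hs.u_pos _ _

lemma validTowards_updateScaling (M : TreeMOT m n) {par : Params m n} {s : State m n} {k : Fin m}
    (hv : M.ValidTowards par s k) : M.ValidTowards par (M.updateScaling k s).val k := by
  intro v w hvw hd y
  have hne := M.ne_of_dist_eq_succ hd
  rw [updateScaling_msg, hv v w hvw hd y]
  have : (M.updateScaling k s).val.u v = s.u v := by
    rw [updateScaling_u, Function.update_of_ne hne]
  refine Finset.sum_congr rfl fun x _ => ?_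
  congr 1
  rw [outgoing, outgoing]
  split_ifs
  · simp only [Counted.tabulate_val, Counted.mul_val, this]
  · rfl

/-- The update of the scaling vector at a leaf corrects the marginal at this leaf. -/
lemma marginal_updateScaling (M : TreeMOT m n) (hm : 3 ≤ m) {par : Params m n}
    (hK : M.GibbsKernel par) {s : State m n} (hs : M.Inv s) {k : Fin m} (hk : k ∈ M.leaves)
    (hv : M.ValidTowards par s k) :
    marginal (M.scaledTensor par.eta (M.updateScaling k s).val.u) k = M.mu k := by
  funext a
  rw [M.marginal_scaledTensor_leaf hm hK (M.inv_updateScaling hs k) hk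
    (M.validTowards_updateScaling hv), updateScaling_msg, updateScaling_u, Function.update_self]
  have := (hs.msg_pos (M.nbr k) k a).ne'
  field_simp

/-- The state in which the iteration starts, before the first messages are computed. -/
def initState (m n : ℕ) : State m n :=
  { u := fun _ _ => 1, msg := fun _ _ _ => 1, prod := fun _ _ => 1 }

lemma inv_initState (M : TreeMOT m n) : M.Inv (initState m n) := by
  constructor <;> simp [initState]

/-- The state before the last update of a scaling vector. -/
noncomputable def preState (M : TreeMOT m n) (par : Params m n) (κ : ℕ → Fin m) :
    ℕ → State m n
  | 0 => (M.updateMessages par (M.inwardEdges (κ 0)) (initState m n)).val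
  | t + 1 => (M.updateMessages par (M.pathEdges (κ t) (κ (t + 1))) (M.sinkhorn par κ t).val).val

lemma sinkhorn_val (M : TreeMOT m n) (par : Params m n) (κ : ℕ → Fin m) (t : ℕ) :
    (M.sinkhorn par κ t).val = (M.updateScaling (κ t) (M.preState par κ t)).val := by
  cases t <;> rfl

lemma preState_succ_u (M : TreeMOT m n) (par : Params m n) (κ : ℕ → Fin m) (t : ℕ) :
    (M.preState par κ (t + 1)).u = (M.sinkhorn par κ t).val.u :=
  M.updateMessages_u par _ _

lemma inv_preState (M : TreeMOT m n) (hm : 3 ≤ m) (hn : 0 < n) {par : Params m n}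
    (hK : M.GibbsKernel par) (κ : ℕ → Fin m) (t : ℕ) :
    M.Inv (M.preState par κ t) ∧ M.ValidTowards par (M.preState par κ t) (κ t) := by
  induction t with
  | zero =>
    exact ⟨M.inv_updateMessages hm hn hK.pos _ (fun _ he => (M.mem_inwardEdges.1 he).1)
      M.inv_initState, M.validTowards_inward hm hn hK.pos _ M.inv_initState⟩
  | succ t ih =>
    refine M.validTowards_updateMessages_walk hm hn hK.pos _ ?_ ?_
    · rw [sinkhorn_val]
      exact M.inv_updateScaling ih.1 _
    · rw [sinkhorn_val]
      exact M.validTowards_updateScaling ih.2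

lemma inv_sinkhorn (M : TreeMOT m n) (hm : 3 ≤ m) (hn : 0 < n) {par : Params m n}
    (hK : M.GibbsKernel par) (κ : ℕ → Fin m) (t : ℕ) :
    M.Inv (M.sinkhorn par κ t).val ∧ M.ValidTowards par (M.sinkhorn par κ t).val (κ t) := by
  have h := M.inv_preState hm hn hK κ t
  rw [sinkhorn_val]
  exact ⟨M.inv_updateScaling h.1 _, M.validTowards_updateScaling h.2⟩

lemma marginal_sinkhorn (M : TreeMOT m n) (hm : 3 ≤ m) (hn : 0 < n) {par : Params m n}
    (hK : M.GibbsKernel par) (κ : ℕ → Fin m) (t : ℕ) (hκ : κ t ∈ M.leaves) :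
    marginal (M.scaledTensor par.eta (M.sinkhorn par κ t).val.u) (κ t) = M.mu (κ t) := by
  have h := M.inv_preState hm hn hK κ t
  rw [sinkhorn_val]
  exact M.marginal_updateScaling hm hK h.1 hκ h.2

lemma sum_scaledTensor_sinkhorn (M : TreeMOT m n) (hm : 3 ≤ m) (hn : 0 < n) {par : Params m n}
    (hK : M.GibbsKernel par) (κ : ℕ → Fin m) (t : ℕ) (hκ : κ t ∈ M.leaves) :
    ∑ x, M.scaledTensor par.eta (M.sinkhorn par κ t).val.u x = 1 := by
  rw [← sum_marginal_one _ (κ t), M.marginal_sinkhorn hm hn hK κ t hκ, M.mu_sum' hκ]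

/-- The update at `κ (t + 1)` multiplies the scaling vector by the ratio of the prescribed and the
present marginal. -/
lemma marginal_sinkhorn_next (M : TreeMOT m n) (hm : 3 ≤ m) (hn : 0 < n) {par : Params m n}
    (hK : M.GibbsKernel par) (κ : ℕ → Fin m) (t : ℕ) (hκ : κ (t + 1) ∈ M.leaves) (a : Fin n) :
    (M.sinkhorn par κ (t + 1)).val.u (κ (t + 1)) a *
      marginal (M.scaledTensor par.eta (M.sinkhorn par κ t).val.u) (κ (t + 1)) a =
      (M.sinkhorn par κ t).val.u (κ (t + 1)) a * M.mu (κ (t + 1)) a := by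
  have h := M.inv_preState hm hn hK κ (t + 1)
  rw [← M.preState_succ_u par κ t, M.marginal_scaledTensor_leaf hm hK h.1 hκ h.2, sinkhorn_val,
    updateScaling_u, Function.update_self]
  have := (h.1.msg_pos (M.nbr (κ (t + 1))) (κ (t + 1)) a).ne'
  field_simp

lemma sinkhorn_succ_u_of_ne (M : TreeMOT m n) (par : Params m n) (κ : ℕ → Fin m) (t : ℕ)
    {k : Fin m} (h : k ≠ κ (t + 1)) :
    (M.sinkhorn par κ (t + 1)).val.u k = (M.sinkhorn par κ t).val.u k := by
  rw [sinkhorn_val, updateScaling_u, Function.update_of_ne h, preState_succ_u]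

lemma sinkhorn_zero_u_of_ne (M : TreeMOT m n) (par : Params m n) (κ : ℕ → Fin m)
    {k : Fin m} (h : k ≠ κ 0) : (M.sinkhorn par κ 0).val.u k = fun _ => 1 := by
  rw [sinkhorn_val, updateScaling_u, Function.update_of_ne h, preState, updateMessages_u]
  rfl

/-! ### The oscillation of the scaling vectors -/

lemma le_leafCost (M : TreeMOT m n) {k : Fin m} (hk : k ∈ M.leaves) (x y : Fin n) :
    M.C k (M.nbr k) x y ≤ M.leafCost :=
  le_ciSup (f := fun i : {k // k ∈ M.leaves} × Fin n × Fin n => M.C i.1 (M.nbr i.1) i.2.1 i.2.2)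
    (Set.finite_range _).bddAbove (⟨k, hk⟩, x, y)

/-- The scaling vectors are positive, and their logarithms oscillate by at most `D` at the
leaves. -/
structure OscBound (M : TreeMOT m n) (D : ℝ) (u : Fin m → Fin n → ℝ) : Prop where
  pos : ∀ k x, 0 < u k x
  log_le : ∀ k ∈ M.leaves, ∀ x y, Real.log (u k x) ≤ D + Real.log (u k y)

/-- The kernel at a leaf varies by a factor of at most `exp (R / η)`, and so do the message into
the leaf and the scaling vector computed from it. -/
lemma log_updateScaling_le (M : TreeMOT m n) (hm : 3 ≤ m) {par : Params m n}
    (hK : M.GibbsKernel par) (heta : 0 < par.eta) {s : State m n} (hs : M.Inv s) {k : Fin m}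
    (hk : k ∈ M.leaves) (hv : M.ValidTowards par s k) (x y : Fin n) :
    Real.log ((M.updateScaling k s).val.u k x) ≤
      M.leafCost / par.eta + Real.log ((M.updateScaling k s).val.u k y) := by
  have hadj := M.adj_nbr hm k
  have hd : M.G.dist k (M.nbr k) = M.G.dist k k + 1 := by
    rw [SimpleGraph.dist_eq_one_iff_adj.2 hadj]
    simp
  have hval := hv (M.nbr k) k hadj.symm hd
  have hle : s.msg (M.nbr k) k y ≤
      Real.exp (M.leafCost / par.eta) * s.msg (M.nbr k) k x := by
    rw [hval y, hval x, Finset.mul_sum]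
    refine Finset.sum_le_sum fun z _ => ?_
    rw [← mul_assoc]
    have hout : 0 ≤ (M.outgoing (M.nbr k) k s).val z := by
      rw [M.outgoing_eq hm hs hadj.symm]
      exact mul_nonneg (M.weight_nonneg hs.u_pos _ _)
        (Finset.prod_nonneg fun j _ => (hs.msg_pos _ _ _).le)
    refine mul_le_mul_of_nonneg_right ?_ hout
    rw [hK k _ hadj, hK k _ hadj, ← Real.exp_add, Real.exp_le_exp]
    have h1 : 0 ≤ M.C k (M.nbr k) y z / par.eta :=
      div_nonneg (M.C_nonneg _ _ hadj _ _) heta.le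
    have h2 : M.C k (M.nbr k) x z / par.eta ≤ M.leafCost / par.eta :=
      div_le_div_of_nonneg_right (M.le_leafCost hk x z) heta.le
    linarith
  have hx := hs.msg_pos (M.nbr k) k x
  have hy := hs.msg_pos (M.nbr k) k y
  rw [updateScaling_u, Function.update_self, one_div, one_div, Real.log_inv, Real.log_inv]
  have := Real.log_le_log hy hle
  rw [Real.log_mul (Real.exp_pos _).ne' hx.ne', Real.log_exp] at this
  linarith

lemma leafCost_nonneg (M : TreeMOT m n) (hm : 3 ≤ m) : 0 ≤ M.leafCost :=
  Real.iSup_nonneg fun i => M.C_nonneg _ _ (M.adj_nbr hm i.1) _ _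

lemma oscBound_sinkhorn (M : TreeMOT m n) (hm : 3 ≤ m) (hn : 0 < n) {par : Params m n}
    (hK : M.GibbsKernel par) (heta : 0 < par.eta) (κ : ℕ → Fin m) (t : ℕ) :
    M.OscBound (M.leafCost / par.eta) (M.sinkhorn par κ t).val.u := by
  refine ⟨(M.inv_sinkhorn hm hn hK κ t).1.u_pos, ?_⟩
  induction t with
  | zero =>
    intro k hk x y
    have h := M.inv_preState hm hn hK κ 0
    by_cases hk0 : k = κ 0
    · subst hk0
      rw [sinkhorn_val]
      exact M.log_updateScaling_le hm hK heta h.1 hk h.2 x y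
    · rw [M.sinkhorn_zero_u_of_ne par κ hk0]
      simpa using div_nonneg (M.leafCost_nonneg hm) heta.le
  | succ t ih =>
    intro k hk x y
    have h := M.inv_preState hm hn hK κ (t + 1)
    by_cases hk0 : k = κ (t + 1)
    · subst hk0
      rw [sinkhorn_val]
      exact M.log_updateScaling_le hm hK heta h.1 hk h.2 x y
    · rw [M.sinkhorn_succ_u_of_ne par κ t hk0]
      exact ih k hk x y

/-! ### The dual objective -/

/-- The objective of the dual of the entropically regularized problem, as a function of the scaling
vectors. -/
noncomputable def dual (M : TreeMOT m n) (η : ℝ) (u : Fin m → Fin n → ℝ) : ℝ :=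
  ∑ k ∈ M.leaves, ∑ a, M.mu k a * Real.log (u k a) - ∑ x, M.scaledTensor η u x

lemma sum_mul_le_of_osc {ι : Type*} [Fintype ι] {f d : ι → ℝ} {D : ℝ}
    (hf : ∀ a b, f a ≤ D + f b) (hd : ∑ a, d a = 0) : ∑ a, f a * d a ≤ D * ∑ a, |d a| := by
  rcases isEmpty_or_nonempty ι with h | ⟨⟨b⟩⟩
  · simp
  have h1 : ∑ a, f a * d a = ∑ a, (f a - f b) * d a := by
    simp only [sub_mul, Finset.sum_sub_distrib, ← Finset.mul_sum, hd, mul_zero, sub_zero]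
  rw [h1, Finset.mul_sum]
  refine Finset.sum_le_sum fun a _ => ?_
  have h2 : |f a - f b| ≤ D := abs_le.2 ⟨by linarith [hf b a], by linarith [hf a b]⟩
  calc (f a - f b) * d a ≤ |(f a - f b) * d a| := le_abs_self _
    _ = |f a - f b| * |d a| := abs_mul _ _
    _ ≤ D * |d a| := mul_le_mul_of_nonneg_right h2 (abs_nonneg _)

lemma scaledTensor_nonneg (M : TreeMOT m n) (η : ℝ) {u : Fin m → Fin n → ℝ}
    (hu : ∀ k x, 0 < u k x) (x : Fin m → Fin n) : 0 ≤ M.scaledTensor η u x :=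
  mul_nonneg (Real.exp_pos _).le
    (Finset.prod_nonneg fun _ hk => mul_nonneg (hu _ _).le (M.mu_nonneg' hk _))

lemma scaledTensor_eq_mul_exp (M : TreeMOT m n) (η : ℝ) {u v : Fin m → Fin n → ℝ}
    (hu : ∀ k x, 0 < u k x) (hv : ∀ k x, 0 < v k x) (x : Fin m → Fin n) :
    M.scaledTensor η v x = M.scaledTensor η u x *
      Real.exp (∑ k ∈ M.leaves, (Real.log (v k (x k)) - Real.log (u k (x k)))) := by
  rw [scaledTensor, scaledTensor, mul_assoc, Real.exp_sum, ← Finset.prod_mul_distrib]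
  congr 1
  refine Finset.prod_congr rfl fun k _ => ?_
  rw [Real.exp_sub, Real.exp_log (hu _ _), Real.exp_log (hv _ _)]
  have := (hu k (x k)).ne'
  field_simp

/-- Concavity of the dual objective bounds its deficit by the violation of the constraints. -/
lemma dual_sub_le (M : TreeMOT m n) {η D : ℝ} {u v : Fin m → Fin n → ℝ} (hu : M.OscBound D u)
    (hv : M.OscBound D v) (hmass : ∑ x, M.scaledTensor η u x = 1) :
    M.dual η v - M.dual η u ≤ 2 * D * M.marginalError η u := by
  have h1 : ∑ x, M.scaledTensor η u x + ∑ k ∈ M.leaves, ∑ a,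
      (Real.log (v k a) - Real.log (u k a)) * marginal (M.scaledTensor η u) k a ≤
      ∑ x, M.scaledTensor η v x := by
    simp only [sum_marginal]
    rw [Finset.sum_comm, ← Finset.sum_add_distrib]
    refine Finset.sum_le_sum fun x _ => ?_
    rw [M.scaledTensor_eq_mul_exp η hu.pos hv.pos x, ← Finset.sum_mul]
    have h2 := Real.add_one_le_exp
      (∑ k ∈ M.leaves, (Real.log (v k (x k)) - Real.log (u k (x k))))
    have h3 := M.scaledTensor_nonneg η hu.pos x
    nlinarith
  have h4 : ∑ k ∈ M.leaves, ∑ a, (Real.log (v k a) - Real.log (u k a)) *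
      (M.mu k a - marginal (M.scaledTensor η u) k a) ≤ 2 * D * M.marginalError η u := by
    rw [marginalError, Finset.mul_sum]
    refine Finset.sum_le_sum fun k hk => ?_
    refine (sum_mul_le_of_osc (D := 2 * D) (fun a b => ?_) ?_).trans_eq ?_
    · linarith [hv.log_le k hk a b, hu.log_le k hk b a]
    · rw [Finset.sum_sub_distrib, M.mu_sum' hk, sum_marginal_one, hmass, sub_self]
    · simp only [abs_sub_comm]
  have h5 : ∑ k ∈ M.leaves, ∑ a, (Real.log (v k a) - Real.log (u k a)) *
      (M.mu k a - marginal (M.scaledTensor η u) k a) =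
      ∑ k ∈ M.leaves, ∑ a, M.mu k a * Real.log (v k a) -
      ∑ k ∈ M.leaves, ∑ a, M.mu k a * Real.log (u k a) -
      ∑ k ∈ M.leaves, ∑ a,
        (Real.log (v k a) - Real.log (u k a)) * marginal (M.scaledTensor η u) k a := by
    simp only [← Finset.sum_sub_distrib]
    refine Finset.sum_congr rfl fun k _ => Finset.sum_congr rfl fun a _ => ?_
    ring
  rw [dual, dual]
  linarith

/-- The deficit of the dual objective with respect to its supremum over the scaling vectors with
bounded oscillation. -/
noncomputable def dualGap (M : TreeMOT m n) (η D : ℝ) (u : Fin m → Fin n → ℝ) : ℝ :=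
  sSup (M.dual η '' {v | M.OscBound D v}) - M.dual η u

lemma dualGap_bounds (M : TreeMOT m n) {η D : ℝ} {u : Fin m → Fin n → ℝ} (hu : M.OscBound D u)
    (hmass : ∑ x, M.scaledTensor η u x = 1) :
    0 ≤ M.dualGap η D u ∧ M.dualGap η D u ≤ 2 * D * M.marginalError η u := by
  have hub : ∀ b ∈ M.dual η '' {v | M.OscBound D v},
      b ≤ M.dual η u + 2 * D * M.marginalError η u := by
    rintro _ ⟨v, hv, rfl⟩
    linarith [M.dual_sub_le hu hv hmass]
  have hmem : M.dual η u ∈ M.dual η '' {v | M.OscBound D v} := ⟨u, hu, rfl⟩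
  constructor
  · exact sub_nonneg.2 (le_csSup ⟨_, hub⟩ hmem)
  · have := csSup_le ⟨_, hmem⟩ hub
    rw [dualGap]
    linarith

/-- A weak form of Pinsker's inequality. The logarithm of the ratio of the two probability vectors
is given as the logarithm of `v / u`, which avoids a division by zero. The proof goes through the
Hellinger distance. -/
lemma sq_sum_abs_sub_le {ι : Type*} [Fintype ι] {p q u v : ι → ℝ} (hp : ∀ a, 0 ≤ p a)
    (hq : ∀ a, 0 ≤ q a) (hp1 : ∑ a, p a = 1) (hq1 : ∑ a, q a = 1) (hu : ∀ a, 0 < u a)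
    (hv : ∀ a, 0 < v a) (h : ∀ a, v a * p a = u a * q a) :
    (∑ a, |p a - q a|) ^ 2 ≤ 4 * ∑ a, q a * (Real.log (v a) - Real.log (u a)) := by
  have h1 : ∀ a, (√(p a) - √(q a)) ^ 2 + (q a - p a) ≤
      q a * (Real.log (v a) - Real.log (u a)) := by
    intro a
    have hsp := Real.sq_sqrt (hp a)
    have hsq := Real.sq_sqrt (hq a)
    rcases (hq a).eq_or_lt with h0 | h0
    · have hpa : p a = 0 := by
        have := h a
        rw [← h0, mul_zero] at this
        exact (mul_eq_zero.1 this).resolve_left (hv a).ne'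
      simp [← h0, hpa]
    · have hpa : 0 < p a := by
        have := mul_pos (hu a) h0
        rw [← h a] at this
        exact (mul_pos_iff_of_pos_left (hv a)).1 this
      have hs1 := Real.sqrt_pos.2 hpa
      have hs2 := Real.sqrt_pos.2 h0
      have hlog : Real.log (v a) - Real.log (u a) = -(2 * Real.log (√(p a) / √(q a))) := by
        have h2 := congrArg Real.log (h a)
        rw [Real.log_mul (hv a).ne' hpa.ne', Real.log_mul (hu a).ne' h0.ne'] at h2
        rw [Real.log_div hs1.ne' hs2.ne', Real.log_sqrt hpa.le, Real.log_sqrt h0.le]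
        linarith
      have h3 := Real.log_le_sub_one_of_pos (div_pos hs1 hs2)
      have h4 : q a * (√(p a) / √(q a)) = √(p a) * √(q a) := by
        nth_rw 1 [← hsq]
        field_simp
      have h5 := mul_le_mul_of_nonneg_left h3 h0.le
      rw [mul_sub, h4] at h5
      rw [hlog]
      nlinarith
  have hH : ∑ a, (√(p a) - √(q a)) ^ 2 ≤ ∑ a, q a * (Real.log (v a) - Real.log (u a)) := by
    have := Finset.sum_le_sum fun a (_ : a ∈ Finset.univ) => h1 a
    rw [Finset.sum_add_distrib, Finset.sum_sub_distrib, hp1, hq1] at this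
    linarith
  have h6 : ∀ a, |p a - q a| = |√(p a) - √(q a)| * (√(p a) + √(q a)) := by
    intro a
    have h7 : 0 ≤ √(p a) + √(q a) := by positivity
    rw [← abs_of_nonneg h7, ← abs_mul]
    congr 1
    nlinarith [Real.sq_sqrt (hp a), Real.sq_sqrt (hq a)]
  have hcs := Finset.sum_mul_sq_le_sq_mul_sq Finset.univ (fun a => |√(p a) - √(q a)|)
    (fun a => √(p a) + √(q a))
  simp only [← h6, sq_abs] at hcs
  have h8 : ∑ a, (√(p a) + √(q a)) ^ 2 ≤ 4 := by
    calc ∑ a, (√(p a) + √(q a)) ^ 2 ≤ ∑ a, (2 * p a + 2 * q a) :=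
          Finset.sum_le_sum fun a _ => by
            nlinarith [Real.sq_sqrt (hp a), Real.sq_sqrt (hq a), sq_nonneg (√(p a) - √(q a))]
      _ = 4 := by
        rw [Finset.sum_add_distrib, ← Finset.mul_sum, ← Finset.mul_sum, hp1, hq1]
        norm_num
  have h9 : 0 ≤ ∑ a, (√(p a) - √(q a)) ^ 2 := Finset.sum_nonneg fun a _ => sq_nonneg _
  nlinarith

/-- One Sinkhorn update decreases the dual gap by at least a multiple of the squared error of the
marginal that it corrects. -/
lemma dualGap_sinkhorn_succ_le (M : TreeMOT m n) (hm : 3 ≤ m) (hn : 0 < n) {par : Params m n}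
    (hK : M.GibbsKernel par) (D : ℝ) (κ : ℕ → Fin m) (t : ℕ) (h0 : κ t ∈ M.leaves)
    (h1 : κ (t + 1) ∈ M.leaves) :
    M.dualGap par.eta D (M.sinkhorn par κ (t + 1)).val.u +
      (∑ a, |marginal (M.scaledTensor par.eta (M.sinkhorn par κ t).val.u) (κ (t + 1)) a -
        M.mu (κ (t + 1)) a|) ^ 2 / 4 ≤
      M.dualGap par.eta D (M.sinkhorn par κ t).val.u := by
  have hs0 := (M.inv_sinkhorn hm hn hK κ t).1
  have hs1 := (M.inv_sinkhorn hm hn hK κ (t + 1)).1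
  have hmass0 := M.sum_scaledTensor_sinkhorn hm hn hK κ t h0
  have hmass1 := M.sum_scaledTensor_sinkhorn hm hn hK κ (t + 1) h1
  have h2 := sq_sum_abs_sub_le
    (p := marginal (M.scaledTensor par.eta (M.sinkhorn par κ t).val.u) (κ (t + 1)))
    (q := M.mu (κ (t + 1))) (u := (M.sinkhorn par κ t).val.u (κ (t + 1)))
    (v := (M.sinkhorn par κ (t + 1)).val.u (κ (t + 1)))
    (fun a => Finset.sum_nonneg fun x _ => M.scaledTensor_nonneg _ hs0.u_pos x)
    (M.mu_nonneg' h1) (by rw [sum_marginal_one, hmass0]) (M.mu_sum' h1) (hs0.u_pos _)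
    (hs1.u_pos _) (M.marginal_sinkhorn_next hm hn hK κ t h1)
  have h3 : M.dual par.eta (M.sinkhorn par κ (t + 1)).val.u -
      M.dual par.eta (M.sinkhorn par κ t).val.u =
      ∑ a, M.mu (κ (t + 1)) a * (Real.log ((M.sinkhorn par κ (t + 1)).val.u (κ (t + 1)) a) -
        Real.log ((M.sinkhorn par κ t).val.u (κ (t + 1)) a)) := by
    rw [dual, dual, hmass0, hmass1, ← Finset.add_sum_erase _ _ h1, ← Finset.add_sum_erase _ _ h1]
    have h4 : ∑ k ∈ M.leaves.erase (κ (t + 1)),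
        ∑ a, M.mu k a * Real.log ((M.sinkhorn par κ (t + 1)).val.u k a) =
        ∑ k ∈ M.leaves.erase (κ (t + 1)),
        ∑ a, M.mu k a * Real.log ((M.sinkhorn par κ t).val.u k a) :=
      Finset.sum_congr rfl fun k hk => by
        rw [M.sinkhorn_succ_u_of_ne par κ t (Finset.ne_of_mem_erase hk)]
    rw [h4]
    simp only [mul_sub, Finset.sum_sub_distrib]
    ring
  rw [dualGap, dualGap]
  linarith

/-! ### Rounding a matrix -/

/-- If the rows of `F` already have the required sums, then only the columns are scaled. -/
lemma roundMatrix_val {F : Matrix (Fin n) (Fin n) ℝ} {r : Fin n → ℝ} (c : Fin n → ℝ)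
    (hrow : ∀ i, ∑ j, F i j = r i) (hr : ∀ i, 0 < r i) (i j : Fin n) :
    (roundMatrix F r c).val i j = F i j * min (c j / ∑ i, F i j) 1 +
      (r i - ∑ j, F i j * min (c j / ∑ i, F i j) 1) *
        (c j - ∑ i, F i j * min (c j / ∑ i, F i j) 1) /
        ∑ i, |r i - ∑ j, F i j * min (c j / ∑ i, F i j) 1| := by
  have h : ∀ i, r i / r i = 1 := fun i => div_self (hr i).ne'
  simp [roundMatrix, hrow, h]

lemma roundMatrix_spec {F : Matrix (Fin n) (Fin n) ℝ} {r c : Fin n → ℝ}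
    (hF : ∀ i j, 0 ≤ F i j) (hrow : ∀ i, ∑ j, F i j = r i) (hr : ∀ i, 0 < r i)
    (hc : ∀ j, 0 ≤ c j) (hsum : ∑ i, r i = ∑ j, c j) :
    (∀ i j, 0 ≤ (roundMatrix F r c).val i j) ∧
    (∀ i, ∑ j, (roundMatrix F r c).val i j = r i) ∧
    (∀ j, ∑ i, (roundMatrix F r c).val i j = c j) ∧
    ∀ (W : Matrix (Fin n) (Fin n) ℝ) (R : ℝ), (∀ i j, 0 ≤ W i j) → (∀ i j, W i j ≤ R) → 0 ≤ R →
      ∑ i, ∑ j, W i j * (roundMatrix F r c).val i j ≤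
        ∑ i, ∑ j, W i j * F i j + R * ∑ j, |∑ i, F i j - c j| := by
  let y : Fin n → ℝ := fun j => min (c j / ∑ i, F i j) 1
  let e : Fin n → ℝ := fun i => r i - ∑ j, F i j * y j
  let f : Fin n → ℝ := fun j => c j - ∑ i, F i j * y j
  let N : ℝ := ∑ i, e i
  have hcol : ∀ j, 0 ≤ ∑ i, F i j := fun j => Finset.sum_nonneg fun i _ => hF i j
  have hy0 : ∀ j, 0 ≤ y j := fun j => le_min (div_nonneg (hc j) (hcol j)) zero_le_one
  have hy1 : ∀ j, y j ≤ 1 := fun j => min_le_right _ _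
  have hle : ∀ i j, F i j * y j ≤ F i j := fun i j => mul_le_of_le_one_right (hF i j) (hy1 j)
  have he : ∀ i, 0 ≤ e i := fun i => sub_nonneg.2 (by
    rw [← hrow i]
    exact Finset.sum_le_sum fun j _ => hle i j)
  have hcoly : ∀ j, ∑ i, F i j * y j = min (c j) (∑ i, F i j) := by
    intro j
    rw [← Finset.sum_mul]
    rcases (hcol j).eq_or_lt with h0 | h0
    · rw [← h0, zero_mul, min_eq_right (hc j)]
    · rw [mul_min_of_nonneg _ _ h0.le, mul_one, mul_div_cancel₀ _ h0.ne']
  have hf : ∀ j, 0 ≤ f j := fun j => sub_nonneg.2 (by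
    rw [hcoly]
    exact min_le_left _ _)
  have hN : N = ∑ j, f j := by
    simp only [N, e, f, Finset.sum_sub_distrib]
    rw [hsum, Finset.sum_comm]
  have hN0 : 0 ≤ N := Finset.sum_nonneg fun i _ => he i
  have hval : ∀ i j, (roundMatrix F r c).val i j = F i j * y j + e i * f j / N := by
    intro i j
    rw [roundMatrix_val c hrow hr]
    congr 2
    exact Finset.sum_congr rfl fun i _ => abs_of_nonneg (he i)
  -- if there is nothing to correct, then all errors vanish
  have heN : ∀ i, e i * N / N = e i := by
    intro i
    rcases hN0.eq_or_lt with h0 | h0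
    · have := (Finset.sum_eq_zero_iff_of_nonneg fun i _ => he i).1 h0.symm i (Finset.mem_univ i)
      rw [this, zero_mul, zero_div]
    · exact mul_div_cancel_right₀ _ h0.ne'
  have hfN : ∀ j, N * f j / N = f j := by
    intro j
    rcases hN0.eq_or_lt with h0 | h0
    · have := (Finset.sum_eq_zero_iff_of_nonneg fun j _ => hf j).1 (hN ▸ h0.symm) j
        (Finset.mem_univ j)
      rw [this, mul_zero, zero_div]
    · exact mul_div_cancel_left₀ _ h0.ne'
  have hpos : ∀ i j, 0 ≤ e i * f j / N := fun i j =>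
    div_nonneg (mul_nonneg (he i) (hf j)) hN0
  refine ⟨fun i j => ?_, fun i => ?_, fun j => ?_, fun W R hW hWR hR => ?_⟩
  · rw [hval]
    exact add_nonneg (mul_nonneg (hF i j) (hy0 j)) (hpos i j)
  · simp only [hval]
    rw [Finset.sum_add_distrib, ← Finset.sum_div, ← Finset.mul_sum, ← hN, heN]
    simp [e]
  · simp only [hval]
    have h1 : ∑ i, e i * f j / N = f j := by
      rw [← Finset.sum_div, ← Finset.sum_mul]
      exact hfN j
    rw [Finset.sum_add_distrib, h1]
    simp [f]
  · have h1 : ∑ i, ∑ j, W i j * (roundMatrix F r c).val i j ≤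
        ∑ i, ∑ j, (W i j * F i j + R * (e i * f j / N)) := by
      refine Finset.sum_le_sum fun i _ => Finset.sum_le_sum fun j _ => ?_
      rw [hval, mul_add]
      exact add_le_add (mul_le_mul_of_nonneg_left (hle i j) (hW i j))
        (mul_le_mul_of_nonneg_right (hWR i j) (hpos i j))
    have h2 : ∑ i, ∑ j, R * (e i * f j / N) = R * N := by
      simp only [← Finset.mul_sum, ← Finset.sum_div]
      rw [← hN]
      congr 1
      rw [Finset.sum_div]
      exact Finset.sum_congr rfl fun i _ => heN i
    have h3 : N ≤ ∑ j, |∑ i, F i j - c j| := by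
      rw [hN]
      refine Finset.sum_le_sum fun j _ => ?_
      simp only [f]
      rw [hcoly]
      rcases le_total (c j) (∑ i, F i j) with h | h
      · rw [min_eq_left h, sub_self]
        exact abs_nonneg _
      · rw [min_eq_right h, abs_sub_comm]
        exact le_abs_self _
    simp only [Finset.sum_add_distrib] at h1
    rw [h2] at h1
    exact h1.trans (by gcongr)

/-! ### The tensor represented by the bi-marginals on the edges -/

lemma treeTensor_eq_rootedTensor (M : TreeMOT m n) (hm : 3 ≤ m)
    {B : Fin m → Fin m → Matrix (Fin n) (Fin n) ℝ} {P : Fin m → Fin n → ℝ}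
    (hB : ∀ k l, M.G.Adj k l → B l k = (B k l).transpose)
    (hrow : ∀ k l, M.G.Adj k l → ∀ a, ∑ b, B k l a b = P k a) {r : Fin m}
    (hP : ∀ a, 0 < P r a) :
    M.treeTensor B = M.rootedTensor r (P r)
      (fun v b y => B (M.parent r v) v b y / P (M.parent r v) b) := by
  classical
  funext x
  have hnbr : ∀ v, ∑ y, B v (M.nbr v) (x v) y = P v (x v) := fun v =>
    hrow _ _ (M.adj_nbr hm v) _
  have hcard : ∀ w, (Finset.univ.filter fun v => M.G.Adj w v ∧ (w = r ∨ v ≠ M.parent r w)).card =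
      M.G.degree w - 1 + if w = r then 1 else 0 := by
    intro w
    have hN : M.G.neighborFinset w = Finset.univ.filter fun v => M.G.Adj w v := by
      ext v
      simp
    rw [← SimpleGraph.card_neighborFinset_eq_degree, hN]
    split_ifs with h
    · have h1 : 0 < (Finset.univ.filter fun v => M.G.Adj w v).card :=
        Finset.card_pos.2 ⟨M.nbr w, by simpa using M.adj_nbr hm w⟩
      simp only [h, true_or, and_true] at h1 ⊢
      omega
    · rw [add_zero, ← Finset.card_erase_of_mem (a := M.parent r w) (by simpa using M.adj_parent h)]
      congr 1
      ext v
      simp [h, and_comm]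
  have hden : ∏ v ∈ Finset.univ.erase r, P (M.parent r v) (x (M.parent r v)) =
      P r (x r) * ∏ v, P v (x v) ^ (M.G.degree v - 1) := by
    rw [M.prod_parent_eq r fun w _ => P w (x w)]
    simp only [Finset.prod_const, hcard, pow_add, Finset.prod_mul_distrib, pow_ite, pow_one,
      pow_zero]
    rw [Finset.prod_ite_eq', if_pos (Finset.mem_univ _), mul_comm]
  rw [treeTensor, M.prod_edges_eq r (fun v w => B v w (x v) (x w)) fun v w h => by
    rw [hB v w h, Matrix.transpose_apply]]
  simp only [hnbr]
  rw [rootedTensor, Finset.prod_div_distrib, hden, mul_div_assoc',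
    mul_div_mul_left _ _ (hP (x r)).ne']

/-- A family of consistent matrices on the edges is the family of bi-marginals of the tensor that it
represents. A vertex that is not a leaf serves as root, so that all parents have a positive
marginal. -/
lemma bimarginal_treeTensor (M : TreeMOT m n) (hm : 3 ≤ m)
    {B : Fin m → Fin m → Matrix (Fin n) (Fin n) ℝ} {P : Fin m → Fin n → ℝ}
    (hB : ∀ k l, M.G.Adj k l → B l k = (B k l).transpose)
    (hrow : ∀ k l, M.G.Adj k l → ∀ a, ∑ b, B k l a b = P k a)
    (hP : ∀ k ∉ M.leaves, ∀ a, 0 < P k a) {k l : Fin m} (h : M.G.Adj k l) :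
    bimarginal (M.treeTensor B) k l = B k l := by
  have key : ∀ k l, M.G.Adj k l → k ∉ M.leaves → bimarginal (M.treeTensor B) k l = B k l := by
    intro k l h hk
    have hpl : M.parent k l = k := M.parent_eq_root h
    funext a b
    rw [M.treeTensor_eq_rootedTensor hm hB hrow (hP k hk), M.bimarginal_rootedTensor _ _ _ _ h, hpl]
    · exact mul_div_cancel₀ _ (hP k hk a).ne'
    · intro v hv b
      rw [← Finset.sum_div, hrow _ _ (M.adj_parent hv).symm]
      exact div_self (hP _ (M.parent_not_mem_leaves hv hk) b).ne'
  by_cases hk : k ∈ M.leaves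
  · have hl := M.not_mem_leaves_of_adj hm h hk
    funext a b
    rw [← bimarginal_swap, key l k h.symm hl, hB k l h, Matrix.transpose_apply]
  · exact key k l h hk

lemma treeTensor_nonneg (M : TreeMOT m n) (hm : 3 ≤ m)
    {B : Fin m → Fin m → Matrix (Fin n) (Fin n) ℝ}
    (hB : ∀ k l, M.G.Adj k l → ∀ a b, 0 ≤ B k l a b) (x : Fin m → Fin n) :
    0 ≤ M.treeTensor B x := by
  classical
  refine div_nonneg (Finset.prod_nonneg fun p hp => ?_) (Finset.prod_nonneg fun v _ =>
    pow_nonneg (Finset.sum_nonneg fun y _ => hB _ _ (M.adj_nbr hm v) _ _) _)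
  simp only [edges, Finset.mem_filter] at hp
  exact hB _ _ hp.2.2 _ _

/-! ### Rounding a tensor -/

lemma roundLeaves_val_of_mem (M : TreeMOT m n) (hm : 3 ≤ m)
    (B : Fin m → Fin m → Matrix (Fin n) (Fin n) ℝ) (P : Fin m → Fin n → ℝ) {k l : Fin m}
    (h : M.G.Adj k l) (hk : k ∈ M.leaves) :
    (M.roundLeaves B P).val k l = (roundMatrix (B l k) (P l) (M.mu k)).val.transpose := by
  have hl := (M.adj_leaf_iff hm hk).1 h
  simp [roundLeaves, hk, hl]

lemma roundLeaves_val_of_mem' (M : TreeMOT m n) (hm : 3 ≤ m)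
    (B : Fin m → Fin m → Matrix (Fin n) (Fin n) ℝ) (P : Fin m → Fin n → ℝ) {k l : Fin m}
    (h : M.G.Adj k l) (hl : l ∈ M.leaves) :
    (M.roundLeaves B P).val k l = (roundMatrix (B k l) (P k) (M.mu l)).val := by
  have hk := (M.adj_leaf_iff hm hl).1 h.symm
  have hk' := M.not_mem_leaves_of_adj hm h.symm hl
  rw [hk] at hk'
  simp [roundLeaves, hk, hl, hk']

lemma roundLeaves_val_of_not_mem (M : TreeMOT m n)
    (B : Fin m → Fin m → Matrix (Fin n) (Fin n) ℝ) (P : Fin m → Fin n → ℝ) {k l : Fin m}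
    (hk : k ∉ M.leaves) (hl : l ∉ M.leaves) : (M.roundLeaves B P).val k l = B k l := by
  simp [roundLeaves, hk, hl]

/-- Rounding the bi-marginals of a tensor of total mass one at the leaves gives the bi-marginals of
a transport plan. Its cost exceeds the one of the tensor by at most the violation of the marginal
constraints, times the largest cost at the leaves. -/
lemma roundLeaves_spec (M : TreeMOT m n) (hm : 3 ≤ m) {T : (Fin m → Fin n) → ℝ}
    (hT : ∀ x, 0 ≤ T x) (hmass : ∑ x, T x = 1)
    (hpos : ∀ k ∉ M.leaves, ∀ a, 0 < marginal T k a)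
    {B : Fin m → Fin m → Matrix (Fin n) (Fin n) ℝ} {P : Fin m → Fin n → ℝ}
    (hB : ∀ k l, M.G.Adj k l → B k l = bimarginal T k l)
    (hP : ∀ k ∉ M.leaves, P k = marginal T k) :
    (∀ k l, M.G.Adj k l → bimarginal (M.treeTensor (M.roundLeaves B P).val) k l =
      (M.roundLeaves B P).val k l) ∧
    M.IsFeasible (M.treeTensor (M.roundLeaves B P).val) ∧
    M.totalCost (M.treeTensor (M.roundLeaves B P).val) ≤ M.totalCost T +
      M.leafCost * ∑ k ∈ M.leaves, ∑ a, |marginal T k a - M.mu k a| := by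
  classical
  have hspec : ∀ k l, M.G.Adj k l → l ∈ M.leaves → _ := fun k l h hl =>
    roundMatrix_spec (F := B k l) (r := P k) (c := M.mu l)
      (fun i j => by
        rw [hB k l h]
        exact Finset.sum_nonneg fun x _ => hT x)
      (fun i => by
        rw [hB k l h, sum_bimarginal, hP k (M.not_mem_leaves_of_adj hm h.symm hl)])
      (fun i => by
        rw [hP k (M.not_mem_leaves_of_adj hm h.symm hl)]
        exact hpos k (M.not_mem_leaves_of_adj hm h.symm hl) i)
      (M.mu_nonneg' hl)
      (by
        rw [hP k (M.not_mem_leaves_of_adj hm h.symm hl), sum_marginal_one, hmass, M.mu_sum' hl])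
  have hnonneg : ∀ k l, M.G.Adj k l → ∀ a b, 0 ≤ (M.roundLeaves B P).val k l a b := by
    intro k l h a b
    by_cases hk : k ∈ M.leaves
    · rw [M.roundLeaves_val_of_mem hm B P h hk, Matrix.transpose_apply]
      exact (hspec l k h.symm hk).1 _ _
    by_cases hl : l ∈ M.leaves
    · rw [M.roundLeaves_val_of_mem' hm B P h hl]
      exact (hspec k l h hl).1 _ _
    · rw [M.roundLeaves_val_of_not_mem B P hk hl, hB k l h]
      exact Finset.sum_nonneg fun x _ => hT x
  have hsymm : ∀ k l, M.G.Adj k l →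
      (M.roundLeaves B P).val l k = ((M.roundLeaves B P).val k l).transpose := by
    intro k l h
    by_cases hk : k ∈ M.leaves
    · rw [M.roundLeaves_val_of_mem hm B P h hk, M.roundLeaves_val_of_mem' hm B P h.symm hk,
        Matrix.transpose_transpose]
    by_cases hl : l ∈ M.leaves
    · rw [M.roundLeaves_val_of_mem' hm B P h hl, M.roundLeaves_val_of_mem hm B P h.symm hl]
    · rw [M.roundLeaves_val_of_not_mem B P hk hl, M.roundLeaves_val_of_not_mem B P hl hk, hB k l h,
        hB l k h.symm]
      ext a b
      rw [Matrix.transpose_apply, bimarginal_swap]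
  have hrow : ∀ k l, M.G.Adj k l → ∀ a, ∑ b, (M.roundLeaves B P).val k l a b =
      if k ∈ M.leaves then M.mu k a else P k a := by
    intro k l h a
    by_cases hk : k ∈ M.leaves
    · rw [M.roundLeaves_val_of_mem hm B P h hk, if_pos hk]
      exact (hspec l k h.symm hk).2.2.1 a
    rw [if_neg hk]
    by_cases hl : l ∈ M.leaves
    · rw [M.roundLeaves_val_of_mem' hm B P h hl]
      exact (hspec k l h hl).2.1 a
    · rw [M.roundLeaves_val_of_not_mem B P hk hl, hB k l h, sum_bimarginal, hP k hk]
  have hbi : ∀ k l, M.G.Adj k l → bimarginal (M.treeTensor (M.roundLeaves B P).val) k l =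
      (M.roundLeaves B P).val k l := fun k l h =>
    M.bimarginal_treeTensor hm (P := fun k a => if k ∈ M.leaves then M.mu k a else P k a) hsymm
      hrow (fun k hk a => by
        rw [if_neg hk, hP k hk]
        exact hpos k hk a) h
  refine ⟨hbi, ⟨M.treeTensor_nonneg hm hnonneg, fun k hk => ?_⟩, ?_⟩
  · funext a
    rw [← sum_bimarginal _ k (M.nbr k), hbi _ _ (M.adj_nbr hm k), hrow _ _ (M.adj_nbr hm k),
      if_pos hk]
  · obtain ⟨r, hr⟩ := M.exists_not_mem_leaves hm
    have hcost : ∀ S : (Fin m → Fin n) → ℝ, M.totalCost S = ∑ v ∈ Finset.univ.erase r,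
        ∑ a, ∑ b, M.C (M.parent r v) v a b * bimarginal S (M.parent r v) v a b := by
      intro S
      rw [totalCost_eq, M.sum_edges_eq r (fun v w => ∑ a, ∑ b, M.C v w a b * bimarginal S v w a b)]
      intro v w h
      rw [Finset.sum_comm]
      refine Finset.sum_congr rfl fun b _ => Finset.sum_congr rfl fun a _ => ?_
      rw [M.C_transpose v w h, Matrix.transpose_apply, bimarginal_swap]
    have hleaf : ∑ k ∈ M.leaves, ∑ a, |marginal T k a - M.mu k a| =
        ∑ v ∈ Finset.univ.erase r,
          if v ∈ M.leaves then ∑ a, |marginal T v a - M.mu v a| else 0 := by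
      rw [← Finset.sum_filter]
      refine Finset.sum_congr ?_ fun _ _ => rfl
      ext v
      simp only [Finset.mem_filter, Finset.mem_erase, Finset.mem_univ, and_true]
      exact ⟨fun h => ⟨fun h' => hr (h' ▸ h), h⟩, fun h => h.2⟩
    rw [hcost, hcost, hleaf, Finset.mul_sum, ← Finset.sum_add_distrib]
    refine Finset.sum_le_sum fun v hv => ?_
    have hadj := (M.adj_parent (Finset.ne_of_mem_erase hv)).symm
    rw [hbi _ _ hadj]
    by_cases hl : v ∈ M.leaves
    · rw [M.roundLeaves_val_of_mem' hm B P hadj hl, if_pos hl]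
      have h1 := (hspec _ _ hadj hl).2.2.2 (M.C (M.parent r v) v) M.leafCost
        (M.C_nonneg _ _ hadj) (fun i j => by
          rw [M.C_transpose _ _ hadj.symm, Matrix.transpose_apply,
            (M.adj_leaf_iff hm hl).1 hadj.symm]
          exact M.le_leafCost hl _ _) (M.leafCost_nonneg hm)
      have h2 : ∀ j, ∑ i, B (M.parent r v) v i j = marginal T v j := by
        intro j
        rw [hB _ _ hadj, ← sum_bimarginal T v (M.parent r v)]
        exact Finset.sum_congr rfl fun i _ => bimarginal_swap _ _ _ _ _
      simp only [h2] at h1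
      rw [hB _ _ hadj] at h1 ⊢
      exact h1
    · rw [M.roundLeaves_val_of_not_mem B P (M.parent_not_mem_leaves (Finset.ne_of_mem_erase hv) hr)
        hl, if_neg hl, mul_zero, add_zero, hB _ _ hadj]

/-! ### Duality bounds for the cost -/

lemma sub_le_mul_log_sub_log {t s : ℝ} (ht : 0 ≤ t) (hs : 0 < s) :
    t - s ≤ t * (Real.log t - Real.log s) := by
  rcases ht.eq_or_lt with rfl | ht
  · simp [hs.le]
  have h := Real.log_le_sub_one_of_pos (div_pos hs ht)
  rw [Real.log_div hs.ne' ht.ne'] at h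
  have h2 := mul_le_mul_of_nonneg_left h ht.le
  have h3 : t * (s / t - 1) = s - t := by field_simp
  rw [h3] at h2
  linarith

lemma neg_log_le_sum_mul_log {p : Fin n → ℝ} (hp : ∀ a, 0 ≤ p a) (hp1 : ∑ a, p a = 1) :
    -Real.log n ≤ ∑ a, p a * Real.log (p a) := by
  have hn : (0 : ℝ) < n := by
    rcases Nat.eq_zero_or_pos n with rfl | h
    · simp at hp1
    · exact_mod_cast h
  have h := Finset.sum_le_sum fun a (_ : a ∈ Finset.univ) =>
    sub_le_mul_log_sub_log (hp a) (inv_pos.2 hn)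
  simp only [mul_sub, Finset.sum_sub_distrib, ← Finset.sum_mul, hp1, Real.log_inv,
    Finset.sum_const, Finset.card_univ, Fintype.card_fin, nsmul_eq_mul] at h
  rw [mul_inv_cancel₀ hn.ne'] at h
  linarith

lemma IsFeasible.sum_eq_one {M : TreeMOT m n} {B : (Fin m → Fin n) → ℝ} (hB : M.IsFeasible B)
    {k : Fin m} (hk : k ∈ M.leaves) : ∑ x, B x = 1 := by
  rw [← sum_marginal_one B k, hB.2 k hk, M.mu_sum' hk]

/-- The relative entropy of a transport plan with respect to a scaled tensor is nonnegative. -/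
lemma sum_mu_log_le (M : TreeMOT m n) {η : ℝ} {u : Fin m → Fin n → ℝ} (hu : ∀ k x, 0 < u k x)
    (hmass : ∑ x, M.scaledTensor η u x = 1) {B : (Fin m → Fin n) → ℝ} (hB : M.IsFeasible B)
    {k₀ : Fin m} (hk₀ : k₀ ∈ M.leaves) :
    ∑ k ∈ M.leaves, ∑ a, M.mu k a * Real.log (u k a) - M.leaves.card * Real.log n ≤
      M.totalCost B / η := by
  have hB1 := hB.sum_eq_one hk₀
  have hle : ∀ x, B x ≤ 1 := fun x => by
    rw [← hB1]
    exact Finset.single_le_sum (fun y _ => hB.1 y) (Finset.mem_univ x)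
  have hpt : ∀ x, B x - M.scaledTensor η u x ≤ M.costTensor x * B x / η -
      ∑ k ∈ M.leaves, Real.log (u k (x k)) * B x -
      ∑ k ∈ M.leaves, Real.log (M.mu k (x k)) * B x := by
    intro x
    rcases (hB.1 x).eq_or_lt with h0 | h0
    · simpa [← h0] using M.scaledTensor_nonneg η hu x
    have hmu : ∀ k ∈ M.leaves, 0 < M.mu k (x k) := fun k hk => by
      rw [← hB.2 k hk]
      exact h0.trans_le (Finset.single_le_sum (f := B) (fun y _ => hB.1 y)
        (Finset.mem_filter.2 ⟨Finset.mem_univ x, rfl⟩))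
    have hpos : 0 < M.scaledTensor η u x :=
      mul_pos (Real.exp_pos _) (Finset.prod_pos fun k hk => mul_pos (hu _ _) (hmu k hk))
    have hlog : Real.log (M.scaledTensor η u x) = -(M.costTensor x / η) +
        (∑ k ∈ M.leaves, Real.log (u k (x k)) + ∑ k ∈ M.leaves, Real.log (M.mu k (x k))) := by
      rw [scaledTensor, Real.log_mul (Real.exp_pos _).ne'
        (Finset.prod_pos fun k hk => mul_pos (hu _ _) (hmu k hk)).ne', Real.log_exp,
        Real.log_prod fun k hk => (mul_pos (hu _ _) (hmu k hk)).ne', ← Finset.sum_add_distrib]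
      congr 1
      exact Finset.sum_congr rfl fun k hk => Real.log_mul (hu _ _).ne' (hmu k hk).ne'
    have h1 := sub_le_mul_log_sub_log (hB.1 x) hpos
    have h2 := mul_nonpos_of_nonneg_of_nonpos (hB.1 x) (Real.log_nonpos (hB.1 x) (hle x))
    rw [hlog] at h1
    rw [← Finset.sum_mul, ← Finset.sum_mul, mul_div_right_comm]
    linarith
  have h := Finset.sum_le_sum fun x (_ : x ∈ Finset.univ) => hpt x
  simp only [Finset.sum_sub_distrib] at h
  rw [hB1, hmass, Finset.sum_comm, Finset.sum_comm (t := M.leaves), ← Finset.sum_div] at h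
  have e : ∀ (k : Fin m) (f : Fin n → ℝ), k ∈ M.leaves →
      ∑ x, f (x k) * B x = ∑ a, M.mu k a * f a := fun k f hk => by
    rw [← sum_marginal, hB.2 k hk]
    exact Finset.sum_congr rfl fun a _ => mul_comm _ _
  rw [Finset.sum_congr rfl fun k hk => e k (fun a => Real.log (u k a)) hk,
    Finset.sum_congr rfl fun k hk => e k (fun a => Real.log (M.mu k a)) hk] at h
  have hent : ∑ _k ∈ M.leaves, -Real.log n ≤
      ∑ k ∈ M.leaves, ∑ a, M.mu k a * Real.log (M.mu k a) :=
    Finset.sum_le_sum fun k hk => neg_log_le_sum_mul_log (M.mu_nonneg' hk) (M.mu_sum' hk)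
  rw [Finset.sum_const, nsmul_eq_mul] at hent
  rw [totalCost]
  linarith

open scoped Classical in
lemma sum_prod_mu (M : TreeMOT m n) (hn : 0 < n) :
    ∑ x : Fin m → Fin n, (∏ k ∈ M.leaves, M.mu k (x k)) *
      Real.exp (-((m - M.leaves.card) * Real.log n)) = 1 := by
  have hn' : (n : ℝ) ≠ 0 := by positivity
  let ρ : Fin m → Fin n → ℝ := fun v a => if v ∈ M.leaves then M.mu v a else (n : ℝ)⁻¹
  have hρ : ∀ v, ∑ a, ρ v a = 1 := by
    intro v
    by_cases h : v ∈ M.leaves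
    · simp [ρ, h, M.mu_sum' h]
    · simp [ρ, h, hn']
  have h1 : ∑ x : Fin m → Fin n, ∏ v, ρ v (x v) = 1 := by
    have := Finset.prod_univ_sum (fun _ : Fin m => (Finset.univ : Finset (Fin n))) ρ
    rw [Fintype.piFinset_univ] at this
    rw [← this]
    exact Finset.prod_eq_one fun v _ => hρ v
  rw [← h1]
  refine Finset.sum_congr rfl fun x _ => ?_
  have hc : (M.leavesᶜ.card : ℝ) = m - M.leaves.card := by
    rw [Finset.card_compl, Nat.cast_sub (Finset.card_le_univ _), Fintype.card_fin]
  rw [← Finset.prod_mul_prod_compl M.leaves]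
  congr 1
  · exact Finset.prod_congr rfl fun k hk => by simp [ρ, hk]
  · rw [Finset.prod_congr rfl fun k hk => if_neg (Finset.mem_compl.1 hk), Finset.prod_const, ← hc,
      inv_pow, Real.exp_neg, ← Real.log_pow, Real.exp_log (by positivity)]

/-- The relative entropy of a scaled tensor with respect to the product of the prescribed marginals
and of uniform laws at the other vertices is nonnegative. -/
lemma totalCost_scaledTensor_le (M : TreeMOT m n) (hn : 0 < n) {η : ℝ} {u : Fin m → Fin n → ℝ}
    (hu : ∀ k x, 0 < u k x) (hmass : ∑ x, M.scaledTensor η u x = 1) :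
    M.totalCost (M.scaledTensor η u) / η ≤
      ∑ k ∈ M.leaves, ∑ a, marginal (M.scaledTensor η u) k a * Real.log (u k a) +
        (m - M.leaves.card) * Real.log n := by
  have hQ1 := M.sum_prod_mu hn
  set L : ℝ := (m - M.leaves.card) * Real.log n with hL
  have hpt : ∀ x, M.scaledTensor η u x -
      (∏ k ∈ M.leaves, M.mu k (x k)) * Real.exp (-L) ≤
      ∑ k ∈ M.leaves, Real.log (u k (x k)) * M.scaledTensor η u x + L * M.scaledTensor η u x -
        M.costTensor x * M.scaledTensor η u x / η := by
    intro x
    set w : ℝ := ∑ k ∈ M.leaves, Real.log (u k (x k)) + L - M.costTensor x / η with hw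
    have hBQ : M.scaledTensor η u x =
        (∏ k ∈ M.leaves, M.mu k (x k)) * Real.exp (-L) * Real.exp w := by
      rw [mul_assoc, ← Real.exp_add,
        show -L + w = -(M.costTensor x / η) + ∑ k ∈ M.leaves, Real.log (u k (x k)) by
          rw [hw]; ring, Real.exp_add, Real.exp_sum,
        Finset.prod_congr rfl fun k _ => Real.exp_log (hu k (x k)), scaledTensor,
        Finset.prod_mul_distrib]
      ring
    have hQ : 0 ≤ (∏ k ∈ M.leaves, M.mu k (x k)) * Real.exp (-L) :=
      mul_nonneg (Finset.prod_nonneg fun k hk => M.mu_nonneg' hk _) (Real.exp_pos _).le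
    have h1 : Real.exp w - 1 ≤ Real.exp w * w := by
      have h2 := mul_le_mul_of_nonneg_left (Real.add_one_le_exp (-w)) (Real.exp_pos w).le
      rw [← Real.exp_add, add_neg_cancel, Real.exp_zero] at h2
      linarith
    have h3 := mul_le_mul_of_nonneg_left h1 hQ
    rw [mul_sub, mul_one, ← mul_assoc, ← hBQ, hw] at h3
    rw [← Finset.sum_mul, mul_div_right_comm]
    linarith
  have h := Finset.sum_le_sum fun x (_ : x ∈ Finset.univ) => hpt x
  simp only [Finset.sum_sub_distrib, Finset.sum_add_distrib] at h
  rw [hQ1, hmass, ← Finset.mul_sum, hmass, Finset.sum_comm, ← Finset.sum_div] at h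
  have e : ∀ k, ∑ x, Real.log (u k (x k)) * M.scaledTensor η u x =
      ∑ a, marginal (M.scaledTensor η u) k a * Real.log (u k a) := fun k => by
    rw [← sum_marginal _ k fun a => Real.log (u k a)]
    exact Finset.sum_congr rfl fun a _ => mul_comm _ _
  simp only [e] at h
  rw [totalCost]
  linarith

/-- A scaled tensor is optimal among the transport plans up to an entropy term and the violation of
the marginal constraints. -/
lemma totalCost_scaledTensor_le_add (M : TreeMOT m n) (hn : 0 < n) {η D : ℝ} (hη : 0 < η)
    {u : Fin m → Fin n → ℝ} (hu : M.OscBound D u) (hmass : ∑ x, M.scaledTensor η u x = 1)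
    {B : (Fin m → Fin n) → ℝ} (hB : M.IsFeasible B) {k₀ : Fin m} (hk₀ : k₀ ∈ M.leaves) :
    M.totalCost (M.scaledTensor η u) ≤
      M.totalCost B + η * (m * Real.log n + D * M.marginalError η u) := by
  have h1 := M.sum_mu_log_le hu.pos hmass hB hk₀
  have h2 := M.totalCost_scaledTensor_le hn hu.pos hmass
  have h3 : ∑ k ∈ M.leaves, ∑ a, marginal (M.scaledTensor η u) k a * Real.log (u k a) -
      ∑ k ∈ M.leaves, ∑ a, M.mu k a * Real.log (u k a) ≤ D * M.marginalError η u := by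
    simp only [← Finset.sum_sub_distrib]
    rw [marginalError, Finset.mul_sum]
    refine Finset.sum_le_sum fun k hk => ?_
    refine (sum_mul_le_of_osc (hu.log_le k hk)
      (d := fun a => marginal (M.scaledTensor η u) k a - M.mu k a) ?_).trans' (le_of_eq ?_)
    · rw [Finset.sum_sub_distrib, M.mu_sum' hk, sum_marginal_one, hmass, sub_self]
    · exact Finset.sum_congr rfl fun a _ => by ring
  have h4 : M.totalCost (M.scaledTensor η u) / η ≤
      M.totalCost B / η + (m * Real.log n + D * M.marginalError η u) := by
    linarith
  rw [div_le_iff₀ hη, add_mul, div_mul_cancel₀ _ hη.ne'] at h4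
  linarith

/-! ### Correctness of the output -/

lemma setup_eta (M : TreeMOT m n) (ε : ℝ) :
    (M.setup ε).val.eta = ε / (2 * m * Real.log n) := rfl

lemma setup_tol (M : TreeMOT m n) (ε : ℝ) : (M.setup ε).val.tol = ε / (8 * M.leafCost) := rfl

lemma gibbsKernel_setup (M : TreeMOT m n) (ε : ℝ) : M.GibbsKernel (M.setup ε).val := by
  intro k l h x y
  simp only [setup, Counted.bind_val, Counted.pure_val, Counted.tabulate_val, if_pos h]
  rfl

lemma edgeMatrices_val (M : TreeMOT m n) (par : Params m n) (s : State m n) {k l : Fin m}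
    (h : M.G.Adj k l) (a b : Fin n) : (M.edgeMatrices par s).val k l a b =
      (M.outgoing k l s).val a * par.K k l a b * (M.outgoing l k s).val b := by
  exact congrArg (fun z : Counted (Matrix (Fin n) (Fin n) ℝ) => z.val a b) (if_pos h)

lemma runFor_val (M : TreeMOT m n) (ε : ℝ) (κ : ℕ → Fin m) (t : ℕ) :
    (M.runFor ε κ t).val =
      (M.roundLeaves (M.edgeMatrices (M.setup ε).val (M.updateMessages (M.setup ε).val
        (M.outwardEdges (κ t)) (M.sinkhorn (M.setup ε).val κ t).val).val).val
        (M.updateMessages (M.setup ε).val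
        (M.outwardEdges (κ t)) (M.sinkhorn (M.setup ε).val κ t).val).val.prod).val := rfl

lemma setup_eta_pos (M : TreeMOT m n) (hm : 3 ≤ m) (hn : 2 ≤ n) {ε : ℝ} (hε : 0 < ε) :
    0 < (M.setup ε).val.eta := by
  have h1 : (1 : ℝ) < n := by exact_mod_cast hn
  have h2 : (0 : ℝ) < m := by
    have : 0 < m := by omega
    exact_mod_cast this
  have := Real.log_pos h1
  rw [setup_eta]
  positivity

/-- If the stopping criterion holds, then the output has the bi-marginals that it should have, and
it represents an approximate solution. -/
lemma runFor_spec (M : TreeMOT m n) (hm : 3 ≤ m) (hn : 2 ≤ n) {ε : ℝ} (hε : 0 < ε)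
    (hR : 0 < M.leafCost) {κ : ℕ → Fin m} {t : ℕ} (hκ : κ t ∈ M.leaves)
    (hcond : M.StopCond ε κ t) :
    (∀ k l, M.G.Adj k l → bimarginal (M.treeTensor (M.runFor ε κ t).val) k l =
      (M.runFor ε κ t).val k l) ∧
    M.IsApproxSolution ε (M.treeTensor (M.runFor ε κ t).val) := by
  have hn0 : 0 < n := by omega
  have hK := M.gibbsKernel_setup ε
  have heta := M.setup_eta_pos hm hn hε
  set par := (M.setup ε).val with hpar
  obtain ⟨hinv, hvalid⟩ := M.inv_sinkhorn hm hn0 hK κ t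
  have hosc := M.oscBound_sinkhorn hm hn0 hK heta κ t
  have hmass := M.sum_scaledTensor_sinkhorn hm hn0 hK κ t hκ
  set s' := (M.updateMessages par (M.outwardEdges (κ t)) (M.sinkhorn par κ t).val).val with hs'
  have hinv' : M.Inv s' := M.inv_updateMessages hm hn0 hK.pos _
    (fun _ he => (M.mem_outwardEdges.1 he).1) hinv
  have hu : s'.u = (M.sinkhorn par κ t).val.u := M.updateMessages_u par _ _
  have hvalid' : ∀ r, M.ValidTowards par s' r := fun r v w hvw _ =>
    M.valid_outward hm hn0 hK.pos (κ t) hinv hvalid hvw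
  have hprod : ∀ k ∉ M.leaves, ∀ a,
      s'.prod k a = marginal (M.scaledTensor par.eta (M.sinkhorn par κ t).val.u) k a := by
    intro k hk a
    rw [← hu, M.marginal_scaledTensor hm hK hinv' (hvalid' k), weight, if_neg hk, one_mul]
  have hround := M.roundLeaves_spec hm (M.scaledTensor_nonneg par.eta hosc.pos) hmass
    (fun k hk a => by
      classical
      rw [← hprod k hk, hinv'.prod_eq]
      exact Finset.prod_pos fun j _ => hinv'.msg_pos _ _ _)
    (B := (M.edgeMatrices par s').val) (P := s'.prod)
    (fun k l h => by
      ext a b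
      rw [M.edgeMatrices_val par s' h, ← hu, M.bimarginal_scaledTensor hm hK hinv' (hvalid' k) h])
    (fun k hk => funext (hprod k hk))
  rw [runFor_val, ← hpar, ← hs']
  refine ⟨hround.1, hround.2.1, fun B' hB' => ?_⟩
  have h1 := hround.2.2
  have h2 := M.totalCost_scaledTensor_le_add hn0 heta hosc hmass hB' hκ
  have h3 : M.marginalError par.eta (M.sinkhorn par κ t).val.u < ε / (8 * M.leafCost) := hcond
  rw [lt_div_iff₀ (by positivity)] at h3
  have h4 : par.eta * (m * Real.log n) = ε / 2 := by
    have h5 : Real.log n ≠ 0 := by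
      have h1 : (1 : ℝ) < n := by exact_mod_cast hn
      exact (Real.log_pos h1).ne'
    have h6 : (m : ℝ) ≠ 0 := by
      have : m ≠ 0 := by omega
      exact_mod_cast this
    rw [hpar, setup_eta]
    field_simp
  rw [mul_add, h4, ← mul_assoc, mul_div_cancel₀ _ heta.ne'] at h2
  rw [← marginalError] at h1
  linarith

/-! ### Operation counts -/

lemma outgoing_ops (M : TreeMOT m n) (k l : Fin m) (s : State m n) :
    (M.outgoing k l s).ops = n := by
  rw [outgoing]
  split_ifs <;> simp

lemma updateMessage_ops (M : TreeMOT m n) (par : Params m n) (k l : Fin m) (s : State m n) :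
    (M.updateMessage par k l s).ops = 2 * n ^ 2 + 3 * n := by
  simp [updateMessage, outgoing_ops]
  ring

lemma updateMessages_ops (M : TreeMOT m n) (par : Params m n) (L : List (Fin m × Fin m))
    (s : State m n) : (M.updateMessages par L s).ops = L.length * (2 * n ^ 2 + 3 * n) := by
  induction L generalizing s with
  | nil => simp [updateMessages_nil]
  | cons e L ih =>
    rw [updateMessages_cons, Counted.bind_ops, ih, updateMessage_ops, List.length_cons]
    ring

lemma updateMessages_ops_le (M : TreeMOT m n) (par : Params m n) (L : List (Fin m × Fin m))
    (s : State m n) : (M.updateMessages par L s).ops ≤ L.length * (5 * n ^ 2) := by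
  rw [updateMessages_ops]
  gcongr
  nlinarith [Nat.le_self_pow two_ne_zero n]

lemma updateScaling_ops (M : TreeMOT m n) (k : Fin m) (s : State m n) :
    (M.updateScaling k s).ops = n := by
  simp [updateScaling]

lemma length_flatMap_sphere_le (M : TreeMOT m n) (k : Fin m) {R : List ℕ} (hR : R.Nodup) :
    (R.flatMap fun r => M.sphere k (r + 1)).length ≤ m := by
  have h : (R.flatMap fun r => M.sphere k (r + 1)).Nodup := by
    rw [List.nodup_flatMap]
    refine ⟨fun r _ => (List.nodup_finRange m).filter _, hR.imp fun {i j} hij v hv hw => hij ?_⟩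
    have h1 := M.mem_sphere.1 hv
    have h2 := M.mem_sphere.1 hw
    omega
  simpa using h.length_le_card

lemma length_inwardEdges_le (M : TreeMOT m n) (k : Fin m) : (M.inwardEdges k).length ≤ m := by
  refine le_of_eq_of_le ?_ (M.length_flatMap_sphere_le k
    (List.nodup_reverse.2 (List.nodup_range (n := m))))
  simp [inwardEdges, List.length_flatMap]

lemma length_outwardEdges_le (M : TreeMOT m n) (k : Fin m) : (M.outwardEdges k).length ≤ m := by
  refine le_of_eq_of_le ?_ (M.length_flatMap_sphere_le k (List.nodup_range (n := m)))
  simp [outwardEdges, List.length_flatMap]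

open scoped Classical in
lemma sum_adj_le (M : TreeMOT m n) (c : ℕ) :
    ∑ k, ∑ l, (if M.G.Adj k l then c else 0) ≤ 2 * m * c := by
  have h1 : ∀ k, ∑ l, (if M.G.Adj k l then c else 0) = M.G.degree k * c := by
    intro k
    have hN : M.G.neighborFinset k = Finset.univ.filter fun v => M.G.Adj k v := by
      ext v
      simp
    rw [← SimpleGraph.card_neighborFinset_eq_degree, hN, ← Finset.sum_filter, Finset.sum_const,
      smul_eq_mul]
  have h2 := M.isTree.card_edgeFinset
  rw [Fintype.card_fin] at h2
  rw [Finset.sum_congr rfl fun k _ => h1 k, ← Finset.sum_mul, M.G.sum_degrees_eq_twice_card_edges]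
  gcongr
  omega

lemma ite_ops {α : Type} (c : Prop) [Decidable c] (x y : Counted α) :
    (if c then x else y).ops = if c then x.ops else y.ops := apply_ite Counted.ops c x y

lemma setup_ops_le (M : TreeMOT m n) (ε : ℝ) : (M.setup ε).ops ≤ 7 * m * n ^ 2 + 6 := by
  classical
  have h1 : M.leaves.card ≤ m := by simpa using Finset.card_le_univ M.leaves
  have h2 := M.sum_adj_le (3 * n ^ 2)
  have h3 : M.leaves.card * (n * n) ≤ m * (n * n) := by gcongr
  have h4 : (M.setup ε).ops = M.leaves.card * (n * n) + 6 +
      ∑ k, ∑ l, (if M.G.Adj k l then 3 * n ^ 2 else 0) := by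
    simp only [setup, Counted.bind_ops, Counted.maximum_ops, Counted.mul_ops, Counted.log_ops,
      Counted.div_ops, Counted.pure_ops, Counted.tabulate_ops, ite_ops, Counted.neg_ops,
      Counted.exp_ops, Fintype.card_prod, Fintype.card_coe, Fintype.card_fin, Finset.sum_const,
      Finset.card_univ, smul_eq_mul]
    have h5 : n * (n * (1 + (1 + 1))) = 3 * n ^ 2 := by ring
    simp only [h5]
    ring
  rw [h4]
  nlinarith

lemma edgeMatrices_ops_le (M : TreeMOT m n) (par : Params m n) (s : State m n) :
    (M.edgeMatrices par s).ops ≤ 8 * m * n ^ 2 := by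
  classical
  have h2 := M.sum_adj_le (4 * n ^ 2)
  have h4 : (M.edgeMatrices par s).ops ≤
      ∑ k, ∑ l, (if M.G.Adj k l then 4 * n ^ 2 else 0) := by
    rw [edgeMatrices, Counted.tabulate_ops]
    refine Finset.sum_le_sum fun k _ => ?_
    rw [Counted.tabulate_ops]
    refine Finset.sum_le_sum fun l _ => ?_
    refine (ite_ops (α := Matrix (Fin n) (Fin n) ℝ) _ _ _).le.trans ?_
    split_ifs
    · simp only [Counted.bind_ops, outgoing_ops, Counted.tabulate_ops, Counted.mul_ops,
        Finset.sum_const, Finset.card_univ, Fintype.card_fin, smul_eq_mul]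
      nlinarith [Nat.le_self_pow two_ne_zero n]
    · exact le_rfl
  nlinarith

lemma roundMatrix_ops_le (F : Matrix (Fin n) (Fin n) ℝ) (r c : Fin n → ℝ) :
    (roundMatrix F r c).ops ≤ 17 * n ^ 2 := by
  have h : (roundMatrix F r c).ops = 9 * n ^ 2 + 8 * n := by
    simp only [roundMatrix, Counted.bind_ops, Counted.tabulate_ops, Counted.sum_ops,
      Counted.pure_ops, Counted.div_ops, Counted.min_ops, Counted.mul_ops, Counted.sub_ops,
      Counted.abs_ops, Counted.add_ops, Finset.sum_const, Finset.card_univ, Fintype.card_fin,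
      smul_eq_mul]
    ring
  rw [h]
  nlinarith [Nat.le_self_pow two_ne_zero n]

lemma roundLeaves_ops_le (M : TreeMOT m n) (B : Fin m → Fin m → Matrix (Fin n) (Fin n) ℝ)
    (P : Fin m → Fin n → ℝ) : (M.roundLeaves B P).ops ≤ 17 * m * n ^ 2 := by
  classical
  rw [roundLeaves, Counted.bind_ops, Counted.pure_ops, add_zero, Counted.tabulate_ops]
  refine (Finset.sum_le_card_nsmul _ _ (17 * n ^ 2) fun k _ => ?_).trans_eq ?_
  · rw [ite_ops]
    split_ifs
    · exact roundMatrix_ops_le _ _ _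
    · exact Nat.zero_le _
  · rw [Finset.card_univ, Fintype.card_fin, smul_eq_mul]
    ring

lemma sinkhorn_ops_le (M : TreeMOT m n) (par : Params m n) (κ : ℕ → Fin m) (t : ℕ) :
    (M.sinkhorn par κ t).ops ≤ 5 * m * n ^ 2 + n +
      ∑ s ∈ Finset.range t, 5 * n ^ 2 * (M.G.dist (κ s) (κ (s + 1)) + 1) := by
  induction t with
  | zero =>
    rw [sinkhorn, startState, Counted.bind_ops, updateScaling_ops]
    have h1 := M.updateMessages_ops_le par (M.inwardEdges (κ 0)) (initState m n)
    have h2 := Nat.mul_le_mul_right (5 * n ^ 2) (M.length_inwardEdges_le (κ 0))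
    rw [initState] at h1
    simp only [Finset.range_zero, Finset.sum_empty]
    linarith
  | succ t ih =>
    rw [sinkhorn, Counted.bind_ops, iteration, Counted.bind_ops, updateScaling_ops,
      Finset.sum_range_succ]
    have h1 := M.updateMessages_ops_le par (M.pathEdges (κ t) (κ (t + 1))) (M.sinkhorn par κ t).val
    have h2 : (M.pathEdges (κ t) (κ (t + 1))).length = M.G.dist (κ t) (κ (t + 1)) := by
      rw [pathEdges, List.length_map, SimpleGraph.Walk.length_darts, length_path]
    rw [h2] at h1
    nlinarith [Nat.le_self_pow two_ne_zero n]

lemma runFor_ops_le (M : TreeMOT m n) (hm : 0 < m) (hn : 0 < n) (ε : ℝ) (κ : ℕ → Fin m) (t : ℕ) :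
    (M.runFor ε κ t).ops ≤ 49 * m * n ^ 2 +
      ∑ s ∈ Finset.range t, 5 * n ^ 2 * (M.G.dist (κ s) (κ (s + 1)) + 1) := by
  rw [runFor]
  simp only [Counted.bind_ops]
  have h1 := M.setup_ops_le ε
  have h2 := M.sinkhorn_ops_le (M.setup ε).val κ t
  have h3 := M.updateMessages_ops_le (M.setup ε).val (M.outwardEdges (κ t))
    (M.sinkhorn (M.setup ε).val κ t).val
  have h3' := Nat.mul_le_mul_right (5 * n ^ 2) (M.length_outwardEdges_le (κ t))
  have h4 := M.edgeMatrices_ops_le (M.setup ε).val (M.updateMessages (M.setup ε).val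
        (M.outwardEdges (κ t)) (M.sinkhorn (M.setup ε).val κ t).val).val
  have h5 := M.roundLeaves_ops_le (M.edgeMatrices (M.setup ε).val (M.updateMessages (M.setup ε).val
        (M.outwardEdges (κ t)) (M.sinkhorn (M.setup ε).val κ t).val).val).val
        (M.updateMessages (M.setup ε).val
        (M.outwardEdges (κ t)) (M.sinkhorn (M.setup ε).val κ t).val).val.prod
  have h6 : 1 ≤ m * n ^ 2 := Nat.mul_pos hm (pow_pos hn 2)
  have h7 : n ≤ m * n ^ 2 :=
    (Nat.le_self_pow two_ne_zero n).trans (Nat.le_mul_of_pos_left _ hm)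
  linarith

/-! ### Dependence on the sequence of leaves -/

lemma sinkhorn_congr (M : TreeMOT m n) (par : Params m n) {κ κ' : ℕ → Fin m} {t : ℕ}
    (h : ∀ s ≤ t, κ s = κ' s) : M.sinkhorn par κ t = M.sinkhorn par κ' t := by
  induction t with
  | zero => rw [sinkhorn, sinkhorn, h 0 le_rfl]
  | succ t ih =>
    rw [sinkhorn, sinkhorn, h (t + 1) le_rfl, h t t.le_succ,
      ih fun s hs => h s (hs.trans t.le_succ)]

lemma stopCond_congr (M : TreeMOT m n) (ε : ℝ) {κ κ' : ℕ → Fin m} {t : ℕ}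
    (h : ∀ s ≤ t, κ s = κ' s) : M.StopCond ε κ t ↔ M.StopCond ε κ' t := by
  rw [StopCond, StopCond, M.sinkhorn_congr _ h]

lemma runFor_congr (M : TreeMOT m n) (ε : ℝ) {κ κ' : ℕ → Fin m} {t : ℕ}
    (h : ∀ s ≤ t, κ s = κ' s) : M.runFor ε κ t = M.runFor ε κ' t := by
  rw [runFor, runFor]
  simp only [M.sinkhorn_congr _ h, h t le_rfl]

/-! ### A concave Lyapunov function -/

/-- The concave function of `φ` with derivative `A / max φ s ^ 2` that vanishes at zero: it is linear
for `φ ≤ s`, and it is bounded by `2 * A / s`. -/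
noncomputable def lyapunov (A s φ : ℝ) : ℝ :=
  if φ ≤ s then A * φ / s ^ 2 else 2 * A / s - A / φ

lemma lyapunov_nonneg {A s φ : ℝ} (hA : 0 ≤ A) (hs : 0 < s) (hφ : 0 ≤ φ) :
    0 ≤ lyapunov A s φ := by
  rw [lyapunov]
  split_ifs with h
  · positivity
  · have h1 : A / φ ≤ A / s := by gcongr; exact (not_le.1 h).le
    have h2 : 2 * A / s = A / s + A / s := by ring
    have h3 : 0 ≤ A / s := by positivity
    linarith

lemma lyapunov_le {A s φ : ℝ} (hA : 0 ≤ A) (hs : 0 < s) (hφ : 0 ≤ φ) :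
    lyapunov A s φ ≤ 2 * A / s := by
  have h3 : 0 ≤ A / s := by positivity
  have h2 : 2 * A / s = A / s + A / s := by ring
  rw [lyapunov]
  split_ifs with h
  · have h1 : A * φ / s ^ 2 ≤ A * s / s ^ 2 := by gcongr
    have h4 : A * s / s ^ 2 = A / s := by field_simp
    linarith
  · have : 0 ≤ A / φ := by positivity
    linarith

/-- The tangent inequality for the concave function `lyapunov A s`. -/
lemma lyapunov_tangent {A s φ ψ : ℝ} (hA : 0 ≤ A) (hs : 0 < s) :
    lyapunov A s ψ ≤ lyapunov A s φ + A / max φ s ^ 2 * (ψ - φ) := by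
  -- the difference of the two sides is a fraction with a visibly nonnegative numerator
  rw [lyapunov, lyapunov]
  split_ifs with h1 h2 h2
  · rw [max_eq_right h2]
    apply le_of_eq
    field_simp
    ring
  · rw [max_eq_left (not_le.1 h2).le]
    have hφ : 0 < φ := hs.trans (not_le.1 h2)
    rw [← sub_nonneg]
    have : 2 * A / s - A / φ + A / φ ^ 2 * (ψ - φ) - A * ψ / s ^ 2 =
        A * ((φ - s) * ((s - ψ) * (φ + s) + s * (φ - s))) / (φ ^ 2 * s ^ 2) := by
      field_simp
      ring
    rw [this]
    have h3 : 0 ≤ φ - s := (sub_pos.2 (not_le.1 h2)).le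
    have h4 : 0 ≤ s - ψ := sub_nonneg.2 h1
    positivity
  · rw [max_eq_right h2]
    have hψ : 0 < ψ := hs.trans (not_le.1 h1)
    rw [← sub_nonneg]
    have : A * φ / s ^ 2 + A / s ^ 2 * (ψ - φ) - (2 * A / s - A / ψ) =
        A * (ψ - s) ^ 2 / (s ^ 2 * ψ) := by
      field_simp
      ring
    rw [this]
    positivity
  · rw [max_eq_left (not_le.1 h2).le]
    have hφ : 0 < φ := hs.trans (not_le.1 h2)
    have hψ : 0 < ψ := hs.trans (not_le.1 h1)
    rw [← sub_nonneg]
    have : 2 * A / s - A / φ + A / φ ^ 2 * (ψ - φ) - (2 * A / s - A / ψ) =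
        A * (ψ - φ) ^ 2 / (φ ^ 2 * ψ) := by
      field_simp
      ring
    rw [this]
    positivity

/-! ### Functions of finitely many choices -/

open MeasureTheory

/-- A function of a sequence that depends only on its entries up to the index `t`. -/
def DependsUpTo {X β : Type*} (t : ℕ) (F : (ℕ → X) → β) : Prop :=
  ∀ κ κ' : ℕ → X, (∀ s ≤ t, κ s = κ' s) → F κ = F κ'

/-- Extend a finite sequence by repeating its last entry. -/
def extend {X : Type*} {t : ℕ} (h : Fin (t + 1) → X) (s : ℕ) : X :=
  h ⟨min s t, by omega⟩

lemma DependsUpTo.extend_eq {X β : Type*} {t : ℕ} {F : (ℕ → X) → β} (hF : DependsUpTo t F)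
    (κ : ℕ → X) : F (extend fun i : Fin (t + 1) => κ i) = F κ :=
  hF _ _ fun s hs => by simp [extend, hs]

lemma measurable_prefix (t : ℕ) : Measurable fun (κ : ℕ → Fin m) (i : Fin (t + 1)) => κ i :=
  measurable_pi_lambda _ fun _ => measurable_pi_apply _

lemma DependsUpTo.measurable {t : ℕ} {F : (ℕ → Fin m) → ℝ≥0∞} (hF : DependsUpTo t F) :
    Measurable F := by
  have h : F = (fun h : Fin (t + 1) → Fin m => F (extend h)) ∘ fun κ i => κ i :=
    funext fun κ => (hF.extend_eq κ).symm
  rw [h]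
  exact (measurable_of_countable _).comp (measurable_prefix t)

lemma DependsUpTo.lintegral_eq {t : ℕ} {F : (ℕ → Fin m) → ℝ≥0∞} (hF : DependsUpTo t F)
    (P : Measure (ℕ → Fin m)) :
    ∫⁻ κ, F κ ∂P = ∑ h : Fin (t + 1) → Fin m,
      F (extend h) * P {κ | ∀ s ≤ t, κ s = extend h s} := by
  calc ∫⁻ κ, F κ ∂P
      = ∫⁻ κ, (fun h : Fin (t + 1) → Fin m => F (extend h)) (fun i => κ i) ∂P := by
        simp only [hF.extend_eq]
    _ = ∫⁻ h, F (extend h) ∂(P.map fun (κ : ℕ → Fin m) (i : Fin (t + 1)) => κ i) :=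
        (lintegral_map (f := fun h : Fin (t + 1) → Fin m => F (extend h))
          (measurable_of_countable _) (measurable_prefix t)).symm
    _ = _ := by
        rw [lintegral_fintype]
        refine Finset.sum_congr rfl fun h _ => ?_
        rw [Measure.map_apply (measurable_prefix t) (measurableSet_singleton h)]
        congr 2
        ext κ
        simp only [Set.mem_preimage, Set.mem_singleton_iff, Set.mem_ofPred_eq, funext_iff, extend]
        constructor
        · intro h1 s hs
          simpa [hs] using h1 ⟨s, by omega⟩
        · intro h1 i
          have h2 := h1 i (by omega)
          rw [h2]
          congr 1
          ext
          simp only [inf_eq_left]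
          omega

lemma measurableSet_eval (t : ℕ) (l : Fin m) : MeasurableSet {κ : ℕ → Fin m | κ t = l} :=
  measurableSet_eq_fun (measurable_pi_apply t) measurable_const

open scoped Classical in
lemma IsUpdateLaw.setLIntegral_eq {M : TreeMOT m n} {P : Measure (ℕ → Fin m)}
    (hP : M.IsUpdateLaw P) {t : ℕ} {H : (ℕ → Fin m) → ℝ≥0∞} (hH : DependsUpTo t H) (l : Fin m) :
    ∫⁻ κ in {κ | κ (t + 1) = l}, H κ ∂P =
      ∫⁻ κ, H κ * (if l ∈ M.leaves.erase (κ t) then ((M.leaves.card - 1 : ℕ) : ℝ≥0∞)⁻¹ else 0)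
        ∂P := by
  have hH' : DependsUpTo t fun κ => H κ *
      (if l ∈ M.leaves.erase (κ t) then ((M.leaves.card - 1 : ℕ) : ℝ≥0∞)⁻¹ else 0) := by
    intro κ κ' h
    simp only [hH κ κ' h, h t le_rfl]
  rw [hH.lintegral_eq, hH'.lintegral_eq]
  refine Finset.sum_congr rfl fun h _ => ?_
  rw [mul_assoc]
  congr 1
  have hstep := hP.step t (Function.update (extend h) (t + 1) l)
  rw [Function.update_self, Function.update_of_ne (by omega : t ≠ t + 1)] at hstep
  have h1 : {κ : ℕ → Fin m | ∀ s ≤ t, κ s = Function.update (extend h) (t + 1) l s} =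
      {κ | ∀ s ≤ t, κ s = extend h s} := by
    ext κ
    refine forall₂_congr fun s hs => ?_
    rw [Function.update_of_ne (by omega)]
  have h2 : {κ : ℕ → Fin m | ∀ s ≤ t + 1, κ s = Function.update (extend h) (t + 1) l s} =
      {κ | ∀ s ≤ t, κ s = extend h s} ∩ {κ | κ (t + 1) = l} := by
    rw [← h1]
    ext κ
    simp only [Set.mem_ofPred_eq, Set.mem_inter_iff]
    constructor
    · intro hκ
      exact ⟨fun s hs => hκ s (by omega), by simpa using hκ (t + 1) le_rfl⟩
    · rintro ⟨hκ, hl⟩ s hs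
      rcases Nat.lt_or_ge t s with h3 | h3
      · obtain rfl : s = t + 1 := by omega
        simpa using hl
      · exact hκ s h3
  rw [h1, h2] at hstep
  rw [Measure.restrict_apply' (measurableSet_eval _ _), hstep, mul_comm]

open scoped Classical in
/-- Given the past, the next leaf is uniformly distributed on the leaves other than the present
one. -/
lemma IsUpdateLaw.lintegral_step {M : TreeMOT m n} {P : Measure (ℕ → Fin m)}
    (hP : M.IsUpdateLaw P) {t : ℕ} {F : (ℕ → Fin m) → ℝ≥0∞} (hF : DependsUpTo (t + 1) F) :
    ∫⁻ κ, F κ ∂P = ∫⁻ κ, ∑ l ∈ M.leaves.erase (κ t),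
      F (Function.update κ (t + 1) l) * ((M.leaves.card - 1 : ℕ) : ℝ≥0∞)⁻¹ ∂P := by
  have hFl : ∀ l, DependsUpTo t fun κ => F (Function.update κ (t + 1) l) := by
    intro l κ κ' h
    refine hF _ _ fun s hs => ?_
    rcases Nat.lt_or_ge t s with h3 | h3
    · obtain rfl : s = t + 1 := by omega
      simp
    · rw [Function.update_of_ne (by omega), Function.update_of_ne (by omega), h s h3]
  have hmeas : ∀ l, Measurable fun κ : ℕ → Fin m =>
      ({κ | κ (t + 1) = l} : Set _).indicator (fun κ => F (Function.update κ (t + 1) l)) κ :=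
    fun l => (hFl l).measurable.indicator (measurableSet_eval _ _)
  have hite : ∀ l, Measurable fun κ : ℕ → Fin m => F (Function.update κ (t + 1) l) *
      (if l ∈ M.leaves.erase (κ t) then ((M.leaves.card - 1 : ℕ) : ℝ≥0∞)⁻¹ else 0) := by
    intro l
    refine DependsUpTo.measurable (t := t) fun κ κ' h => ?_
    simp only [hFl l κ κ' h, h t le_rfl]
  calc ∫⁻ κ, F κ ∂P = ∫⁻ κ, ∑ l, ({κ | κ (t + 1) = l} : Set _).indicator
        (fun κ => F (Function.update κ (t + 1) l)) κ ∂P := by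
        refine lintegral_congr fun κ => ?_
        rw [Finset.sum_eq_single (κ (t + 1))]
        · rw [Set.indicator_of_mem (by simp), Function.update_eq_self]
        · intro l _ hl
          rw [Set.indicator_of_notMem]
          exact fun h => hl (Eq.symm h)
        · simp
    _ = ∑ l, ∫⁻ κ, F (Function.update κ (t + 1) l) *
          (if l ∈ M.leaves.erase (κ t) then ((M.leaves.card - 1 : ℕ) : ℝ≥0∞)⁻¹ else 0) ∂P := by
        rw [lintegral_finsetSum _ fun l _ => hmeas l]
        refine Finset.sum_congr rfl fun l _ => ?_
        rw [lintegral_indicator (measurableSet_eval _ _), hP.setLIntegral_eq (hFl l)]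
    _ = _ := by
        rw [← lintegral_finsetSum _ fun l _ => hite l]
        refine lintegral_congr fun κ => ?_
        simp only [mul_ite, mul_zero]
        rw [Finset.sum_ite_mem, Finset.univ_inter]

lemma IsUpdateLaw.ae_mem_leaves {M : TreeMOT m n} {P : Measure (ℕ → Fin m)}
    (hP : M.IsUpdateLaw P) : ∀ᵐ κ ∂P, ∀ t, κ t ∈ M.leaves := by
  classical
  rw [ae_all_iff]
  rintro (_ | t)
  · exact hP.start
  let F : (ℕ → Fin m) → ℝ≥0∞ := fun κ => if κ (t + 1) ∈ M.leaves then 0 else 1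
  have hF : DependsUpTo (t + 1) F := fun κ κ' h => by simp only [F, h (t + 1) le_rfl]
  have h : ∫⁻ κ, F κ ∂P = 0 := by
    rw [hP.lintegral_step hF, lintegral_eq_zero_iff' ?_]
    · refine Filter.Eventually.of_forall fun κ => Finset.sum_eq_zero fun l hl => ?_
      simp [F, Finset.mem_of_mem_erase hl]
    · refine (DependsUpTo.measurable (t := t) fun κ κ' h => ?_).aemeasurable
      simp only [h t le_rfl, F, Function.update_self]
  rw [lintegral_eq_zero_iff hF.measurable] at h
  filter_upwards [h] with κ hκ
  by_contra hne
  simp [F, hne] at hκ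

lemma two_le_card_leaves (M : TreeMOT m n) (hm : 3 ≤ m) : 2 ≤ M.leaves.card := by
  classical
  have : Nontrivial (Fin m) := Fin.nontrivial_iff_two_le.2 (by omega)
  obtain ⟨v, w, hne, hv, hw⟩ := M.isTree.exists_ne_and_degree_eq_one
  have h1 : ∀ v, M.G.degree v = 1 → v ∈ M.leaves := fun v hv =>
    M.mem_leaves.2 (SimpleGraph.degree_eq_one_iff_existsUnique_adj.1 hv)
  exact Finset.one_lt_card.2 ⟨v, h1 v hv, w, h1 w hw, hne⟩

/-! ### The expected number of iterations -/

/-- The stopping criterion fails for all states up to the index `t`, so that the iteration with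
index `t` takes place. -/
def Alive (M : TreeMOT m n) (ε : ℝ) (t : ℕ) (κ : ℕ → Fin m) : Prop :=
  ∀ s ≤ t, ¬M.StopCond ε κ s

open scoped Classical in
/-- The indicator function of `Alive`. -/
noncomputable def alive (M : TreeMOT m n) (ε : ℝ) (t : ℕ) (κ : ℕ → Fin m) : ℝ≥0∞ :=
  if M.Alive ε t κ then 1 else 0

lemma alive_le_one (M : TreeMOT m n) (ε : ℝ) (t : ℕ) (κ : ℕ → Fin m) : M.alive ε t κ ≤ 1 := by
  rw [alive]
  split_ifs <;> simp

lemma alive_succ_le (M : TreeMOT m n) (ε : ℝ) (t : ℕ) (κ : ℕ → Fin m) :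
    M.alive ε (t + 1) κ ≤ M.alive ε t κ := by
  rw [alive, alive]
  split_ifs with h1 h2
  · exact le_rfl
  · exact absurd (fun s hs => h1 s (by omega)) h2
  · exact zero_le
  · exact le_rfl

lemma dependsUpTo_alive (M : TreeMOT m n) (ε : ℝ) (t : ℕ) : DependsUpTo t (M.alive ε t) := by
  classical
  intro κ κ' h
  have : M.Alive ε t κ ↔ M.Alive ε t κ' :=
    forall₂_congr fun s hs => not_congr (M.stopCond_congr ε fun r hr => h r (hr.trans hs))
  rw [alive, alive]
  exact if_congr this rfl rfl

lemma DependsUpTo.mono {X β : Type*} {t t' : ℕ} {F : (ℕ → X) → β} (hF : DependsUpTo t F)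
    (h : t ≤ t') : DependsUpTo t' F :=
  fun κ κ' hκ => hF κ κ' fun s hs => hκ s (hs.trans h)

lemma DependsUpTo.update_succ {X β : Type*} {t : ℕ} {F : (ℕ → X) → β} (hF : DependsUpTo t F)
    (κ : ℕ → X) (l : X) : F (Function.update κ (t + 1) l) = F κ :=
  hF _ _ fun s hs => Function.update_of_ne (by omega) _ _

/-- The value of the Lyapunov function after `t` updates. The parameters are chosen such that its
expected decrease in one step is at least one. -/
noncomputable def energy (M : TreeMOT m n) (ε : ℝ) (t : ℕ) (κ : ℕ → Fin m) : ℝ :=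
  lyapunov (16 * ((M.leaves.card : ℝ) - 1) ^ 2 * (M.leafCost / (M.setup ε).val.eta) ^ 2)
    (2 * (M.leafCost / (M.setup ε).val.eta) * (M.setup ε).val.tol)
    (M.dualGap (M.setup ε).val.eta (M.leafCost / (M.setup ε).val.eta)
      (M.sinkhorn (M.setup ε).val κ t).val.u)

lemma dependsUpTo_energy (M : TreeMOT m n) (ε : ℝ) (t : ℕ) : DependsUpTo t (M.energy ε t) := by
  intro κ κ' h
  rw [energy, energy, M.sinkhorn_congr _ h]

/-- Before the iteration stops, the average of the Lyapunov function over the choices of the next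
leaf is smaller than its present value by at least one. -/
lemma energy_step (M : TreeMOT m n) (hm : 3 ≤ m) (hn : 2 ≤ n) {ε : ℝ} (hε : 0 < ε)
    (hR : 0 < M.leafCost) {κ : ℕ → Fin m} {t : ℕ} (hκ : κ t ∈ M.leaves)
    (hcond : ¬M.StopCond ε κ t) :
    (∑ l ∈ M.leaves.erase (κ t), M.energy ε (t + 1) (Function.update κ (t + 1) l)) *
      ((M.leaves.card : ℝ) - 1)⁻¹ + 1 ≤ M.energy ε t κ := by
  have hn0 : 0 < n := by omega
  have hK := M.gibbsKernel_setup ε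
  have heta := M.setup_eta_pos hm hn hε
  have htol : 0 < (M.setup ε).val.tol := by rw [setup_tol]; positivity
  have hcard : ((M.leaves.erase (κ t)).card : ℝ) = (M.leaves.card : ℝ) - 1 := by
    rw [Finset.card_erase_of_mem hκ, Nat.cast_sub (Finset.card_pos.2 ⟨_, hκ⟩), Nat.cast_one]
  have hN : (0 : ℝ) < (M.leaves.card : ℝ) - 1 := by
    have : (2 : ℝ) ≤ M.leaves.card := by exact_mod_cast M.two_le_card_leaves hm
    linarith
  have hosc := M.oscBound_sinkhorn hm hn0 hK heta κ t
  have hmass := M.sum_scaledTensor_sinkhorn hm hn0 hK κ t hκ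
  have hcond_le : (M.setup ε).val.tol ≤ M.marginalError (M.setup ε).val.eta
      (M.sinkhorn (M.setup ε).val κ t).val.u := not_lt.1 hcond
  simp only [energy]
  set par := (M.setup ε).val with hpar
  set D : ℝ := M.leafCost / par.eta with hD
  have hDpos : 0 < D := div_pos hR heta
  set N : ℝ := (M.leaves.card : ℝ) - 1 with hNdef
  set A : ℝ := 16 * N ^ 2 * D ^ 2 with hA
  set σ : ℝ := 2 * D * par.tol with hσ
  set E : ℝ := M.marginalError par.eta (M.sinkhorn par κ t).val.u with hE
  set φ : ℝ := M.dualGap par.eta D (M.sinkhorn par κ t).val.u with hφ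
  have hgap : 0 ≤ φ ∧ φ ≤ 2 * D * E := M.dualGap_bounds hosc hmass
  let e : Fin m → ℝ := fun l => ∑ a,
    |marginal (M.scaledTensor par.eta (M.sinkhorn par κ t).val.u) l a - M.mu l a|
  have hApos : 0 < A := by positivity
  have hσpos : 0 < σ := by positivity
  -- the marginal at the leaf that was updated last has no error
  have hsum : ∑ l ∈ M.leaves.erase (κ t), e l = E := by
    rw [hE, marginalError, ← Finset.add_sum_erase _ _ hκ, M.marginal_sinkhorn hm hn0 hK κ t hκ]
    simp [e]
  have hmax : 0 < max φ σ := lt_max_of_lt_right hσpos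
  -- the error is bounded below by the tolerance and by the dual gap
  have hmaxE : max φ σ ≤ 2 * D * E := max_le hgap.2
    (mul_le_mul_of_nonneg_left hcond_le (by positivity))
  set c : ℝ := A / max φ σ ^ 2 with hc
  have hcpos : 0 < c := by positivity
  have hl : ∀ l ∈ M.leaves.erase (κ t), lyapunov A σ (M.dualGap par.eta D
      (M.sinkhorn par (Function.update κ (t + 1) l) (t + 1)).val.u) ≤
      lyapunov A σ φ - c * (e l ^ 2 / 4) := by
    intro l hl
    have hcongr : M.sinkhorn par (Function.update κ (t + 1) l) t = M.sinkhorn par κ t :=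
      M.sinkhorn_congr par fun s hs => Function.update_of_ne (by omega) _ _
    have h1 := M.dualGap_sinkhorn_succ_le hm hn0 hK D (Function.update κ (t + 1) l) t
      (by rwa [Function.update_of_ne (by omega)])
      (by rw [Function.update_self]; exact Finset.mem_of_mem_erase hl)
    rw [hcongr, Function.update_self] at h1
    refine (lyapunov_tangent (φ := φ) hApos.le hσpos).trans ?_
    have h2 := mul_le_mul_of_nonneg_left h1 hcpos.le
    rw [mul_add] at h2
    change _ ≤ c * φ at h2
    change _ + c * (e l ^ 2 / 4) ≤ _ at h2
    rw [mul_sub]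
    linarith
  have hcs : E ^ 2 ≤ N * ∑ l ∈ M.leaves.erase (κ t), e l ^ 2 := by
    rw [← hsum, ← hcard]
    exact sq_sum_le_card_mul_sum_sq
  have hfinal : 1 ≤ c * (E ^ 2 / (4 * N ^ 2)) := by
    have h1 : max φ σ ^ 2 ≤ (2 * D * E) ^ 2 := by gcongr
    rw [hc, div_mul_div_comm, le_div_iff₀ (by positivity), one_mul, hA]
    nlinarith [mul_le_mul_of_nonneg_right h1 (by positivity : 0 ≤ 4 * N ^ 2)]
  calc _ ≤ (∑ l ∈ M.leaves.erase (κ t), (lyapunov A σ φ - c * (e l ^ 2 / 4))) * N⁻¹ + 1 := by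
        gcongr with l hl'
        exact hl l hl'
    _ = lyapunov A σ φ - c * ((∑ l ∈ M.leaves.erase (κ t), e l ^ 2) / (4 * N)) + 1 := by
        rw [Finset.sum_sub_distrib, Finset.sum_const, nsmul_eq_mul, hcard, ← Finset.mul_sum,
          ← Finset.sum_div]
        field_simp
    _ ≤ lyapunov A σ φ - c * (E ^ 2 / (4 * N ^ 2)) + 1 := by
        have h1 : E ^ 2 / (4 * N ^ 2) ≤ (∑ l ∈ M.leaves.erase (κ t), e l ^ 2) / (4 * N) := by
          rw [div_le_div_iff₀ (by positivity) (by positivity)]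
          nlinarith [mul_le_mul_of_nonneg_right hcs (by positivity : 0 ≤ 4 * N)]
        have h2 := mul_le_mul_of_nonneg_left h1 hcpos.le
        linarith
    _ ≤ lyapunov A σ φ := by linarith

lemma energy_nonneg (M : TreeMOT m n) (hm : 3 ≤ m) (hn : 2 ≤ n) {ε : ℝ} (hε : 0 < ε)
    (hR : 0 < M.leafCost) {κ : ℕ → Fin m} {t : ℕ} (hκ : κ t ∈ M.leaves) :
    0 ≤ M.energy ε t κ := by
  have hK := M.gibbsKernel_setup ε
  have heta := M.setup_eta_pos hm hn hε
  have htol : 0 < (M.setup ε).val.tol := by rw [setup_tol]; positivity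
  exact lyapunov_nonneg (by positivity) (by positivity)
    (M.dualGap_bounds (M.oscBound_sinkhorn hm (by omega) hK heta κ t)
      (M.sum_scaledTensor_sinkhorn hm (by omega) hK κ t hκ)).1

/-- A bound for the Lyapunov function, and hence for the expected number of iterations: the bound
`2 * A / s` for the parameters in `energy`, with `|Γ|` in place of `|Γ| - 1`. -/
noncomputable def iterationBound (M : TreeMOT m n) (ε : ℝ) : ℝ :=
  256 * (M.leaves.card : ℝ) ^ 2 * M.leafCost ^ 2 * m * Real.log n / ε ^ 2

lemma energy_le (M : TreeMOT m n) (hm : 3 ≤ m) (hn : 2 ≤ n) {ε : ℝ} (hε : 0 < ε)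
    (hR : 0 < M.leafCost) {κ : ℕ → Fin m} {t : ℕ} (hκ : κ t ∈ M.leaves) :
    M.energy ε t κ ≤ M.iterationBound ε := by
  have hK := M.gibbsKernel_setup ε
  have heta := M.setup_eta_pos hm hn hε
  have htol : 0 < (M.setup ε).val.tol := by rw [setup_tol]; positivity
  refine (lyapunov_le (by positivity) (by positivity)
    (M.dualGap_bounds (M.oscBound_sinkhorn hm (by omega) hK heta κ t)
      (M.sum_scaledTensor_sinkhorn hm (by omega) hK κ t hκ)).1).trans ?_
  have h1 : (1 : ℝ) < n := by exact_mod_cast hn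
  have hlog := Real.log_pos h1
  have h2 : (0 : ℝ) < m := by
    have : 0 < m := by omega
    exact_mod_cast this
  have h3 : (2 : ℝ) ≤ M.leaves.card := by exact_mod_cast M.two_le_card_leaves hm
  have h4 : ((M.leaves.card : ℝ) - 1) ^ 2 ≤ (M.leaves.card : ℝ) ^ 2 :=
    pow_le_pow_left₀ (by linarith) (by linarith) 2
  rw [setup_tol, setup_eta, iterationBound]
  calc _ = 256 * ((M.leaves.card : ℝ) - 1) ^ 2 * M.leafCost ^ 2 * m * Real.log n / ε ^ 2 := by
        field_simp
        ring
    _ ≤ _ := by gcongr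

lemma inv_card_sub_one (M : TreeMOT m n) (hm : 3 ≤ m) :
    ((M.leaves.card - 1 : ℕ) : ℝ≥0∞)⁻¹ = ENNReal.ofReal (((M.leaves.card : ℝ) - 1)⁻¹) := by
  have h2 := M.two_le_card_leaves hm
  have h3 : (2 : ℝ) ≤ M.leaves.card := by exact_mod_cast h2
  rw [ENNReal.ofReal_inv_of_pos (by linarith), ← ENNReal.ofReal_natCast,
    Nat.cast_sub (by omega), Nat.cast_one]

/-- The stopped Lyapunov function is a supermartingale with a drift of one before the iteration
stops. -/
lemma lintegral_alive_add_le (M : TreeMOT m n) (hm : 3 ≤ m) (hn : 2 ≤ n) {ε : ℝ} (hε : 0 < ε)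
    (hR : 0 < M.leafCost) {P : Measure (ℕ → Fin m)} (hP : M.IsUpdateLaw P) (t : ℕ) :
    ∫⁻ κ, M.alive ε t κ ∂P +
        ∫⁻ κ, M.alive ε (t + 1) κ * ENNReal.ofReal (M.energy ε (t + 1) κ) ∂P ≤
      ∫⁻ κ, M.alive ε t κ * ENNReal.ofReal (M.energy ε t κ) ∂P := by
  classical
  have hdep : DependsUpTo (t + 1) fun κ =>
      M.alive ε t κ * ENNReal.ofReal (M.energy ε (t + 1) κ) := by
    intro κ κ' h
    simp only [(M.dependsUpTo_alive ε t).mono t.le_succ κ κ' h, M.dependsUpTo_energy ε _ κ κ' h]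
  have h1 : ∫⁻ κ, M.alive ε (t + 1) κ * ENNReal.ofReal (M.energy ε (t + 1) κ) ∂P ≤
      ∫⁻ κ, M.alive ε t κ * ENNReal.ofReal (M.energy ε (t + 1) κ) ∂P :=
    lintegral_mono fun κ => mul_le_mul_left (M.alive_succ_le ε t κ) _
  refine (add_le_add_right h1 _).trans ?_
  rw [hP.lintegral_step hdep, ← lintegral_add_left (M.dependsUpTo_alive ε t).measurable]
  refine lintegral_mono_ae ?_
  filter_upwards [hP.ae_mem_leaves] with κ hκ
  simp only [(M.dependsUpTo_alive ε t).update_succ]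
  by_cases hal : M.Alive ε t κ
  · have h2 := M.energy_step hm hn hε hR (hκ t) (hal t le_rfl)
    have h3 : ∀ l ∈ M.leaves.erase (κ t),
        0 ≤ M.energy ε (t + 1) (Function.update κ (t + 1) l) := fun l hl =>
      M.energy_nonneg hm hn hε hR (by
        rw [Function.update_self]
        exact Finset.mem_of_mem_erase hl)
    have h4 : (0 : ℝ) ≤ ((M.leaves.card : ℝ) - 1)⁻¹ := by
      have h3 : (2 : ℝ) ≤ M.leaves.card := by exact_mod_cast M.two_le_card_leaves hm
      exact inv_nonneg.2 (by linarith)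
    rw [alive, if_pos hal, one_mul]
    simp only [one_mul]
    rw [← Finset.sum_mul, ← ENNReal.ofReal_sum_of_nonneg h3, M.inv_card_sub_one hm,
      ← ENNReal.ofReal_mul (Finset.sum_nonneg h3), ← ENNReal.ofReal_one,
      ← ENNReal.ofReal_add zero_le_one (mul_nonneg (Finset.sum_nonneg h3) h4)]
    exact ENNReal.ofReal_le_ofReal (by linarith)
  · rw [alive, if_neg hal]
    simp

/-- The probabilities that the iteration with index `t` takes place sum up to the expected number of
iterations. -/
lemma tsum_lintegral_alive_le (M : TreeMOT m n) (hm : 3 ≤ m) (hn : 2 ≤ n) {ε : ℝ} (hε : 0 < ε)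
    (hR : 0 < M.leafCost) {P : Measure (ℕ → Fin m)} (hP : M.IsUpdateLaw P) :
    ∑' t, ∫⁻ κ, M.alive ε t κ ∂P ≤ ENNReal.ofReal (M.iterationBound ε) := by
  have := hP.prob
  have h0 : ∫⁻ κ, M.alive ε 0 κ * ENNReal.ofReal (M.energy ε 0 κ) ∂P ≤
      ENNReal.ofReal (M.iterationBound ε) := by
    calc _ ≤ ∫⁻ _, ENNReal.ofReal (M.iterationBound ε) ∂P := by
          refine lintegral_mono_ae ?_
          filter_upwards [hP.ae_mem_leaves] with κ hκ
          refine (mul_le_mul' (M.alive_le_one ε 0 κ)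
            (ENNReal.ofReal_le_ofReal (M.energy_le hm hn hε hR (hκ 0)))).trans_eq (one_mul _)
      _ = _ := by simp
  have h1 : ∀ T, ∑ t ∈ Finset.range T, ∫⁻ κ, M.alive ε t κ ∂P +
      ∫⁻ κ, M.alive ε T κ * ENNReal.ofReal (M.energy ε T κ) ∂P ≤
      ENNReal.ofReal (M.iterationBound ε) := by
    intro T
    induction T with
    | zero => simpa using h0
    | succ T ih =>
      rw [Finset.sum_range_succ, add_assoc]
      exact (add_le_add_right (M.lintegral_alive_add_le hm hn hε hR hP T) _).trans ih
  exact ENNReal.tsum_le_of_sum_range_le fun T => le_self_add.trans (h1 T)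

lemma ae_exists_haltsAt (M : TreeMOT m n) (hm : 3 ≤ m) (hn : 2 ≤ n) {ε : ℝ} (hε : 0 < ε)
    (hR : 0 < M.leafCost) {P : Measure (ℕ → Fin m)} (hP : M.IsUpdateLaw P) :
    ∀ᵐ κ ∂P, ∃ t, M.HaltsAt ε κ t := by
  classical
  have h1 := M.tsum_lintegral_alive_le hm hn hε hR hP
  have hmeas : ∀ t, Measurable (M.alive ε t) := fun t => (M.dependsUpTo_alive ε t).measurable
  rw [← lintegral_tsum fun t => (hmeas t).aemeasurable] at h1
  filter_upwards [ae_lt_top (Measurable.tsum hmeas)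
    (h1.trans_lt ENNReal.ofReal_lt_top).ne] with κ hκ
  have hex : ∃ t, M.StopCond ε κ t := by
    by_contra! hne
    have : ∀ t, M.alive ε t κ = 1 := fun t => by
      have hal : M.Alive ε t κ := fun s _ => hne s
      rw [alive, if_pos hal]
    simp [this] at hκ
  exact ⟨Nat.find hex, Nat.find_spec hex, fun s hs => Nat.find_min hex hs⟩

/-! ### The expected length of the paths -/

/-- The factor `2` bounds the ratio of the numbers of leaves and of possible next leaves. -/
lemma sum_dist_mul_inv_le (M : TreeMOT m n) (hm : 3 ≤ m) :
    (∑ k ∈ M.leaves, ∑ l ∈ M.leaves.erase k, (M.G.dist k l : ℝ≥0∞)) *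
      ((M.leaves.card - 1 : ℕ) : ℝ≥0∞)⁻¹ * ((M.leaves.card - 1 : ℕ) : ℝ≥0∞)⁻¹ ≤
      ENNReal.ofReal (2 * M.avgLeafDist) := by
  have h3 : (2 : ℝ) ≤ M.leaves.card := by exact_mod_cast M.two_le_card_leaves hm
  have h4 : (0 : ℝ) < (M.leaves.card : ℝ) - 1 := by linarith
  have h5 : ∑ k ∈ M.leaves, ∑ l ∈ M.leaves.erase k, (M.G.dist k l : ℝ≥0∞) =
      ENNReal.ofReal (∑ k ∈ M.leaves, ∑ l ∈ M.leaves.erase k, (M.G.dist k l : ℝ)) := by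
    rw [ENNReal.ofReal_sum_of_nonneg fun k _ => by positivity]
    refine Finset.sum_congr rfl fun k _ => ?_
    rw [ENNReal.ofReal_sum_of_nonneg fun k _ => by positivity]
    simp
  have h6 : 0 ≤ ∑ k ∈ M.leaves, ∑ l ∈ M.leaves.erase k, (M.G.dist k l : ℝ) := by positivity
  rw [h5, M.inv_card_sub_one hm, ← ENNReal.ofReal_mul h6, ← ENNReal.ofReal_mul (by positivity)]
  refine ENNReal.ofReal_le_ofReal ?_
  rw [avgLeafDist]
  set S := ∑ k ∈ M.leaves, ∑ l ∈ M.leaves.erase k, (M.G.dist k l : ℝ)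
  rw [← div_eq_mul_inv, ← div_eq_mul_inv, div_div, mul_div_assoc',
    div_le_div_iff₀ (by positivity) (by positivity)]
  have h7 : (M.leaves.card : ℝ) ≤ 2 * ((M.leaves.card : ℝ) - 1) := by linarith
  calc _ = S * ((M.leaves.card : ℝ) - 1) * M.leaves.card := by ring
    _ ≤ S * ((M.leaves.card : ℝ) - 1) * (2 * ((M.leaves.card : ℝ) - 1)) := by gcongr
    _ = _ := by ring

/-- The event that the iteration goes on after `t + 1` updates is contained in the one that it
goes on after `t` updates. The latter does not depend on the next two leaves, whose expected
distance is then bounded by the average over all pairs. -/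
lemma lintegral_alive_mul_dist_succ_le (M : TreeMOT m n) (hm : 3 ≤ m) (ε : ℝ)
    {P : Measure (ℕ → Fin m)} (hP : M.IsUpdateLaw P) (t : ℕ) :
    ∫⁻ κ, M.alive ε (t + 1) κ * (M.G.dist (κ (t + 1)) (κ (t + 2)) : ℝ≥0∞) ∂P ≤
      ∫⁻ κ, M.alive ε t κ * ENNReal.ofReal (2 * M.avgLeafDist) ∂P := by
  set N : ℝ≥0∞ := ((M.leaves.card - 1 : ℕ) : ℝ≥0∞)⁻¹ with hN
  have hal := M.dependsUpTo_alive ε t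
  have hdep2 : DependsUpTo (t + 1 + 1) fun κ =>
      M.alive ε t κ * (M.G.dist (κ (t + 1)) (κ (t + 2)) : ℝ≥0∞) := by
    intro κ κ' h
    simp only [hal.mono (by omega : t ≤ t + 1 + 1) κ κ' h, h (t + 1) (by omega),
      h (t + 2) (by omega)]
  have hdep1 : DependsUpTo (t + 1) fun κ => ∑ l ∈ M.leaves.erase (κ (t + 1)),
      M.alive ε t κ * (M.G.dist (κ (t + 1)) l : ℝ≥0∞) * N := by
    intro κ κ' h
    simp only [hal.mono (by omega : t ≤ t + 1) κ κ' h, h (t + 1) (by omega)]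
  calc ∫⁻ κ, M.alive ε (t + 1) κ * (M.G.dist (κ (t + 1)) (κ (t + 2)) : ℝ≥0∞) ∂P
      ≤ ∫⁻ κ, M.alive ε t κ * (M.G.dist (κ (t + 1)) (κ (t + 2)) : ℝ≥0∞) ∂P :=
        lintegral_mono fun κ => mul_le_mul_left (M.alive_succ_le ε t κ) _
    _ = ∫⁻ κ, ∑ l ∈ M.leaves.erase (κ (t + 1)),
          M.alive ε t κ * (M.G.dist (κ (t + 1)) l : ℝ≥0∞) * N ∂P := by
        rw [hP.lintegral_step hdep2]
        refine lintegral_congr fun κ => Finset.sum_congr rfl fun l _ => ?_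
        rw [(hal.mono (t.le_succ)).update_succ, Function.update_self,
          Function.update_of_ne (by omega)]
    _ = ∫⁻ κ, ∑ k ∈ M.leaves.erase (κ t), (∑ l ∈ M.leaves.erase k,
          M.alive ε t κ * (M.G.dist k l : ℝ≥0∞) * N) * N ∂P := by
        rw [hP.lintegral_step hdep1]
        simp only [hal.update_succ, Function.update_self, hN]
    _ ≤ _ := by
        refine lintegral_mono fun κ => ?_
        refine (Finset.sum_le_sum_of_subset (Finset.erase_subset _ _)).trans ?_
        simp only [← Finset.sum_mul, ← Finset.mul_sum, mul_assoc]
        gcongr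
        rw [← mul_assoc]
        exact M.sum_dist_mul_inv_le hm

/-- The law of the first leaf is arbitrary, so the length of the first path is only bounded by the
number of vertices. -/
lemma lintegral_alive_mul_dist_zero_le (M : TreeMOT m n) (ε : ℝ)
    {P : Measure (ℕ → Fin m)} (hP : M.IsUpdateLaw P) :
    ∫⁻ κ, M.alive ε 0 κ * (M.G.dist (κ 0) (κ 1) : ℝ≥0∞) ∂P ≤ m := by
  have := hP.prob
  calc _ ≤ ∫⁻ _, (m : ℝ≥0∞) ∂P := by
        refine lintegral_mono fun κ => ?_
        refine (mul_le_mul' (M.alive_le_one ε 0 κ) (Nat.cast_le.2 (M.dist_lt _ _).le)).trans_eq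
          (one_mul _)
    _ = m := by simp

lemma tsum_lintegral_alive_mul_dist_le (M : TreeMOT m n) (hm : 3 ≤ m) (hn : 2 ≤ n) {ε : ℝ}
    (hε : 0 < ε) (hR : 0 < M.leafCost) {P : Measure (ℕ → Fin m)} (hP : M.IsUpdateLaw P) :
    ∑' t, ∫⁻ κ, M.alive ε t κ * (M.G.dist (κ t) (κ (t + 1)) : ℝ≥0∞) ∂P ≤
      m + ENNReal.ofReal (M.iterationBound ε) * ENNReal.ofReal (2 * M.avgLeafDist) := by
  rw [tsum_eq_zero_add' ENNReal.summable]
  refine add_le_add (M.lintegral_alive_mul_dist_zero_le ε hP) ?_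
  refine (ENNReal.tsum_le_tsum fun t => M.lintegral_alive_mul_dist_succ_le hm ε hP t).trans ?_
  simp only [lintegral_mul_const _ (M.dependsUpTo_alive ε _).measurable]
  rw [ENNReal.tsum_mul_right]
  gcongr
  exact M.tsum_lintegral_alive_le hm hn hε hR hP

/-! ### The expected number of operations -/

lemma HaltsAt.unique {M : TreeMOT m n} {ε : ℝ} {κ : ℕ → Fin m} {t t' : ℕ}
    (h : M.HaltsAt ε κ t) (h' : M.HaltsAt ε κ t') : t = t' := by
  by_contra hne
  rcases Nat.lt_or_gt_of_ne hne with hlt | hlt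
  · exact h'.2 t hlt h.1
  · exact h.2 t' hlt h'.1

lemma HaltsAt.opCount_eq {M : TreeMOT m n} {ε : ℝ} {κ : ℕ → Fin m} {t : ℕ}
    (h : M.HaltsAt ε κ t) : M.opCount ε κ = ((M.runFor ε κ t).ops : ℝ≥0∞) := by
  have hex : ∃ t, M.HaltsAt ε κ t := ⟨t, h⟩
  rw [opCount, dif_pos hex, hex.choose_spec.unique h]

open scoped Classical in
/-- The method halts at one index at most, which makes the number of operations an infimum of
functions of finitely many choices. -/
lemma opCount_eq_iInf (M : TreeMOT m n) (ε : ℝ) (κ : ℕ → Fin m) :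
    M.opCount ε κ = ⨅ t, if M.HaltsAt ε κ t then ((M.runFor ε κ t).ops : ℝ≥0∞) else ⊤ := by
  by_cases hex : ∃ t, M.HaltsAt ε κ t
  · obtain ⟨t, h⟩ := hex
    rw [h.opCount_eq]
    refine le_antisymm (le_iInf fun t' => ?_) (iInf_le_of_le t (by rw [if_pos h]))
    split_ifs with h'
    · rw [h.unique h']
    · exact le_top
  · rw [opCount, dif_neg hex]
    push Not at hex
    simp [hex]

lemma measurable_opCount (M : TreeMOT m n) (ε : ℝ) : Measurable (M.opCount ε) := by
  classical
  rw [funext (M.opCount_eq_iInf ε)]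
  refine Measurable.iInf fun t => DependsUpTo.measurable (t := t) fun κ κ' h => ?_
  have h1 : M.HaltsAt ε κ t ↔ M.HaltsAt ε κ' t :=
    and_congr (M.stopCond_congr ε h) (forall₂_congr fun s hs =>
      not_congr (M.stopCond_congr ε fun r hr => h r (by omega)))
  rw [M.runFor_congr ε h]
  exact if_congr h1 rfl rfl

lemma HaltsAt.opCount_le {M : TreeMOT m n} {ε : ℝ} {κ : ℕ → Fin m} {t : ℕ}
    (h : M.HaltsAt ε κ t) (hm : 0 < m) (hn : 0 < n) :
    M.opCount ε κ ≤ 49 * m * n ^ 2 + ∑' s, 5 * (n : ℝ≥0∞) ^ 2 *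
      (M.alive ε s κ * (M.G.dist (κ s) (κ (s + 1)) : ℝ≥0∞) + M.alive ε s κ) := by
  rw [h.opCount_eq]
  have h1 : ((M.runFor ε κ t).ops : ℝ≥0∞) ≤ ((49 * m * n ^ 2 +
      ∑ s ∈ Finset.range t, 5 * n ^ 2 * (M.G.dist (κ s) (κ (s + 1)) + 1) : ℕ) : ℝ≥0∞) :=
    Nat.cast_le.2 (M.runFor_ops_le hm hn ε κ t)
  refine h1.trans ?_
  push_cast
  gcongr
  refine le_trans (Finset.sum_le_sum fun s hs => ?_) (ENNReal.sum_le_tsum (Finset.range t))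
  have hal : M.Alive ε s κ := fun r hr => h.2 r (hr.trans_lt (Finset.mem_range.1 hs))
  rw [alive, if_pos hal, one_mul]

lemma lintegral_opCount_le (M : TreeMOT m n) (hm : 3 ≤ m) (hn : 2 ≤ n) {ε : ℝ}
    (hε : 0 < ε) (hR : 0 < M.leafCost) {P : Measure (ℕ → Fin m)} (hP : M.IsUpdateLaw P) :
    ∫⁻ κ, M.opCount ε κ ∂P ≤ 49 * m * n ^ 2 + 5 * (n : ℝ≥0∞) ^ 2 *
      ((m + ENNReal.ofReal (M.iterationBound ε) * ENNReal.ofReal (2 * M.avgLeafDist)) +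
        ENNReal.ofReal (M.iterationBound ε)) := by
  have := hP.prob
  have hmeas1 : ∀ s, Measurable fun κ : ℕ → Fin m =>
      M.alive ε s κ * (M.G.dist (κ s) (κ (s + 1)) : ℝ≥0∞) := by
    intro s
    refine DependsUpTo.measurable (t := s + 1) fun κ κ' h => ?_
    simp only [(M.dependsUpTo_alive ε s).mono s.le_succ κ κ' h, h s s.le_succ, h (s + 1) le_rfl]
  have hmeas2 : ∀ s, Measurable (M.alive ε s) := fun s => (M.dependsUpTo_alive ε s).measurable
  calc ∫⁻ κ, M.opCount ε κ ∂P
      ≤ ∫⁻ κ, (49 * m * n ^ 2 + ∑' s, 5 * (n : ℝ≥0∞) ^ 2 *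
          (M.alive ε s κ * (M.G.dist (κ s) (κ (s + 1)) : ℝ≥0∞) + M.alive ε s κ)) ∂P := by
        refine lintegral_mono_ae ?_
        filter_upwards [M.ae_exists_haltsAt hm hn hε hR hP] with κ ⟨t, ht⟩
        exact ht.opCount_le (by omega) (by omega)
    _ = 49 * m * n ^ 2 + 5 * (n : ℝ≥0∞) ^ 2 *
          (∑' s, ∫⁻ κ, M.alive ε s κ * (M.G.dist (κ s) (κ (s + 1)) : ℝ≥0∞) ∂P +
            ∑' s, ∫⁻ κ, M.alive ε s κ ∂P) := by
        have hmeas3 : ∀ s, AEMeasurable (fun κ : ℕ → Fin m => 5 * (n : ℝ≥0∞) ^ 2 *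
            (M.alive ε s κ * (M.G.dist (κ s) (κ (s + 1)) : ℝ≥0∞) + M.alive ε s κ)) P :=
          fun s => (((hmeas1 s).add (hmeas2 s)).const_mul _).aemeasurable
        rw [lintegral_add_left measurable_const, lintegral_const, measure_univ, mul_one,
          lintegral_tsum hmeas3]
        congr 1
        rw [← ENNReal.tsum_add, ← ENNReal.tsum_mul_left]
        refine tsum_congr fun s => ?_
        rw [← lintegral_add_left (hmeas1 s)]
        exact lintegral_const_mul _ ((hmeas1 s).add (hmeas2 s))
    _ ≤ _ := by
        gcongr
        · exact M.tsum_lintegral_alive_mul_dist_le hm hn hε hR hP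
        · exact M.tsum_lintegral_alive_le hm hn hε hR hP

lemma one_le_avgLeafDist (M : TreeMOT m n) (hm : 3 ≤ m) : 1 ≤ M.avgLeafDist := by
  have h2 := M.two_le_card_leaves hm
  have h3 : (2 : ℝ) ≤ M.leaves.card := by exact_mod_cast h2
  rw [avgLeafDist, one_le_div (mul_pos (by linarith) (by linarith))]
  have h4 : ∀ k ∈ M.leaves, (M.leaves.card : ℝ) - 1 ≤
      ∑ l ∈ M.leaves.erase k, (M.G.dist k l : ℝ) := by
    intro k hk
    have h5 : ∑ l ∈ M.leaves.erase k, (1 : ℝ) ≤ ∑ l ∈ M.leaves.erase k, (M.G.dist k l : ℝ) := by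
      refine Finset.sum_le_sum fun l hl => ?_
      have := M.isTree.connected.pos_dist_of_ne (Finset.ne_of_mem_erase hl).symm
      exact_mod_cast this
    rw [Finset.sum_const, Finset.card_erase_of_mem hk, nsmul_eq_mul, mul_one,
      Nat.cast_sub (by omega), Nat.cast_one] at h5
    exact h5
  have h6 := Finset.sum_le_sum h4
  rwa [Finset.sum_const, nsmul_eq_mul] at h6

/-- The condition `ε ≤ |Γ| R` makes the bound dominate the operations outside of the iteration. -/
lemma opCount_bound_le (M : TreeMOT m n) (hm : 3 ≤ m) (hn : 2 ≤ n) {ε : ℝ} (hε : 0 < ε)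
    (hle : ε ≤ (M.leaves.card : ℝ) * M.leafCost) :
    49 * m * n ^ 2 + 5 * (n : ℝ≥0∞) ^ 2 *
      ((m + ENNReal.ofReal (M.iterationBound ε) * ENNReal.ofReal (2 * M.avgLeafDist)) +
        ENNReal.ofReal (M.iterationBound ε)) ≤
      ENNReal.ofReal (4000 * (M.avgLeafDist * (m : ℝ) * (M.leaves.card : ℝ) ^ 2 * (n : ℝ) ^ 2 *
              M.leafCost ^ 2 * Real.log n / ε ^ 2)) := by
  have hd := M.one_le_avgLeafDist hm
  have hn' : (2 : ℝ) ≤ n := by exact_mod_cast hn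
  have hlog : 1 / 2 ≤ Real.log n := by
    have h1 := Real.log_le_log two_pos hn'
    have h2 := Real.log_two_gt_d9
    linarith
  have hI : 0 ≤ M.iterationBound ε := by
    have : 0 ≤ Real.log n := by linarith
    rw [iterationBound]
    positivity
  set X : ℝ := M.avgLeafDist * (m : ℝ) * (M.leaves.card : ℝ) ^ 2 * (n : ℝ) ^ 2 *
              M.leafCost ^ 2 * Real.log n / ε ^ 2 with hX
  have h1 : 49 * m * n ^ 2 + 5 * (n : ℝ≥0∞) ^ 2 *
      ((m + ENNReal.ofReal (M.iterationBound ε) * ENNReal.ofReal (2 * M.avgLeafDist)) +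
        ENNReal.ofReal (M.iterationBound ε)) =
      ENNReal.ofReal (49 * m * n ^ 2 + 5 * n ^ 2 *
        ((m + M.iterationBound ε * (2 * M.avgLeafDist)) + M.iterationBound ε)) := by
    have e1 : ENNReal.ofReal (49 * m * n ^ 2) = 49 * m * n ^ 2 := by
      rw [ENNReal.ofReal_mul (by positivity), ENNReal.ofReal_mul (by positivity),
        ENNReal.ofReal_pow (by positivity), ENNReal.ofReal_natCast, ENNReal.ofReal_natCast]
      simp
    have e2 : ENNReal.ofReal (5 * n ^ 2) = 5 * n ^ 2 := by
      rw [ENNReal.ofReal_mul (by positivity), ENNReal.ofReal_pow (by positivity),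
        ENNReal.ofReal_natCast]
      simp
    rw [ENNReal.ofReal_add (by positivity) (by positivity),
      ENNReal.ofReal_mul (p := 5 * (n : ℝ) ^ 2) (by positivity),
      ENNReal.ofReal_add (by positivity) hI, ENNReal.ofReal_add (by positivity) (by positivity),
      ENNReal.ofReal_mul hI, e1, e2, ENNReal.ofReal_natCast]
  rw [h1]
  refine ENNReal.ofReal_le_ofReal ?_
  have hq : 1 ≤ ((M.leaves.card : ℝ) * M.leafCost / ε) ^ 2 :=
    one_le_pow₀ ((one_le_div hε).2 hle)
  have h2 : (m : ℝ) * n ^ 2 ≤ 2 * X := by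
    calc (m : ℝ) * n ^ 2 = 2 * (1 * (m * n ^ 2) * 1 * (1 / 2)) := by ring
      _ ≤ 2 * (M.avgLeafDist * (m * n ^ 2) * ((M.leaves.card : ℝ) * M.leafCost / ε) ^ 2 *
          Real.log n) := by gcongr
      _ = 2 * X := by
        rw [hX]
        field_simp
  have h3 : n ^ 2 * M.iterationBound ε * M.avgLeafDist = 256 * X := by
    rw [hX, iterationBound]
    ring
  have h4 : n ^ 2 * M.iterationBound ε ≤ 256 * X := by
    rw [← h3]
    exact le_mul_of_one_le_right (by positivity) hd
  have h5 : 0 ≤ X := by linarith [show (0 : ℝ) ≤ m * n ^ 2 by positivity]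
  calc _ = 54 * (m * n ^ 2) + 10 * (n ^ 2 * M.iterationBound ε * M.avgLeafDist) +
        5 * (n ^ 2 * M.iterationBound ε) := by ring
    _ ≤ 4000 * X := by linarith

end TreeMOT

theorem mainTheorem3 :
    ∃ c : ℝ, 0 < c ∧
      ∀ (m n : ℕ), 3 ≤ m → 2 ≤ n →
      ∀ (M : TreeMOT m n) (ε : ℝ), 0 < ε → ε ≤ (M.leaves.card : ℝ) * M.leafCost →
      ∀ P : MeasureTheory.Measure (ℕ → Fin m), M.IsUpdateLaw P →
        (∀ᵐ κ ∂P, ∃ t, M.HaltsAt ε κ t ∧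
          (∀ k l, M.G.Adj k l →
            TreeMOT.bimarginal (M.treeTensor (M.runFor ε κ t).val) k l =
              (M.runFor ε κ t).val k l) ∧
          M.IsApproxSolution ε (M.treeTensor (M.runFor ε κ t).val)) ∧
        Measurable (M.opCount ε) ∧
        ∫⁻ κ, M.opCount ε κ ∂P ≤
          ENNReal.ofReal
            (c * (M.avgLeafDist * (m : ℝ) * (M.leaves.card : ℝ) ^ 2 * (n : ℝ) ^ 2 *
              M.leafCost ^ 2 * Real.log n / ε ^ 2)) := by
  -- `54 * 2` for the operations outside of the iteration, and `15 * 256` for the iterations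
  refine ⟨4000, by norm_num, fun m n hm hn M ε hε hle P hP => ?_⟩
  have hR : 0 < M.leafCost := by
    have h1 : 0 < (M.leaves.card : ℝ) * M.leafCost := hε.trans_le hle
    exact pos_of_mul_pos_right h1 (Nat.cast_nonneg _)
  refine ⟨?_, M.measurable_opCount ε,
    (M.lintegral_opCount_le hm hn hε hR hP).trans (M.opCount_bound_le hm hn hε hle)⟩
  filter_upwards [M.ae_exists_haltsAt hm hn hε hR hP, hP.ae_mem_leaves] with κ ⟨t, ht⟩ hκ
  exact ⟨t, ht, M.runFor_spec hm hn hε hR (hκ t) ht.1⟩
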